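/- Let $\mu$ be the Möbius function and $B_r$ the $r$-th Bernoulli number. We work with formal Laurent series in $u$ with coefficients in $\mathbb Q[w]$; logarithms, exponentials and inverses are expanded formally in $u$. For $\ell\ge 1$ put $$E_\ell=\frac1\ell\sum_{d\mid\ell}\mu(\ell/d)\,u^{-d},\qquad \lambda_\ell=u^\ell(1-u^\ell)\,\ell,\qquad W_\ell=\frac1\ell\sum_{d\mid\ell}\mu(\ell/d)\,(1-w^d),\qquad B(z)=\sum_{r\ge2}\frac{B_r}{r(r-1)}\frac1{z^{r-1}},$$ $$\mathbf A_\ell=W_\ell\bigl(\log(\lambda_\ell E_\ell)-1\bigr)+\bigl(-E_\ell+W_\ell-\tfrac12\bigr)\log\Bigl(1-\frac{W_\ell}{E_\ell}\Bigr),\qquad \mathbf B_\ell=B(-E_\ell+W_\ell)-B(-E_\ell),$$ $$\mathbb A=\exp\Bigl(\sum_{\ell\ge1}\mathbf A_\ell+\sum_{\ell\ge2}\mathbf B_\ell\Bigr)-1,\qquad \mathbb B=\exp(\mathbf B_1)-1.$$ Let $T_{\le10}$ be the operator that replaces each $u$-coefficient $\sum_i a_iw^i$ by $\sum_{i=0}^{10}a_i$.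 The weight $11$ generating function $Z=-u\,T_{\le10}\bigl((\mathbb A+1)(\mathbb B+1)-1\bigr)$, which by a theorem of Payne and Willwacher equals $\frac12\sum_{g\ge2}u^g\chi_{11}(\mathcal M_g)$, splits as $Z=L+R$ with leading term $L=-u\,T_{\le10}(\mathbf B_1)$ and remainder $$R=-u\,T_{\le10}\Bigl(\sum_{k\ge2}\frac1{k!}\mathbf B_1^k\Bigr)-u\,T_{\le10}(\mathbb A)-u\,T_{\le10}(\mathbb A\mathbb B).$$ Let $R_g\in\mathbb Q$ be the coefficient of $u^g$ in $R$, and let $$C_\infty^{ev}=\frac{1024\,\pi^2}{10!}\bigl(14175-4725\pi^2+630\pi^4-45\pi^6+2\pi^8\bigr),$$ $$C_\infty^{odd}=\frac{4\pi\cdot1280}{10!}\Bigl(2835+2\pi^2\bigl(-945+189\pi^2-18\pi^4+\pi^6\bigr)\Bigr).$$ **Theorem.** Put $E_g:=\dfrac{|R_g|}{(g-2)!\,(2\pi)^{-g}}$ for $g\ge2$. Then $E_g\to0$ as $g\to\infty$, and for all $g\ge600$ one has $E_g\le\frac12\min\bigl(C_\infty^{ev},C_\infty^{odd}\bigr)$.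 -/

import Mathlib

noncomputable section

namespace WeightEleven

open Polynomial PowerSeries

/-- Laurent series in the formal variable `u` with coefficients in the polynomial ring `ℚ[w]`. -/
abbrev Ser : Type := LaurentSeries ℚ[X]

/-- The variable `u`. -/
def u : Ser := HahnSeries.single 1 1

/-- A rational constant. -/
def const (q : ℚ) : Ser := HahnSeries.C (Polynomial.C q)

/-- A polynomial in `w`, seen as a Laurent series constant in `u`. -/
def ofPoly (p : ℚ[X]) : Ser := HahnSeries.C p

/-- `log f = ∑_{m ≥ 1} (-1)^(m+1) (f - 1)^m / m`, for `f` with `f - 1` of positive order in `u`. -/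
def log (f : Ser) : Ser := PowerSeries.heval (f - 1) (PowerSeries.log ℚ[X])

/-- `exp f = ∑_{k ≥ 0} f^k / k!`, for `f` of positive order in `u`. -/
def exp (f : Ser) : Ser := PowerSeries.heval f (PowerSeries.exp ℚ[X])

/-- `∑_{k ≥ 2} f^k / k!`, for `f` of positive order in `u`. -/
def expTail (f : Ser) : Ser :=
  PowerSeries.heval f
    (PowerSeries.mk fun k : ℕ => if 2 ≤ k then Polynomial.C (1 / (k.factorial : ℚ)) else 0)

/-- `B(z) = ∑_{r ≥ 2} B_r / (r (r - 1)) * z^{-(r-1)}`, for an invertible `z` whose inverse has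
positive order in `u`. The summation index is `k = r - 1`. -/
def B (z : Ser) : Ser :=
  PowerSeries.heval (Ring.inverse z)
    (PowerSeries.mk fun k : ℕ =>
      if 1 ≤ k then Polynomial.C (_root_.bernoulli (k + 1) / (((k : ℚ) + 1) * k)) else 0)

/-- `E_ℓ = (1/ℓ) ∑_{d ∣ ℓ} μ(ℓ/d) u^{-d}`. -/
def E (l : ℕ) : Ser :=
  const (1 / l) * ∑ d ∈ l.divisors,
    const (ArithmeticFunction.moebius (l / d)) * HahnSeries.single (-(d : ℤ)) 1

/-- `λ_ℓ = u^ℓ (1 - u^ℓ) ℓ`. -/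
def lam (l : ℕ) : Ser := u ^ l * (1 - u ^ l) * const l

/-- `W_ℓ = (1/ℓ) ∑_{d ∣ ℓ} μ(ℓ/d) (1 - w^d)`. -/
def W (l : ℕ) : Ser :=
  ofPoly (Polynomial.C (1 / (l : ℚ)) * ∑ d ∈ l.divisors,
    Polynomial.C (ArithmeticFunction.moebius (l / d) : ℚ) * (1 - Polynomial.X ^ d))

/-- `𝐀_ℓ = W_ℓ (log(λ_ℓ E_ℓ) - 1) + (-E_ℓ + W_ℓ - 1/2) log(1 - W_ℓ / E_ℓ)`. -/
def bA (l : ℕ) : Ser :=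
  W l * (log (lam l * E l) - 1)
    + (-E l + W l - const (1 / 2)) * log (1 - W l * Ring.inverse (E l))

/-- `𝐁_ℓ = B(-E_ℓ + W_ℓ) - B(-E_ℓ)`. -/
def bB (l : ℕ) : Ser := B (-E l + W l) - B (-E l)

/-- The formal sum `∑_{ℓ ≥ a} f_ℓ`, taken coefficientwise, of series without negative powers
of `u` such that every power of `u` occurs in only finitely many of them. -/
def sumFrom (a : ℕ) (f : ℕ → Ser) : Ser :=
  HahnSeries.ofPowerSeries ℤ ℚ[X]
    (PowerSeries.mk fun n : ℕ => ∑ᶠ (l : ℕ) (_ : a ≤ l), (f l).coeff (n : ℤ))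

/-- `𝔸 = exp(∑_{ℓ ≥ 1} 𝐀_ℓ + ∑_{ℓ ≥ 2} 𝐁_ℓ) - 1`. -/
def bbA : Ser := exp (sumFrom 1 bA + sumFrom 2 bB) - 1

/-- `𝔹 = exp(𝐁_1) - 1`. -/
def bbB : Ser := exp (bB 1) - 1

/-- The truncation `∑ a_i w^i ↦ ∑_{i ≤ Γ} a_i` on polynomials in `w`. -/
def truncPoly (Γ : ℕ) : ℚ[X] →ₗ[ℚ] ℚ := ∑ i ∈ Finset.range (Γ + 1), Polynomial.lcoeff ℚ i

/-- The truncation operator `T_{≤ Γ}`, applied to every coefficient of a series in `u`. -/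
def T (Γ : ℕ) (f : Ser) : LaurentSeries ℚ := HahnSeries.map f (truncPoly Γ)

/-- The remainder
`R = -u T_{≤10}(∑_{k ≥ 2} 𝐁_1^k / k!) - u T_{≤10}(𝔸) - u T_{≤10}(𝔸 𝔹)`. -/
def R : LaurentSeries ℚ :=
  -(HahnSeries.single 1 1 * T 10 (expTail (bB 1)))
    - HahnSeries.single 1 1 * T 10 bbA
    - HahnSeries.single 1 1 * T 10 (bbA * bbB)

/-- `R_g`, the coefficient of `u^g` in `R`. -/
def Rcoeff (g : ℕ) : ℚ := R.coeff (g : ℤ)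

/-- The relative error `E_g = |R_g| / ((g-2)! (2π)^{-g})`, for `g ≥ 2`. -/
def relError (g : ℕ) : ℝ :=
  |(Rcoeff g : ℝ)| / (((g - 2).factorial : ℝ) * ((2 * Real.pi) ^ g)⁻¹)

/-- The constant `C_∞^ev ≈ 12.8765`. -/
def Cev : ℝ :=
  1 / (Nat.factorial 10 : ℝ) * 1024 * Real.pi ^ 2 *
    (14175 - 4725 * Real.pi ^ 2 + 630 * Real.pi ^ 4 - 45 * Real.pi ^ 6 + 2 * Real.pi ^ 8)

/-- The constant `C_∞^odd ≈ 23.7991`. -/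
def Codd : ℝ :=
  4 * Real.pi / (Nat.factorial 10 : ℝ) * 1280 *
    (2835 + 2 * Real.pi ^ 2 *
      (-945 + 189 * Real.pi ^ 2 - 18 * Real.pi ^ 4 + Real.pi ^ 6))

end WeightEleven

end

noncomputable section

namespace WeightEleven

open scoped Polynomial PowerSeries

/-! ### The truncated `ℓ¹` seminorm on `ℚ[w]` -/

/-! Algebra first. The three pieces of `R` combine to `-u T(exp(∑ 𝐀_ℓ + ∑ 𝐁_ℓ) - 1 - 𝐁_1)`, and
every `𝐀_ℓ`, `𝐁_ℓ` is a power series in `u` without constant term. The exponent splits into a tame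
and a factorially divergent part. For `ℓ = 1` the difference equation of the Bernoulli polynomials
replaces `B(-1/u + 1 - w)` by `B(-1/u - w)` plus an elementary series; its powers of `1 - w` cancel
against those of `𝐀_1` (`serA_one_add_serB_one`). Hence the exponential is `expConv * expDiv`, where
`expConv` is the exponential of `serOne` and all terms with `ℓ ≥ 2`, and `expDiv` is the exponential
of `D = bernDiff (-w)`.

Sizes are measured by the ℓ¹ seminorm modulo `w^11`, which is submultiplicative and dominates `T`.
The coefficients of `D` and of `exp D` are at most a constant times `growth n = (n-1)!/(2π)^n`, and
the two series differ only to lower order (`nrm_coeff_expDiv_le`, `nrm_coeff_expDiv_sub_le`),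
because products of factorials are dominated by their extreme terms. The series `𝐁_ℓ` with `ℓ ≥ 2`
diverge too, but only like `(n/ℓ)!`; so if they are cut at order `n` and weighted by `r^i` with `n
r² ≤ 1`, they stay bounded, and the coefficients of `expConv` are at most `5 r^{-k}`
(`nrm_coeff_expConv_le`).

The coefficient of `u^n` in `expConv * expDiv - 𝐁_1` is then a convolution. Its term `k = 0` is the
small difference `exp D - D`, up to an elementary error. Its term `k = 1` has the factor `w - 1`, on
which `T` telescopes to the single coefficient of `w^10`; this makes the constant small. The terms
`k ≥ 2` lose `k` factors of the factorial against at most `5 r^{-k}`, with `r` adapted to the range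
of `k`. Altogether `(n-1)|R_{n+1}| ≤ 600 growth n` for `n ≥ 599` (`abs_Rcoeff_le`), so the relative
error is at most `3771/(g-2)`. This tends to `0` and is below `6.4` from `g = 600` on, while both
constants exceed `12.8`. -/

/-- The sum of the absolute values of the coefficients of `w^0, …, w^10`. -/
def nrm (p : ℚ[X]) : ℝ := ∑ i ∈ Finset.range 11, |(p.coeff i : ℝ)|

lemma nrm_nonneg (p : ℚ[X]) : 0 ≤ nrm p := Finset.sum_nonneg fun _ _ => abs_nonneg _

@[simp] lemma nrm_zero : nrm 0 = 0 := by simp [nrm]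

lemma nrm_add_le (p q : ℚ[X]) : nrm (p + q) ≤ nrm p + nrm q := by
  simp only [nrm, ← Finset.sum_add_distrib]
  refine Finset.sum_le_sum fun i _ => ?_
  simpa using abs_add_le (p.coeff i : ℝ) (q.coeff i)

@[simp] lemma nrm_neg (p : ℚ[X]) : nrm (-p) = nrm p := by simp [nrm]

lemma nrm_sub_le (p q : ℚ[X]) : nrm (p - q) ≤ nrm p + nrm q := by
  simpa [sub_eq_add_neg] using nrm_add_le p (-q)

lemma nrm_sum_le {ι : Type*} (s : Finset ι) (f : ι → ℚ[X]) :
    nrm (∑ i ∈ s, f i) ≤ ∑ i ∈ s, nrm (f i) := by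
  classical
  induction s using Finset.induction_on with
  | empty => simp
  | insert a s ha ih =>
    rw [Finset.sum_insert ha, Finset.sum_insert ha]
    exact (nrm_add_le _ _).trans (by gcongr)

/-- Sums over the antidiagonals below `N` are dominated by the full product of partial sums. -/
lemma sum_antidiagonal_le_mul (N : ℕ) (a b : ℕ → ℝ) (ha : ∀ i, 0 ≤ a i) (hb : ∀ i, 0 ≤ b i) :
    ∑ i ∈ Finset.range N, ∑ x ∈ Finset.HasAntidiagonal.antidiagonal i, a x.1 * b x.2 ≤
      (∑ i ∈ Finset.range N, a i) * ∑ i ∈ Finset.range N, b i := by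
  rw [Finset.sum_mul_sum, Finset.sum_sigma', ← Finset.sum_product']
  have hinj : Set.InjOn (fun x : (_ : ℕ) × (ℕ × ℕ) => x.2)
      (↑((Finset.range N).sigma fun i => Finset.HasAntidiagonal.antidiagonal i) :
        Set ((_ : ℕ) × (ℕ × ℕ))) := by
    rintro ⟨i, x⟩ hx ⟨j, y⟩ hy hxy
    simp only [Finset.coe_sigma, Set.mem_sigma_iff, Finset.mem_coe,
      Finset.HasAntidiagonal.mem_antidiagonal] at hx hy hxy
    obtain rfl := hxy
    obtain rfl : i = j := by omega
    rfl
  rw [← Finset.sum_image (f := fun x : ℕ × ℕ => a x.1 * b x.2) hinj]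
  refine Finset.sum_le_sum_of_subset_of_nonneg ?_ fun _ _ _ => mul_nonneg (ha _) (hb _)
  intro x hx
  simp only [Finset.mem_image, Finset.mem_sigma, Finset.mem_range,
    Finset.HasAntidiagonal.mem_antidiagonal, Finset.mem_product] at hx ⊢
  obtain ⟨y, hy, rfl⟩ := hx
  omega

/-- Coefficients of a product up to `w^10` involve only coefficients of the factors up to `w^10`, so
the ℓ¹ inequality survives the truncation. -/
lemma nrm_mul_le (p q : ℚ[X]) : nrm (p * q) ≤ nrm p * nrm q := by
  refine le_trans ?_ (sum_antidiagonal_le_mul 11 _ _ (fun _ => abs_nonneg _) fun _ => abs_nonneg _)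
  refine Finset.sum_le_sum fun i _ => ?_
  rw [Polynomial.coeff_mul, Rat.cast_sum]
  refine (Finset.abs_sum_le_sum_abs _ _).trans (Finset.sum_le_sum fun x _ => ?_)
  rw [Rat.cast_mul, abs_mul]

@[simp] lemma nrm_C (q : ℚ) : nrm (Polynomial.C q) = |(q : ℝ)| := by
  simp [nrm, Finset.sum_range_succ, Polynomial.coeff_C]

@[simp] lemma nrm_one : nrm 1 = 1 := by simpa using nrm_C 1

lemma nrm_pow_le (p : ℚ[X]) (k : ℕ) : nrm (p ^ k) ≤ nrm p ^ k := by
  induction k with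
  | zero => simp
  | succ k ih =>
    rw [pow_succ, pow_succ]
    exact (nrm_mul_le _ _).trans (mul_le_mul_of_nonneg_right ih (nrm_nonneg _))

lemma nrm_C_mul (q : ℚ) (p : ℚ[X]) : nrm (Polynomial.C q * p) = |(q : ℝ)| * nrm p := by
  simp [nrm, Finset.mul_sum, abs_mul]

lemma nrm_X_pow_le (k : ℕ) : nrm (Polynomial.X ^ k) ≤ 1 := by
  refine (nrm_pow_le _ _).trans ?_
  have : nrm Polynomial.X = 1 := by
    simp [nrm, Finset.sum_range_succ, Polynomial.coeff_X]
  simp [this]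

lemma nrm_neg_X_pow_le (k : ℕ) : nrm ((-Polynomial.X) ^ k) ≤ 1 := by
  rcases neg_pow_eq_or (Polynomial.X : ℚ[X]) k with h | h <;> rw [h]
  · exact nrm_X_pow_le k
  · rw [nrm_neg]; exact nrm_X_pow_le k
where
  neg_pow_eq_or (a : ℚ[X]) (k : ℕ) : (-a) ^ k = a ^ k ∨ (-a) ^ k = -a ^ k := by
    rcases k.even_or_odd with h | h
    · exact Or.inl (h.neg_pow a)
    · exact Or.inr (h.neg_pow a)

lemma nrm_one_sub_X_le : nrm (1 - Polynomial.X) ≤ 2 := by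
  have := nrm_sub_le 1 (Polynomial.X : ℚ[X])
  have h := nrm_X_pow_le 1
  simp at this h
  linarith

lemma truncPoly_apply (Γ : ℕ) (p : ℚ[X]) :
    truncPoly Γ p = ∑ i ∈ Finset.range (Γ + 1), p.coeff i := by
  simp [truncPoly, LinearMap.sum_apply]

lemma abs_truncPoly_le (p : ℚ[X]) : |(truncPoly 10 p : ℝ)| ≤ nrm p := by
  rw [truncPoly_apply, Rat.cast_sum]
  exact Finset.abs_sum_le_sum_abs _ _

/-- The truncation of a multiple of `w - 1` telescopes. -/
lemma truncPoly_X_sub_one_mul (Γ : ℕ) (p : ℚ[X]) :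
    truncPoly Γ ((Polynomial.X - 1) * p) = -p.coeff Γ := by
  rw [truncPoly_apply]
  induction Γ with
  | zero => simp [sub_mul]
  | succ n ih =>
    rw [Finset.sum_range_succ, ih, sub_mul, one_mul, Polynomial.coeff_sub,
      Polynomial.coeff_X_mul]
    ring

/-! ### Truncated weighted seminorms on `ℚ[w]⟦u⟧` -/

/-- The seminorm `∑_{i ≤ n} ‖F_i‖ r^i`. -/
def wt (n : ℕ) (r : ℝ) (F : ℚ[X]⟦X⟧) : ℝ :=
  ∑ i ∈ Finset.range (n + 1), nrm (PowerSeries.coeff i F) * r ^ i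

section wt

variable {n : ℕ} {r : ℝ}

lemma wt_nonneg (hr : 0 ≤ r) (F : ℚ[X]⟦X⟧) : 0 ≤ wt n r F :=
  Finset.sum_nonneg fun _ _ => mul_nonneg (nrm_nonneg _) (pow_nonneg hr _)

lemma wt_congr {F G : ℚ[X]⟦X⟧} (h : ∀ i ≤ n, PowerSeries.coeff i F = PowerSeries.coeff i G) :
    wt n r F = wt n r G :=
  Finset.sum_congr rfl fun i hi => by rw [h i (by simpa [Nat.lt_succ_iff] using hi)]

@[simp] lemma wt_neg (F : ℚ[X]⟦X⟧) : wt n r (-F) = wt n r F := by simp [wt]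

@[simp] lemma wt_zero : wt n r 0 = 0 := by simp [wt]

lemma wt_add_le (hr : 0 ≤ r) (F G : ℚ[X]⟦X⟧) : wt n r (F + G) ≤ wt n r F + wt n r G := by
  simp only [wt, ← Finset.sum_add_distrib, ← add_mul, map_add]
  refine Finset.sum_le_sum fun i _ => ?_
  gcongr
  exact nrm_add_le _ _

lemma wt_sub_le (hr : 0 ≤ r) (F G : ℚ[X]⟦X⟧) : wt n r (F - G) ≤ wt n r F + wt n r G := by
  simpa [sub_eq_add_neg] using wt_add_le (n := n) hr F (-G)

lemma wt_sum_le (hr : 0 ≤ r) {ι : Type*} (s : Finset ι) (f : ι → ℚ[X]⟦X⟧) :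
    wt n r (∑ i ∈ s, f i) ≤ ∑ i ∈ s, wt n r (f i) := by
  classical
  induction s using Finset.induction_on with
  | empty => simp
  | insert a s ha ih =>
    rw [Finset.sum_insert ha, Finset.sum_insert ha]
    exact (wt_add_le hr _ _).trans (by gcongr)

lemma wt_mul_le (hr : 0 ≤ r) (F G : ℚ[X]⟦X⟧) : wt n r (F * G) ≤ wt n r F * wt n r G := by
  refine le_trans ?_ (sum_antidiagonal_le_mul (n + 1) _ _
    (fun _ => mul_nonneg (nrm_nonneg _) (pow_nonneg hr _))
    fun _ => mul_nonneg (nrm_nonneg _) (pow_nonneg hr _))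
  refine Finset.sum_le_sum fun i _ => ?_
  rw [PowerSeries.coeff_mul]
  calc nrm (∑ x ∈ Finset.HasAntidiagonal.antidiagonal i,
        PowerSeries.coeff x.1 F * PowerSeries.coeff x.2 G) * r ^ i
      ≤ (∑ x ∈ Finset.HasAntidiagonal.antidiagonal i,
          nrm (PowerSeries.coeff x.1 F) * nrm (PowerSeries.coeff x.2 G)) * r ^ i := by
        gcongr
        exact (nrm_sum_le _ _).trans (Finset.sum_le_sum fun x _ => nrm_mul_le _ _)
    _ = _ := by
        rw [Finset.sum_mul]
        refine Finset.sum_congr rfl fun x hx => ?_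
        rw [← Finset.HasAntidiagonal.mem_antidiagonal.mp hx, pow_add]
        ring

@[simp] lemma wt_C (p : ℚ[X]) : wt n r (PowerSeries.C p) = nrm p := by
  simp only [wt]
  rw [Finset.sum_eq_single 0]
  · simp
  · intro b _ hb
    simp [PowerSeries.coeff_C, hb]
  · simp

@[simp] lemma wt_one : wt n r 1 = 1 := by
  simpa using wt_C (n := n) (r := r) 1

lemma wt_X_pow_le (hr : 0 ≤ r) (k : ℕ) : wt n r (PowerSeries.X ^ k) ≤ r ^ k := by
  simp only [wt, PowerSeries.coeff_X_pow]
  by_cases hk : k ∈ Finset.range (n + 1)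
  · rw [Finset.sum_eq_single k (fun b _ hb => by simp [hb]) (fun h => absurd hk h)]
    simp
  · rw [Finset.sum_eq_zero]
    · positivity
    · intro b hb
      have : b ≠ k := fun h => hk (h ▸ hb)
      simp [this]

lemma wt_pow_le (hr : 0 ≤ r) (F : ℚ[X]⟦X⟧) (k : ℕ) : wt n r (F ^ k) ≤ wt n r F ^ k := by
  induction k with
  | zero => simp
  | succ k ih =>
    rw [pow_succ, pow_succ]
    exact (wt_mul_le hr _ _).trans (mul_le_mul_of_nonneg_right ih (wt_nonneg hr _))

lemma nrm_coeff_mul_pow_le (hr : 0 ≤ r) (F : ℚ[X]⟦X⟧) {k : ℕ} (hk : k ≤ n) :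
    nrm (PowerSeries.coeff k F) * r ^ k ≤ wt n r F :=
  Finset.single_le_sum (f := fun i => nrm (PowerSeries.coeff i F) * r ^ i)
    (fun _ _ => mul_nonneg (nrm_nonneg _) (pow_nonneg hr _))
    (Finset.mem_range.mpr (Nat.lt_succ_of_le hk))

end wt

/-! ### Substitution into power series -/

section subst

variable {A : Type*} [CommRing A]

lemma hasSubst_of_X_dvd {g : A⟦X⟧} (hg : PowerSeries.X ∣ g) : PowerSeries.HasSubst g :=
  PowerSeries.HasSubst.of_constantCoeff_zero' (PowerSeries.X_dvd_iff.mp hg)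

/-- The power `g^k` starts in degree `l * k`, which makes the sum over `k` finite. The sharp cutoff
for `l ≥ 2` is needed later for the divergent Bernoulli series. -/
lemma coeff_subst_eq_sum {g : A⟦X⟧} {l : ℕ} (hl : 0 < l) (hg : PowerSeries.X ^ l ∣ g) (φ : A⟦X⟧)
    {i K : ℕ} (hK : i < l * (K + 1)) :
    PowerSeries.coeff i (φ.subst g) =
      ∑ k ∈ Finset.range (K + 1), PowerSeries.coeff k φ * PowerSeries.coeff i (g ^ k) := by
  have hX : PowerSeries.X ∣ g := (dvd_pow_self _ hl.ne').trans hg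
  rw [PowerSeries.coeff_subst' (hasSubst_of_X_dvd hX)]
  simp only [smul_eq_mul]
  refine finsum_eq_sum_of_support_subset _ fun k hk => ?_
  simp only [Finset.coe_range, Set.mem_Iio]
  by_contra h
  refine hk ?_
  have h1 : PowerSeries.X ^ (l * k) ∣ g ^ k := by rw [pow_mul]; exact pow_dvd_pow_of_dvd hg k
  have h2 : i < l * k := lt_of_lt_of_le hK (Nat.mul_le_mul_left _ (by omega))
  simp only
  rw [PowerSeries.X_pow_dvd_iff.mp h1 i h2, mul_zero]

lemma coeff_subst_eq_sum' {g : A⟦X⟧} (hg : PowerSeries.X ∣ g) (φ : A⟦X⟧) {i K : ℕ} (hK : i ≤ K) :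
    PowerSeries.coeff i (φ.subst g) =
      ∑ k ∈ Finset.range (K + 1), PowerSeries.coeff k φ * PowerSeries.coeff i (g ^ k) :=
  coeff_subst_eq_sum one_pos (by simpa using hg) φ (by omega)

lemma constantCoeff_subst_of_X_dvd {g : A⟦X⟧} (hg : PowerSeries.X ∣ g) (φ : A⟦X⟧) :
    PowerSeries.constantCoeff (φ.subst g) = PowerSeries.constantCoeff φ := by
  have := coeff_subst_eq_sum' hg φ (le_refl 0)
  simpa using this

lemma dvd_subst {g : A⟦X⟧} (hg : PowerSeries.X ∣ g) {φ : A⟦X⟧}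
    (hφ : PowerSeries.constantCoeff φ = 0) : g ∣ φ.subst g := by
  obtain ⟨ψ, rfl⟩ := PowerSeries.X_dvd_iff.mpr hφ
  rw [PowerSeries.subst_mul (hasSubst_of_X_dvd hg), PowerSeries.subst_X (hasSubst_of_X_dvd hg)]
  exact dvd_mul_right _ _

end subst

/-- Stopping at `n / l` lets `φ` have radius of convergence zero: only its first `n / l`
coefficients beyond the constant one are seen at order `n`. -/
lemma wt_subst_le {n : ℕ} {r : ℝ} (hr : 0 ≤ r) {g : ℚ[X]⟦X⟧} {l : ℕ} (hl : 0 < l)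
    (hg : PowerSeries.X ^ l ∣ g) (φ : ℚ[X]⟦X⟧) :
    wt n r (φ.subst g) ≤
      ∑ k ∈ Finset.range (n / l + 1), nrm (PowerSeries.coeff k φ) * wt n r g ^ k := by
  have h : wt n r (φ.subst g) = wt n r (∑ k ∈ Finset.range (n / l + 1),
      PowerSeries.C (PowerSeries.coeff k φ) * g ^ k) := by
    refine wt_congr fun i hi => ?_
    rw [coeff_subst_eq_sum hl hg φ (K := n / l), map_sum]
    · simp
    · have := Nat.lt_mul_div_succ n hl
      omega
  rw [h]
  refine (wt_sum_le hr _ _).trans (Finset.sum_le_sum fun k _ => ?_)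
  refine (wt_mul_le hr _ _).trans ?_
  rw [wt_C]
  exact mul_le_mul_of_nonneg_left (wt_pow_le hr _ _) (nrm_nonneg _)

/-! ### Formal exponentials -/

section expS

/-- Serves for the functional equation of `expS`: the products `e^f e^{-f}` and `e^f e^g e^{-(f+g)}`
have derivative zero and constant term one. -/
lemma eq_one_of_derivative_eq_zero {A : Type*} [CommRing A] [IsAddTorsionFree A] {f : A⟦X⟧}
    (h0 : PowerSeries.constantCoeff f = 1) (hd : PowerSeries.derivative A f = 0) : f = 1 :=
  PowerSeries.derivative.ext (by rw [hd, PowerSeries.derivative_one]) (by simp [h0])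

variable {A : Type*} [CommRing A] [Algebra ℚ A]

/-- The exponential of a power series without constant term. -/
def expS (f : A⟦X⟧) : A⟦X⟧ := (PowerSeries.exp A).subst f

lemma constantCoeff_expS {f : A⟦X⟧} (hf : PowerSeries.X ∣ f) :
    PowerSeries.constantCoeff (expS f) = 1 := by
  rw [expS, constantCoeff_subst_of_X_dvd hf, PowerSeries.constantCoeff_exp]

lemma derivative_expS {f : A⟦X⟧} (hf : PowerSeries.X ∣ f) :
    PowerSeries.derivative A (expS f) = expS f * PowerSeries.derivative A f := by
  rw [expS, PowerSeries.derivative_subst (hasSubst_of_X_dvd hf), PowerSeries.derivative_exp]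

/-- The recursion for the coefficients of an exponential. -/
lemma succ_mul_coeff_expS {f : A⟦X⟧} (hf : PowerSeries.X ∣ f) (n : ℕ) :
    ((n + 1 : ℕ) : A) * PowerSeries.coeff (n + 1) (expS f) =
      ∑ k ∈ Finset.range (n + 1), ((k + 1 : ℕ) : A) * PowerSeries.coeff (k + 1) f *
        PowerSeries.coeff (n - k) (expS f) := by
  have h := congrArg (PowerSeries.coeff n) (derivative_expS hf)
  rw [PowerSeries.coeff_derivative, mul_comm (expS f), PowerSeries.coeff_mul,
    Finset.Nat.sum_antidiagonal_eq_sum_range_succ_mk] at h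
  simp only [PowerSeries.coeff_derivative] at h
  push_cast
  rw [mul_comm, h]
  exact Finset.sum_congr rfl fun k _ => by ring

variable [IsAddTorsionFree A]

lemma expS_mul_expS_neg {f : A⟦X⟧} (hf : PowerSeries.X ∣ f) : expS f * expS (-f) = 1 := by
  have hf' : PowerSeries.X ∣ -f := (dvd_neg).mpr hf
  refine eq_one_of_derivative_eq_zero ?_ ?_
  · rw [map_mul, constantCoeff_expS hf, constantCoeff_expS hf', one_mul]
  · rw [Derivation.leibniz, derivative_expS hf, derivative_expS hf', map_neg]
    simp only [smul_eq_mul]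
    ring

lemma expS_add {f g : A⟦X⟧} (hf : PowerSeries.X ∣ f) (hg : PowerSeries.X ∣ g) :
    expS (f + g) = expS f * expS g := by
  have hfg : PowerSeries.X ∣ f + g := dvd_add hf hg
  have hfg' : PowerSeries.X ∣ -(f + g) := (dvd_neg).mpr hfg
  have h1 : expS f * expS g * expS (-(f + g)) = 1 := by
    refine eq_one_of_derivative_eq_zero ?_ ?_
    · rw [map_mul, map_mul, constantCoeff_expS hf, constantCoeff_expS hg,
        constantCoeff_expS hfg', one_mul, one_mul]
    · rw [Derivation.leibniz, Derivation.leibniz, derivative_expS hf, derivative_expS hg,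
        derivative_expS hfg', map_neg, map_add]
      simp only [smul_eq_mul]
      ring
  calc expS (f + g) = (expS f * expS g * expS (-(f + g))) * expS (f + g) := by rw [h1, one_mul]
    _ = expS f * expS g * (expS (f + g) * expS (-(f + g))) := by ring
    _ = _ := by rw [expS_mul_expS_neg hfg, mul_one]

end expS

lemma wt_expS_le {n : ℕ} {r : ℝ} (hr : 0 ≤ r) {f : ℚ[X]⟦X⟧} (hf : PowerSeries.X ∣ f) :
    wt n r (expS f) ≤ Real.exp (wt n r f) := by
  refine (wt_subst_le hr one_pos (by simpa using hf) _).trans ?_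
  refine le_trans (le_of_eq ?_) (Real.sum_le_exp_of_nonneg (wt_nonneg hr f) (n / 1 + 1))
  refine Finset.sum_congr rfl fun k _ => ?_
  rw [PowerSeries.coeff_exp, Polynomial.algebraMap_eq, nrm_C, abs_of_nonneg (by positivity)]
  push_cast
  ring

/-! ### Evaluation at Laurent series without negative powers -/

section heval

variable {A : Type*} [CommRing A]

lemma coeff_ofPowerSeries_neg (F : A⟦X⟧) {m : ℤ} (hm : m < 0) :
    (HahnSeries.ofPowerSeries ℤ A F).coeff m = 0 := by
  rw [HahnSeries.ofPowerSeries_apply]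
  refine HahnSeries.embDomain_of_notMem_range ?_
  rintro ⟨k, rfl⟩
  simp at hm
  omega

lemma orderTop_ofPowerSeries_pos {g : A⟦X⟧} (hg : PowerSeries.X ∣ g) :
    0 < (HahnSeries.ofPowerSeries ℤ A g).orderTop := by
  refine lt_of_lt_of_le (b := ((1 : ℤ) : WithTop ℤ)) (by norm_cast) ?_
  rw [HahnSeries.le_orderTop_iff_forall]
  intro j hj
  have hj : j < 1 := by exact_mod_cast hj
  rcases lt_or_ge j 0 with h | h
  · exact coeff_ofPowerSeries_neg g h
  · obtain rfl : j = ((0 : ℕ) : ℤ) := by simp; omega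
    rw [HahnSeries.ofPowerSeries_apply_coeff]
    simpa using PowerSeries.X_dvd_iff.mp hg

/-- The bridge from the Laurent series of the definitions to power series, where `exp`, `log` and
`B` become substitutions. -/
lemma heval_ofPowerSeries {g : A⟦X⟧} (hg : PowerSeries.X ∣ g) (φ : A⟦X⟧) :
    PowerSeries.heval (HahnSeries.ofPowerSeries ℤ A g) φ =
      HahnSeries.ofPowerSeries ℤ A (φ.subst g) := by
  ext m : 2
  rw [PowerSeries.coeff_heval]
  have h1 : ∀ k, (HahnSeries.SummableFamily.powerSeriesFamily
      (HahnSeries.ofPowerSeries ℤ A g) φ).coeff m k =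
      PowerSeries.coeff k φ * (HahnSeries.ofPowerSeries ℤ A (g ^ k)).coeff m := by
    intro k
    rw [HahnSeries.SummableFamily.coeff_apply,
      HahnSeries.SummableFamily.powerSeriesFamily_of_orderTop_pos
        (orderTop_ofPowerSeries_pos hg), map_pow]
    simp
  simp only [h1]
  rcases lt_or_ge m 0 with h | h
  · simp only [coeff_ofPowerSeries_neg _ h, mul_zero, finsum_zero]
  · lift m to ℕ using h
    simp only [HahnSeries.ofPowerSeries_apply_coeff]
    rw [PowerSeries.coeff_subst' (hasSubst_of_X_dvd hg)]
    simp

end heval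

/-- The embedding of power series into Laurent series. -/
abbrev toSer : ℚ[X]⟦X⟧ →+* Ser := HahnSeries.ofPowerSeries ℤ ℚ[X]

lemma heval_toSer {g : ℚ[X]⟦X⟧} (hg : PowerSeries.X ∣ g) (φ : ℚ[X]⟦X⟧) :
    PowerSeries.heval (toSer g) φ = toSer (φ.subst g) := heval_ofPowerSeries hg φ

lemma exp_toSer {g : ℚ[X]⟦X⟧} (hg : PowerSeries.X ∣ g) : exp (toSer g) = toSer (expS g) :=
  heval_ofPowerSeries hg _

lemma log_toSer {g : ℚ[X]⟦X⟧} (hg : PowerSeries.X ∣ g - 1) :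
    log (toSer g) = toSer ((PowerSeries.log ℚ[X]).subst (g - 1)) := by
  rw [log, ← heval_ofPowerSeries hg, map_sub, map_one]

/-! ### The building blocks as power series -/

/-- `∑_{d ∣ ℓ} μ(ℓ/d) u^{ℓ-d}`, which is `ℓ u^ℓ E_ℓ`. -/
def den (l : ℕ) : ℚ[X]⟦X⟧ :=
  ∑ d ∈ l.divisors, PowerSeries.C (Polynomial.C (ArithmeticFunction.moebius (l / d) : ℚ)) *
    PowerSeries.X ^ (l - d)

/-- The polynomial `W_ℓ`. -/
def wPoly (l : ℕ) : ℚ[X] :=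
  Polynomial.C (1 / (l : ℚ)) * ∑ d ∈ l.divisors,
    Polynomial.C (ArithmeticFunction.moebius (l / d) : ℚ) * (1 - Polynomial.X ^ d)

/-- The power series `1 / E_ℓ`. -/
def invE (l : ℕ) : ℚ[X]⟦X⟧ :=
  PowerSeries.C (Polynomial.C (l : ℚ)) * (PowerSeries.X ^ l * (den l).invOfUnit 1)

/-- The power series `W_ℓ / E_ℓ`. -/
def quotWE (l : ℕ) : ℚ[X]⟦X⟧ := PowerSeries.C (wPoly l) * invE l

/-- `-log (1 - X) = ∑_{k ≥ 1} X^k / k`. -/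
def negLog : ℚ[X]⟦X⟧ := PowerSeries.mk fun k : ℕ => Polynomial.C (1 / (k : ℚ))

/-- `-∑_{k ≥ 1} X^k / (k (k + 1))`. -/
def logRem : ℚ[X]⟦X⟧ :=
  PowerSeries.mk fun k : ℕ => Polynomial.C (-(1 / ((k : ℚ) * (k + 1))))

/-- The rational number `B_{k+1} / (k (k + 1))`. -/
def bern (k : ℕ) : ℚ := if 1 ≤ k then _root_.bernoulli (k + 1) / (((k : ℚ) + 1) * k) else 0

/-- The series `B` in the variable `1 / z`. -/
def bernSeries : ℚ[X]⟦X⟧ := PowerSeries.mk fun k : ℕ => Polynomial.C (bern k)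

/-- The power series equal to `𝐀_ℓ`. -/
def serA (l : ℕ) : ℚ[X]⟦X⟧ :=
  PowerSeries.C (wPoly l) *
      (PowerSeries.log ℚ[X]).subst ((1 - PowerSeries.X ^ l) * den l - 1) +
    PowerSeries.C (wPoly l) * logRem.subst (quotWE l) +
    PowerSeries.C (Polynomial.C (1 / 2)) * negLog.subst (quotWE l)

/-- The power series equal to `𝐁_ℓ`. -/
def serB (l : ℕ) : ℚ[X]⟦X⟧ :=
  bernSeries.subst (-(invE l * (1 - quotWE l).invOfUnit 1)) - bernSeries.subst (-invE l)

lemma const_eq (q : ℚ) : const q = toSer (PowerSeries.C (Polynomial.C q)) :=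
  (HahnSeries.ofPowerSeries_C _).symm

lemma ofPoly_eq (p : ℚ[X]) : ofPoly p = toSer (PowerSeries.C p) :=
  (HahnSeries.ofPowerSeries_C _).symm

lemma W_eq (l : ℕ) : W l = toSer (PowerSeries.C (wPoly l)) := ofPoly_eq _

lemma u_eq : u = toSer PowerSeries.X := HahnSeries.ofPowerSeries_X.symm

lemma single_neg_mul_X_pow (l : ℕ) :
    (HahnSeries.single (-(l : ℤ)) 1 : Ser) * toSer (PowerSeries.X ^ l) = 1 := by
  rw [HahnSeries.ofPowerSeries_X_pow, HahnSeries.single_mul_single]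
  simp

lemma E_eq (l : ℕ) : E l = const (1 / l) * HahnSeries.single (-(l : ℤ)) 1 * toSer (den l) := by
  have key : ∑ d ∈ l.divisors, const (ArithmeticFunction.moebius (l / d)) *
      HahnSeries.single (-(d : ℤ)) 1 = HahnSeries.single (-(l : ℤ)) 1 * toSer (den l) := by
    rw [den, map_sum toSer, Finset.mul_sum]
    refine Finset.sum_congr rfl fun d hd => ?_
    have hdl : d ≤ l := Nat.divisor_le hd
    rw [map_mul toSer, ← const_eq, HahnSeries.ofPowerSeries_X_pow, mul_left_comm,
      HahnSeries.single_mul_single]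
    congr 2
    · push_cast [hdl]; ring_nf
    · simp
  rw [E, key, mul_assoc]

/-- The reduced polynomial `den ℓ - 1` is divisible by `u^⌈ℓ/2⌉`. -/
lemma den_sub_one {l : ℕ} (hl : 0 < l) : den l - 1 = ∑ d ∈ l.properDivisors,
    PowerSeries.C (Polynomial.C (ArithmeticFunction.moebius (l / d) : ℚ)) *
      PowerSeries.X ^ (l - d) := by
  rw [den, ← Nat.cons_self_properDivisors hl.ne', Finset.sum_cons]
  simp [Nat.div_self hl]

lemma two_mul_le_of_mem_properDivisors {l d : ℕ} (hd : d ∈ l.properDivisors) : 2 * d ≤ l := by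
  obtain ⟨⟨c, rfl⟩, hlt⟩ := Nat.mem_properDivisors.mp hd
  have : 2 ≤ c := by
    by_contra h
    interval_cases c <;> omega
  nlinarith

lemma X_pow_dvd_den_sub_one {l : ℕ} (hl : 0 < l) : PowerSeries.X ^ ((l + 1) / 2) ∣ den l - 1 := by
  rw [den_sub_one hl]
  refine Finset.dvd_sum fun d hd => Dvd.dvd.mul_left (pow_dvd_pow _ ?_) _
  have := two_mul_le_of_mem_properDivisors hd
  omega

lemma X_dvd_den_sub_one {l : ℕ} (hl : 0 < l) : PowerSeries.X ∣ den l - 1 :=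
  (dvd_pow_self _ (by omega)).trans (X_pow_dvd_den_sub_one hl)

lemma mul_invOfUnit_one {A : Type*} [CommRing A] {F : A⟦X⟧} (hF : PowerSeries.X ∣ F - 1) :
    F * F.invOfUnit 1 = 1 := by
  refine PowerSeries.mul_invOfUnit _ _ ?_
  have := PowerSeries.X_dvd_iff.mp hF
  rw [map_sub, map_one, sub_eq_zero] at this
  simpa using this

lemma E_mul_invE {l : ℕ} (hl : 0 < l) : E l * toSer (invE l) = 1 := by
  have h1 : toSer (den l) * toSer ((den l).invOfUnit 1) = 1 := by
    rw [← map_mul, mul_invOfUnit_one (X_dvd_den_sub_one hl), map_one]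
  have h2 : const (1 / l) * toSer (PowerSeries.C (Polynomial.C (l : ℚ))) = 1 := by
    rw [const_eq, ← map_mul, ← map_mul, ← map_mul]
    have : (l : ℚ) ≠ 0 := by positivity
    rw [one_div, inv_mul_cancel₀ this]
    simp
  rw [E_eq, invE, map_mul, map_mul]
  calc _ = (const (1 / l) * toSer (PowerSeries.C (Polynomial.C (l : ℚ)))) *
        ((HahnSeries.single (-(l : ℤ)) 1 : Ser) * toSer (PowerSeries.X ^ l)) *
        (toSer (den l) * toSer ((den l).invOfUnit 1)) := by ring
    _ = 1 := by rw [h1, h2, single_neg_mul_X_pow, one_mul, one_mul]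

lemma ring_inverse_eq {M : Type*} [CommRing M] {a b : M} (h : a * b = 1) : Ring.inverse a = b := by
  have ha : IsUnit a := IsUnit.of_mul_eq_one b h
  calc Ring.inverse a = Ring.inverse a * (a * b) := by rw [h, mul_one]
    _ = b := by rw [← mul_assoc, Ring.inverse_mul_cancel a ha, one_mul]

lemma inverse_E {l : ℕ} (hl : 0 < l) : Ring.inverse (E l) = toSer (invE l) :=
  ring_inverse_eq (E_mul_invE hl)

lemma X_pow_dvd_invE (l : ℕ) : PowerSeries.X ^ l ∣ invE l :=
  Dvd.dvd.mul_left (dvd_mul_right _ _) _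

lemma X_pow_dvd_quotWE (l : ℕ) : PowerSeries.X ^ l ∣ quotWE l :=
  Dvd.dvd.mul_left (X_pow_dvd_invE l) _

lemma X_dvd_quotWE {l : ℕ} (hl : 0 < l) : PowerSeries.X ∣ quotWE l :=
  (dvd_pow_self _ hl.ne').trans (X_pow_dvd_quotWE l)

lemma X_dvd_invE {l : ℕ} (hl : 0 < l) : PowerSeries.X ∣ invE l :=
  (dvd_pow_self _ hl.ne').trans (X_pow_dvd_invE l)

lemma lam_mul_E {l : ℕ} (hl : 0 < l) :
    lam l * E l = toSer ((1 - PowerSeries.X ^ l) * den l) := by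
  have h2 : const (1 / l) * const l = 1 := by
    rw [const_eq, const_eq, ← map_mul, ← map_mul, ← map_mul]
    have : (l : ℚ) ≠ 0 := by positivity
    rw [one_div, inv_mul_cancel₀ this]
    simp
  rw [lam, E_eq, u_eq, map_mul toSer, map_sub toSer, map_one toSer, ← map_pow toSer]
  calc _ = ((HahnSeries.single (-(l : ℤ)) 1 : Ser) * toSer (PowerSeries.X ^ l)) *
        (const (1 / l) * const l) * ((1 - toSer (PowerSeries.X ^ l)) * toSer (den l)) := by ring
    _ = _ := by rw [h2, single_neg_mul_X_pow, one_mul, one_mul]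

lemma X_pow_dvd_mul_den_sub_one {l : ℕ} (hl : 0 < l) :
    PowerSeries.X ^ ((l + 1) / 2) ∣ (1 - PowerSeries.X ^ l) * den l - 1 := by
  have : (1 - PowerSeries.X ^ l) * den l - 1 = (den l - 1) - PowerSeries.X ^ l * den l := by ring
  rw [this]
  refine dvd_sub (X_pow_dvd_den_sub_one hl) (Dvd.dvd.mul_right (pow_dvd_pow _ ?_) _)
  omega

lemma X_dvd_mul_den_sub_one {l : ℕ} (hl : 0 < l) :
    PowerSeries.X ∣ (1 - PowerSeries.X ^ l) * den l - 1 :=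
  (dvd_pow_self _ (by omega)).trans (X_pow_dvd_mul_den_sub_one hl)

lemma log_subst_neg {y : ℚ[X]⟦X⟧} (hy : PowerSeries.X ∣ y) :
    (PowerSeries.log ℚ[X]).subst (-y) = -negLog.subst y := by
  ext1 n
  rw [map_neg, coeff_subst_eq_sum' ((dvd_neg).mpr hy) _ (le_refl n),
    coeff_subst_eq_sum' hy _ (le_refl n), ← Finset.sum_neg_distrib]
  refine Finset.sum_congr rfl fun k _ => ?_
  rw [PowerSeries.coeff_log, negLog, PowerSeries.coeff_mk, Polynomial.algebraMap_eq]
  rcases Nat.eq_zero_or_pos k with rfl | hk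
  · simp
  · rw [if_neg hk.ne', neg_pow y, pow_succ]
    have : (-1 : ℚ[X]⟦X⟧) ^ k = PowerSeries.C (Polynomial.C ((-1 : ℚ) ^ k)) := by simp
    rw [this, PowerSeries.coeff_C_mul, ← mul_assoc, ← map_mul, ← neg_mul, ← map_neg]
    congr 2
    rw [div_mul_eq_mul_div, mul_neg_one, neg_mul, ← pow_add, ← two_mul, pow_mul]
    simp [neg_div]

lemma X_mul_shift_eq_negLog :
    PowerSeries.X * (PowerSeries.mk fun k : ℕ => Polynomial.C (1 / ((k : ℚ) + 1))) = negLog := by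
  ext1 n
  rcases n with _ | n
  · simp [negLog]
  · rw [PowerSeries.coeff_succ_X_mul, negLog, PowerSeries.coeff_mk, PowerSeries.coeff_mk]
    push_cast
    rfl

/-- Partial fractions `1/(k+1) = 1/k - 1/(k(k+1))` for `k ≥ 1`. The summand `1` supplies `k = 0`,
where `negLog` and `logRem` vanish because `1/0 = 0`. -/
lemma shift_eq :
    (PowerSeries.mk fun k : ℕ => Polynomial.C (1 / ((k : ℚ) + 1))) = 1 + negLog + logRem := by
  ext1 n
  rw [map_add, map_add, negLog, logRem]
  simp only [PowerSeries.coeff_mk, PowerSeries.coeff_one]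
  rcases Nat.eq_zero_or_pos n with rfl | hn
  · simp
  · rw [if_neg hn.ne', zero_add, ← map_add]
    congr 1
    have : (n : ℚ) ≠ 0 := by positivity
    field_simp
    ring

/-- `W_ℓ = E_ℓ · (W_ℓ / E_ℓ)` produces the cancellation of the leading terms of `𝐀_ℓ`. -/
lemma bA_eq {l : ℕ} (hl : 0 < l) : bA l = toSer (serA l) := by
  set y := quotWE l with hy
  have hXy : PowerSeries.X ∣ y := X_dvd_quotWE hl
  have hsub := hasSubst_of_X_dvd hXy
  set S := (PowerSeries.mk fun k : ℕ => Polynomial.C (1 / ((k : ℚ) + 1))) with hS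
  have e1 : negLog.subst y = y * S.subst y := by
    rw [← X_mul_shift_eq_negLog, PowerSeries.subst_mul hsub, PowerSeries.subst_X hsub]
  have e2 : S.subst y = 1 + negLog.subst y + logRem.subst y := by
    have h1 : (1 : ℚ[X]⟦X⟧).subst y = 1 := by
      rw [← PowerSeries.coe_substAlgHom hsub, map_one]
    rw [hS, shift_eq, PowerSeries.subst_add hsub, PowerSeries.subst_add hsub, h1]
  have h1 : 1 - W l * Ring.inverse (E l) = toSer (1 - y) := by
    rw [inverse_E hl, W_eq, ← map_mul, map_sub, map_one, hy, quotWE]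
  have h2 : log (toSer (1 - y)) = -toSer (negLog.subst y) := by
    have hd : PowerSeries.X ∣ (1 - y) - 1 := by
      rw [sub_sub_cancel_left]; exact (dvd_neg).mpr hXy
    rw [log_toSer hd, sub_sub_cancel_left, log_subst_neg hXy, map_neg]
  -- Since `-log(1-y) = y S(y)` and `E y = W`, the pole of `E` is absorbed by the factor `y`.
  have h3 : E l * toSer (negLog.subst y) = W l * toSer (S.subst y) := by
    have h4 : toSer y = W l * toSer (invE l) := by rw [hy, quotWE, map_mul, ← W_eq]
    rw [e1, map_mul, h4]
    linear_combination W l * toSer (S.subst y) * E_mul_invE hl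
  rw [bA, h1, h2, lam_mul_E hl, log_toSer (X_dvd_mul_den_sub_one hl), serA]
  simp only [map_add, map_mul]
  rw [← hy, ← W_eq, ← const_eq]
  have h4 := congrArg toSer e2
  simp only [map_add, map_one] at h4
  linear_combination h3 + W l * h4

lemma B_eq (z : Ser) : B z = PowerSeries.heval (Ring.inverse z) bernSeries := by
  rw [B, bernSeries]
  congr 2
  funext k
  rw [bern]
  split_ifs <;> simp

lemma X_dvd_one_sub_quotWE {l : ℕ} (hl : 0 < l) : PowerSeries.X ∣ (1 - quotWE l) - 1 := by
  rw [sub_sub_cancel_left]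
  exact (dvd_neg).mpr (X_dvd_quotWE hl)

lemma bB_eq {l : ℕ} (hl : 0 < l) : bB l = toSer (serB l) := by
  have h1 : (-E l) * toSer (-invE l) = 1 := by
    rw [map_neg]
    linear_combination E_mul_invE hl
  -- The factorisation `-E + W = -E (1 - W/E)`, inverted factor by factor.
  have h2 : (-E l + W l) * toSer (-(invE l * (1 - quotWE l).invOfUnit 1)) = 1 := by
    have h3 := congrArg toSer (mul_invOfUnit_one (X_dvd_one_sub_quotWE hl))
    rw [map_mul, map_sub, map_one, quotWE, map_mul, ← W_eq] at h3
    rw [map_neg, map_mul]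
    rw [quotWE]
    linear_combination h3 + toSer ((1 - PowerSeries.C (wPoly l) * invE l).invOfUnit 1) *
      E_mul_invE hl
  have d1 : PowerSeries.X ∣ -invE l := (dvd_neg).mpr (X_dvd_invE hl)
  have d2 : PowerSeries.X ∣ -(invE l * (1 - quotWE l).invOfUnit 1) :=
    (dvd_neg).mpr (Dvd.dvd.mul_right (X_dvd_invE hl) _)
  rw [bB, B_eq, B_eq, ring_inverse_eq h1, ring_inverse_eq h2, heval_toSer d1, heval_toSer d2,
    serB, map_sub]

/-! ### Divisibility by powers of `u` -/

lemma constantCoeff_bernSeries : PowerSeries.constantCoeff bernSeries = 0 := by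
  rw [← PowerSeries.coeff_zero_eq_constantCoeff_apply]
  simp [bernSeries, bern]

lemma constantCoeff_negLog : PowerSeries.constantCoeff negLog = 0 := by
  rw [← PowerSeries.coeff_zero_eq_constantCoeff_apply]
  simp [negLog]

lemma constantCoeff_logRem : PowerSeries.constantCoeff logRem = 0 := by
  rw [← PowerSeries.coeff_zero_eq_constantCoeff_apply]
  simp [logRem]

lemma X_pow_dvd_serB {l : ℕ} (hl : 0 < l) : PowerSeries.X ^ l ∣ serB l := by
  have d1 : PowerSeries.X ^ l ∣ -invE l := (dvd_neg).mpr (X_pow_dvd_invE l)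
  have d2 : PowerSeries.X ^ l ∣ -(invE l * (1 - quotWE l).invOfUnit 1) :=
    (dvd_neg).mpr (Dvd.dvd.mul_right (X_pow_dvd_invE l) _)
  have dX : PowerSeries.X ∣ (PowerSeries.X : ℚ[X]⟦X⟧) ^ l := dvd_pow_self _ hl.ne'
  exact dvd_sub (d2.trans (dvd_subst (dX.trans d2) constantCoeff_bernSeries))
    (d1.trans (dvd_subst (dX.trans d1) constantCoeff_bernSeries))

/-- The logarithm is the bottleneck: the largest proper divisor of `l` is at most `l/2`, so `den l -
1` may start as early as degree `⌈l/2⌉`. Hence only `l ≤ 2n` contribute to `u^n`. -/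
lemma X_pow_dvd_serA {l : ℕ} (hl : 0 < l) : PowerSeries.X ^ ((l + 1) / 2) ∣ serA l := by
  have hle : PowerSeries.X ^ ((l + 1) / 2) ∣ quotWE l :=
    (pow_dvd_pow _ (by omega)).trans (X_pow_dvd_quotWE l)
  refine dvd_add (dvd_add ?_ ?_) ?_ <;> refine Dvd.dvd.mul_left ?_ _
  · exact (X_pow_dvd_mul_den_sub_one hl).trans
      (dvd_subst (X_dvd_mul_den_sub_one hl) PowerSeries.constantCoeff_log)
  · exact hle.trans (dvd_subst (X_dvd_quotWE hl) constantCoeff_logRem)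
  · exact hle.trans (dvd_subst (X_dvd_quotWE hl) constantCoeff_negLog)

/-! ### The remainder as a coefficient of an exponential -/

/-- `∑_{ℓ ≥ 2} (𝐀_ℓ + 𝐁_ℓ)`. -/
def serHigher : ℚ[X]⟦X⟧ :=
  PowerSeries.mk fun n => ∑ l ∈ Finset.Icc 2 (2 * n), PowerSeries.coeff n (serA l + serB l)

lemma coeff_serA_eq_zero {l n : ℕ} (h : 2 * n < l) : PowerSeries.coeff n (serA l) = 0 :=
  PowerSeries.X_pow_dvd_iff.mp (X_pow_dvd_serA (by omega)) n (by omega)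

lemma coeff_serB_eq_zero {l n : ℕ} (h : n < l) : PowerSeries.coeff n (serB l) = 0 :=
  PowerSeries.X_pow_dvd_iff.mp (X_pow_dvd_serB (by omega)) n (by omega)

lemma sumFrom_eq {a : ℕ} (ha : 0 < a) (f : ℕ → Ser) (F : ℕ → ℚ[X]⟦X⟧)
    (hf : ∀ l, 0 < l → f l = toSer (F l))
    (hF : ∀ l n, 2 * n < l → PowerSeries.coeff n (F l) = 0) :
    sumFrom a f = toSer (PowerSeries.mk fun n => ∑ l ∈ Finset.Icc a (2 * n),
      PowerSeries.coeff n (F l)) := by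
  rw [sumFrom]
  congr 2
  funext n
  have h1 : ∀ l, (∑ᶠ (_ : a ≤ l), (f l).coeff (n : ℤ)) =
      if a ≤ l then PowerSeries.coeff n (F l) else 0 := by
    intro l
    by_cases h : a ≤ l
    · rw [if_pos h, finsum_eq_if, if_pos h, hf l (by omega), HahnSeries.ofPowerSeries_apply_coeff]
    · rw [if_neg h, finsum_eq_if, if_neg h]
  simp only [h1]
  rw [finsum_eq_sum_of_support_subset (s := Finset.Icc a (2 * n))]
  · refine Finset.sum_congr rfl fun l hl => ?_
    rw [if_pos (Finset.mem_Icc.mp hl).1]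
  · intro l hl
    simp only [Function.mem_support] at hl
    simp only [Finset.coe_Icc, Set.mem_Icc]
    by_contra hcon
    refine hl ?_
    split_ifs with h
    · exact hF l n (by omega)
    · rfl

lemma sumFrom_add_sumFrom : sumFrom 1 bA + sumFrom 2 bB = toSer (serA 1 + serHigher) := by
  rw [sumFrom_eq one_pos bA serA (fun l hl => bA_eq hl) (fun l n h => coeff_serA_eq_zero h),
    sumFrom_eq two_pos bB serB (fun l hl => bB_eq hl) (fun l n h => coeff_serB_eq_zero (by omega)),
    ← map_add]
  congr 1
  ext1 n
  rw [map_add, map_add, serHigher]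
  simp only [PowerSeries.coeff_mk, map_add, Finset.sum_add_distrib]
  rw [← add_assoc]
  congr 1
  rcases Nat.eq_zero_or_pos n with rfl | hn
  · rw [coeff_serA_eq_zero (l := 1) (by norm_num)]
    simp
  · rw [← Finset.add_sum_Ioc_eq_sum_Icc (by omega : 1 ≤ 2 * n)]
    rfl

lemma X_dvd_serHigher : PowerSeries.X ∣ serHigher := by
  rw [PowerSeries.X_dvd_iff, ← PowerSeries.coeff_zero_eq_constantCoeff_apply, serHigher]
  simp

lemma X_dvd_serA_one : PowerSeries.X ∣ serA 1 := by simpa using X_pow_dvd_serA one_pos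

lemma X_dvd_serB_one : PowerSeries.X ∣ serB 1 := by simpa using X_pow_dvd_serB one_pos

lemma expTail_eq {f : Ser} (hf : 0 < f.orderTop) : expTail f = exp f - 1 - f := by
  have h : (PowerSeries.mk fun k : ℕ =>
      if 2 ≤ k then Polynomial.C (1 / (k.factorial : ℚ)) else 0) =
      PowerSeries.exp ℚ[X] - 1 - PowerSeries.X := by
    ext1 k
    rw [map_sub, map_sub, PowerSeries.coeff_mk, PowerSeries.coeff_exp, PowerSeries.coeff_one,
      PowerSeries.coeff_X]
    rcases k with _ | _ | k
    · simp
    · simp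
    · simp
  rw [expTail, h, map_sub, map_sub, map_one, PowerSeries.heval_X _ hf, exp]

lemma T_add (Γ : ℕ) (f g : Ser) : T Γ (f + g) = T Γ f + T Γ g := by
  ext m
  simp [T]

/-- The remainder is read off from `exp (∑ 𝐀_ℓ + ∑ 𝐁_ℓ) - 𝐁_1`. -/
lemma Rcoeff_succ_succ (n : ℕ) :
    Rcoeff (n + 2) = -truncPoly 10 (PowerSeries.coeff (n + 1)
      (expS (serA 1 + serB 1 + serHigher) - serB 1)) := by
  have hS : PowerSeries.X ∣ serA 1 + serHigher := dvd_add X_dvd_serA_one X_dvd_serHigher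
  have hA : bbA = toSer (expS (serA 1 + serHigher)) - 1 := by
    rw [bbA, sumFrom_add_sumFrom, exp_toSer hS]
  have hB : bbB = toSer (expS (serB 1)) - 1 := by
    rw [bbB, bB_eq one_pos, exp_toSer X_dvd_serB_one]
  have ht : expTail (bB 1) = toSer (expS (serB 1)) - 1 - toSer (serB 1) := by
    rw [bB_eq one_pos, expTail_eq (orderTop_ofPowerSeries_pos X_dvd_serB_one),
      exp_toSer X_dvd_serB_one]
  have hR : R = -(HahnSeries.single 1 1 * T 10 (toSer
      (expS (serA 1 + serB 1 + serHigher) - serB 1 - 1))) := by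
    -- With `a = e^S - 1` and `b = e^{𝐁_1} - 1` this is `(b - 𝐁_1) + a + ab = (1+a)(1+b) - 1 - 𝐁_1`.
    have : expTail (bB 1) + bbA + bbA * bbB =
        toSer (expS (serA 1 + serB 1 + serHigher) - serB 1 - 1) := by
      rw [show serA 1 + serB 1 + serHigher = (serA 1 + serHigher) + serB 1 by ring,
        expS_add hS X_dvd_serB_one, hA, hB, ht]
      simp only [map_sub, map_mul, map_one]
      ring
    rw [R, ← this, T_add, T_add]
    ring
  rw [Rcoeff, hR, HahnSeries.coeff_neg]
  have h1 : ((n + 2 : ℕ) : ℤ) = ((n + 1 : ℕ) : ℤ) + 1 := by push_cast; ring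
  rw [h1, HahnSeries.coeff_single_mul_add, one_mul, T, HahnSeries.map_coeff,
    HahnSeries.ofPowerSeries_apply_coeff]
  congr 2
  rw [map_sub _ _ (1 : ℚ[X]⟦X⟧), PowerSeries.coeff_one, if_neg (by omega), sub_zero]

/-! ### Bernoulli numbers -/

/-- Euler's formula gives `|B_{2j}| = 2 ζ(2j) (2j)!/(2π)^{2j}`, and `2 ζ(2j) ≤ 2 ζ(2) = π²/3 ≤
33/10`. -/
lemma abs_bernoulli_le {j : ℕ} (hj : j ≠ 0) :
    |(_root_.bernoulli (2 * j) : ℝ)| ≤ 33 / 10 * ((2 * j).factorial / (2 * Real.pi) ^ (2 * j)) := by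
  have hz := hasSum_zeta_nat hj
  have hle := hasSum_le (fun n : ℕ => ?_) hz hasSum_zeta_two
  · have hnn := hz.nonneg fun n : ℕ => by positivity
    have hpi : Real.pi ^ 2 / 6 ≤ 33 / 20 := by
      have h1 := Real.pi_lt_d4
      have h2 := Real.pi_pos
      nlinarith
    have h2j : (2 : ℝ) ^ (2 * j - 1) = 2 ^ (2 * j) / 2 := by
      rw [eq_div_iff two_ne_zero, ← pow_succ]
      congr 1
      omega
    have habs := abs_of_nonneg hnn
    rw [h2j] at habs hle
    have hfac : (0 : ℝ) < (2 * j).factorial := by positivity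
    have e : |(-1 : ℝ) ^ (j + 1) * (2 ^ (2 * j) / 2) * Real.pi ^ (2 * j) *
        (_root_.bernoulli (2 * j)) / (2 * j).factorial| =
        (2 * Real.pi) ^ (2 * j) / 2 * |(_root_.bernoulli (2 * j) : ℝ)| / (2 * j).factorial := by
      rw [abs_div, abs_mul, abs_mul, abs_mul, abs_pow, abs_neg, abs_one, one_pow, one_mul,
        abs_of_pos hfac, abs_of_pos (by positivity : (0 : ℝ) < 2 ^ (2 * j) / 2),
        abs_of_pos (by positivity : (0 : ℝ) < Real.pi ^ (2 * j)), mul_pow]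
      ring
    have hpp : (0 : ℝ) < (2 * Real.pi) ^ (2 * j) := by positivity
    rw [e] at habs
    rw [← habs, div_le_iff₀ hfac] at hle
    rw [← mul_div_assoc, le_div_iff₀ hpp]
    nlinarith
  · rcases Nat.eq_zero_or_pos n with rfl | hn
    · simp [hj]
    · have h1 : (1 : ℝ) ≤ n := by exact_mod_cast hn
      apply one_div_le_one_div_of_le (by positivity)
      exact pow_le_pow_right₀ h1 (by omega)

/-- The dominating sequence for `B_{k+1} / (k (k + 1))`. -/
def bernBd (k : ℕ) : ℝ := 33 / 10 * ((k - 1).factorial / (2 * Real.pi) ^ (k + 1))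

lemma bernBd_nonneg (k : ℕ) : 0 ≤ bernBd k := by
  have := Real.pi_pos
  unfold bernBd
  positivity

lemma bern_of_even {k : ℕ} (hk : Even k) : bern k = 0 := by
  rw [bern]
  split_ifs with h
  · rw [bernoulli_eq_zero_of_odd hk.add_one (by omega), zero_div]
  · rfl

lemma abs_bern_le {k : ℕ} : |(bern k : ℝ)| ≤ bernBd k := by
  rcases k.even_or_odd with hk | hk
  · rw [bern_of_even hk]
    simpa using bernBd_nonneg k
  · obtain ⟨j, rfl⟩ := hk
    have h := abs_bernoulli_le (j := j + 1) (by omega)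
    rw [bern, if_pos (by omega), bernBd, Nat.add_sub_cancel]
    push_cast
    rw [abs_div, abs_of_pos (by positivity : (0 : ℝ) < (2 * (j : ℝ) + 1 + 1) * (2 * j + 1)),
      div_le_iff₀ (by positivity)]
    refine h.trans (le_of_eq ?_)
    have e : ((2 * (j + 1)).factorial : ℝ) =
        (2 * (j : ℝ) + 1 + 1) * (2 * j + 1) * (2 * j).factorial := by
      rw [show 2 * (j + 1) = 2 * j + 1 + 1 by ring, Nat.factorial_succ, Nat.factorial_succ]
      push_cast
      ring
    rw [e, show 2 * (j + 1) = 2 * j + 1 + 1 by ring]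
    ring

lemma nrm_coeff_bernSeries_le (k : ℕ) : nrm (PowerSeries.coeff k bernSeries) ≤ bernBd k := by
  rw [bernSeries, PowerSeries.coeff_mk, nrm_C]
  exact abs_bern_le

@[simp] lemma bern_zero : bern 0 = 0 := by simp [bern]

/-! ### Seminorms of compositions and inverses -/

section

variable {n : ℕ} {r : ℝ}

lemma sum_pow_succ_le {x : ℝ} (h0 : 0 ≤ x) (h1 : x < 1) (N : ℕ) :
    ∑ k ∈ Finset.range N, x ^ (k + 1) ≤ x / (1 - x) := by
  have h : ∑ k ∈ Finset.range N, x ^ (k + 1) = x * ∑ k ∈ Finset.range N, x ^ k := by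
    rw [Finset.mul_sum]
    exact Finset.sum_congr rfl fun k _ => by ring
  rw [h, div_eq_mul_inv]
  gcongr
  rw [← tsum_geometric_of_lt_one h0 h1]
  exact (summable_geometric_of_lt_one h0 h1).sum_le_tsum _ fun _ _ => by positivity

lemma wt_subst_le_geometric (hr : 0 ≤ r) {g φ : ℚ[X]⟦X⟧} (hg : PowerSeries.X ∣ g)
    (hφ : PowerSeries.constantCoeff φ = 0) {c x : ℝ} (hc : 0 ≤ c)
    (hb : ∀ k, nrm (PowerSeries.coeff (k + 1) φ) ≤ c) (hx : wt n r g ≤ x) (h1 : x < 1) :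
    wt n r (φ.subst g) ≤ c * (x / (1 - x)) := by
  have hx0 : 0 ≤ x := (wt_nonneg hr g).trans hx
  refine (wt_subst_le hr one_pos (by simpa using hg) φ).trans ?_
  rw [Nat.div_one, Finset.sum_range_succ', PowerSeries.coeff_zero_eq_constantCoeff_apply, hφ,
    nrm_zero, zero_mul, add_zero]
  refine le_trans ?_ (mul_le_mul_of_nonneg_left (sum_pow_succ_le hx0 h1 n) hc)
  rw [Finset.mul_sum]
  refine Finset.sum_le_sum fun k _ => ?_
  have := wt_nonneg (n := n) hr g
  gcongr
  exact hb k

/-- From `1/F = 1 - (F-1)/F` the seminorm `s` of the inverse satisfies `s ≤ 1 + x s`. -/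
lemma wt_invOfUnit_le (hr : 0 ≤ r) {F : ℚ[X]⟦X⟧} (hF : PowerSeries.X ∣ F - 1) {x : ℝ}
    (hx : wt n r (F - 1) ≤ x) (h1 : x < 1) : wt n r (F.invOfUnit 1) ≤ 1 / (1 - x) := by
  have h := mul_invOfUnit_one hF
  have e : F.invOfUnit 1 = 1 - (F - 1) * F.invOfUnit 1 := by
    rw [sub_mul, h]
    ring
  have h2 : wt n r (F.invOfUnit 1) ≤ 1 + x * wt n r (F.invOfUnit 1) := by
    conv_lhs => rw [e]
    refine (wt_sub_le hr _ _).trans ?_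
    rw [wt_one]
    gcongr
    refine (wt_mul_le hr _ _).trans ?_
    have := wt_nonneg (n := n) hr (F.invOfUnit 1)
    gcongr
  rw [le_div_iff₀ (by linarith)]
  linarith

end

/-! ### The terms with `ℓ ≥ 2` -/

lemma sum_moebius_div {l : ℕ} (hl : 2 ≤ l) :
    ∑ d ∈ l.divisors, (ArithmeticFunction.moebius (l / d) : ℚ) = 0 := by
  rw [Nat.sum_div_divisors l fun d => (ArithmeticFunction.moebius d : ℚ)]
  have h := congrArg (fun f : ArithmeticFunction ℤ => f l) ArithmeticFunction.coe_zeta_mul_moebius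
  simp only [ArithmeticFunction.coe_zeta_mul_apply] at h
  rw [ArithmeticFunction.one_apply_ne (by omega)] at h
  exact_mod_cast h

lemma abs_moebius_cast_le (m : ℕ) : |((ArithmeticFunction.moebius m : ℚ) : ℝ)| ≤ 1 := by
  have h := ArithmeticFunction.abs_moebius_le_one (n := m)
  have : |((ArithmeticFunction.moebius m : ℤ) : ℝ)| ≤ 1 := by exact_mod_cast h
  simpa using this

lemma wPoly_eq {l : ℕ} (hl : 2 ≤ l) : wPoly l = -(Polynomial.C (1 / (l : ℚ)) *
    ∑ d ∈ l.divisors, Polynomial.C (ArithmeticFunction.moebius (l / d) : ℚ) *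
      Polynomial.X ^ d) := by
  have h : ∑ d ∈ l.divisors, Polynomial.C (ArithmeticFunction.moebius (l / d) : ℚ) = 0 := by
    rw [← map_sum, sum_moebius_div hl, map_zero]
  rw [wPoly]
  simp only [mul_sub, mul_one, Finset.sum_sub_distrib]
  rw [h, mul_zero, zero_sub]

lemma nrm_wPoly_le {l : ℕ} (hl : 2 ≤ l) : nrm (wPoly l) ≤ 1 := by
  have hl0 : (0 : ℝ) < l := by positivity
  rw [wPoly_eq hl, nrm_neg, nrm_C_mul]
  have h1 : nrm (∑ d ∈ l.divisors, Polynomial.C (ArithmeticFunction.moebius (l / d) : ℚ) *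
      Polynomial.X ^ d) ≤ l := by
    refine (nrm_sum_le _ _).trans ?_
    calc _ ≤ ∑ d ∈ l.divisors, (1 : ℝ) := by
          refine Finset.sum_le_sum fun d _ => ?_
          rw [nrm_C_mul]
          exact mul_le_one₀ (abs_moebius_cast_le _) (nrm_nonneg _) (nrm_X_pow_le d)
      _ ≤ l := by
          simp only [Finset.sum_const, nsmul_eq_mul, mul_one]
          exact_mod_cast Nat.card_divisors_le_self l
  have h2 : |((1 / (l : ℚ) : ℚ) : ℝ)| = 1 / l := by
    push_cast
    rw [abs_of_pos (by positivity)]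
  rw [h2, div_mul_eq_mul_div, one_mul, div_le_one hl0]
  exact h1

section

variable {n l : ℕ} {r : ℝ}

/-- Distinct proper divisors give distinct exponents `l - d` between `⌈l/2⌉` and `l - 1`. The extra
`r^l` extends this range by one, and the geometric sum costs `1/(1-r) ≤ 5/4`. -/
lemma wt_den_sub_one_add_le (h0 : 0 ≤ r) (h5 : r ≤ 1 / 5) (hl : 0 < l) :
    wt n r (den l - 1) + r ^ l ≤ 5 / 4 * r ^ ((l + 1) / 2) := by
  have h1 : wt n r (den l - 1) ≤ ∑ m ∈ Finset.Ico ((l + 1) / 2) l, r ^ m := by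
    rw [den_sub_one hl]
    refine (wt_sum_le h0 _ _).trans ?_
    calc _ ≤ ∑ d ∈ l.properDivisors, r ^ (l - d) := by
          refine Finset.sum_le_sum fun d _ => (wt_mul_le h0 _ _).trans ?_
          rw [wt_C, nrm_C]
          calc _ ≤ 1 * r ^ (l - d) := by
                gcongr
                · exact wt_nonneg h0 _
                · exact abs_moebius_cast_le _
                · exact wt_X_pow_le h0 _
            _ = _ := one_mul _
      _ = ∑ m ∈ l.properDivisors.image (fun d => l - d), r ^ m := by
          rw [Finset.sum_image]
          intro d hd e he hde
          have h1 := (Nat.mem_properDivisors.mp hd).2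
          have h2 := (Nat.mem_properDivisors.mp he).2
          simp only at hde
          omega
      _ ≤ _ := by
          refine Finset.sum_le_sum_of_subset_of_nonneg ?_ fun _ _ _ => by positivity
          intro m hm
          obtain ⟨d, hd, rfl⟩ := Finset.mem_image.mp hm
          have h1 := two_mul_le_of_mem_properDivisors hd
          have h2 := Nat.pos_of_mem_properDivisors hd
          rw [Finset.mem_Ico]
          omega
  have h2 : ∑ m ∈ Finset.Ico ((l + 1) / 2) l, r ^ m + r ^ l ≤ r ^ ((l + 1) / 2) / (1 - r) := by
    rw [← Finset.sum_Ico_succ_top (by omega)]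
    exact geom_sum_Ico_le_of_lt_one h0 (by linarith)
  have h3 : r ^ ((l + 1) / 2) / (1 - r) ≤ 5 / 4 * r ^ ((l + 1) / 2) := by
    rw [div_le_iff₀ (by linarith)]
    have : 0 ≤ r ^ ((l + 1) / 2) := by positivity
    nlinarith
  linarith

lemma pow_half_le (h0 : 0 ≤ r) (h5 : r ≤ 1 / 5) (hl : 0 < l) : r ^ ((l + 1) / 2) ≤ 1 / 5 := by
  calc r ^ ((l + 1) / 2) ≤ r ^ 1 := pow_le_pow_of_le_one h0 (by linarith) (by omega)
    _ ≤ _ := by simpa using h5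

lemma pow_le_sq (h0 : 0 ≤ r) (h5 : r ≤ 1 / 5) (hl : 2 ≤ l) : r ^ l ≤ r ^ 2 :=
  pow_le_pow_of_le_one h0 (by linarith) hl

lemma wt_log_le (h0 : 0 ≤ r) (h5 : r ≤ 1 / 5) (hl : 2 ≤ l) :
    wt n r ((PowerSeries.log ℚ[X]).subst ((1 - PowerSeries.X ^ l) * den l - 1)) ≤
      9 / 5 * r ^ ((l + 1) / 2) := by
  have hd := wt_den_sub_one_add_le (n := n) h0 h5 (by omega : 0 < l)
  have he := pow_half_le h0 h5 (by omega : 0 < l)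
  have hsq := pow_le_sq h0 h5 hl
  have hd0 := wt_nonneg (n := n) h0 (den l - 1)
  set ε := r ^ ((l + 1) / 2)
  have hε0 : 0 ≤ ε := by positivity
  have hrl : r ^ l ≤ 1 / 25 := by nlinarith
  have hrl0 : 0 ≤ r ^ l := by positivity
  -- The constant is `13/10 = (5/4)(1 + 1/25)`, with `r^l ≤ 1/25` in the cross term.
  have hg : wt n r ((1 - PowerSeries.X ^ l) * den l - 1) ≤ 13 / 10 * ε := by
    have e : (1 - PowerSeries.X ^ l) * den l - 1 =
        (den l - 1) - PowerSeries.X ^ l - PowerSeries.X ^ l * (den l - 1) := by ring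
    rw [e]
    have h1 := wt_sub_le (n := n) h0 ((den l - 1) - PowerSeries.X ^ l)
      (PowerSeries.X ^ l * (den l - 1))
    have h2 := wt_sub_le (n := n) h0 (den l - 1) (PowerSeries.X ^ l)
    have h3 := wt_X_pow_le (n := n) h0 l
    have h4 := wt_mul_le (n := n) h0 (PowerSeries.X ^ l) (den l - 1)
    have h5 : wt n r (PowerSeries.X ^ l) * wt n r (den l - 1) ≤ 1 / 25 * (5 / 4 * ε) := by
      gcongr
      · linarith
      · linarith
    linarith
  have hc : ∀ k, nrm (PowerSeries.coeff (k + 1) (PowerSeries.log ℚ[X])) ≤ 1 := by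
    intro k
    rw [PowerSeries.coeff_log, if_neg (by omega), Polynomial.algebraMap_eq, nrm_C]
    push_cast
    rw [abs_div, abs_pow, abs_neg, abs_one, one_pow]
    rw [abs_of_pos (by positivity), div_le_one (by positivity)]
    linarith [Nat.cast_nonneg (α := ℝ) k]
  refine (wt_subst_le_geometric h0 (X_dvd_mul_den_sub_one (by omega))
    PowerSeries.constantCoeff_log zero_le_one hc hg (by linarith)).trans ?_
  rw [one_mul, div_le_iff₀ (by linarith)]
  nlinarith

lemma wt_invE_le (h0 : 0 ≤ r) (h5 : r ≤ 1 / 5) (hl : 2 ≤ l) :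
    wt n r (invE l) ≤ 4 / 3 * (l * r ^ l) := by
  have hd := wt_den_sub_one_add_le (n := n) h0 h5 (by omega : 0 < l)
  have he := pow_half_le h0 h5 (by omega : 0 < l)
  have hrl0 : 0 ≤ r ^ l := by positivity
  have h1 := wt_invOfUnit_le (n := n) h0 (X_dvd_den_sub_one (by omega : 0 < l))
    (x := 1 / 4) (by linarith) (by norm_num)
  have h2 : wt n r (PowerSeries.X ^ l * (den l).invOfUnit 1) ≤ r ^ l * (1 / (1 - 1 / 4)) :=
    (wt_mul_le h0 _ _).trans
      (mul_le_mul (wt_X_pow_le h0 _) h1 (wt_nonneg h0 _) hrl0)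
  refine (wt_mul_le h0 _ _).trans ?_
  rw [wt_C, nrm_C]
  have h3 : |(((l : ℕ) : ℚ) : ℝ)| = l := by simp
  rw [h3]
  calc (l : ℝ) * wt n r (PowerSeries.X ^ l * (den l).invOfUnit 1)
      ≤ l * (r ^ l * (1 / (1 - 1 / 4))) := by gcongr
    _ = _ := by ring

lemma nat_mul_pow_le {m : ℕ} (h0 : 0 ≤ r) (h5 : r ≤ 1 / 5) (hm : 0 < m) :
    (2 * m + 1) * r ^ m ≤ 3 / 5 := by
  induction m, hm using Nat.le_induction with
  | base => norm_num; linarith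
  | succ m hm ih =>
    push_cast
    have hm' : (1 : ℝ) ≤ m := by exact_mod_cast hm
    have : 0 ≤ r ^ m := by positivity
    rw [pow_succ]
    have h1 : r ^ m * r ≤ r ^ m * (1 / 5) := by gcongr
    nlinarith

/-- Half of the power pays for the factor `l`, so all bounds take the form constant times `r^⌈l/2⌉`.
-/
lemma mul_pow_le_half (h0 : 0 ≤ r) (h5 : r ≤ 1 / 5) (hl : 2 ≤ l) :
    l * r ^ l ≤ 3 / 5 * r ^ ((l + 1) / 2) := by
  have h1 := nat_mul_pow_le (m := l / 2) h0 h5 (by omega)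
  have h2 : (l : ℝ) ≤ 2 * ((l / 2 : ℕ) : ℝ) + 1 := by
    have : l ≤ 2 * (l / 2) + 1 := by omega
    exact_mod_cast this
  have h3 : r ^ l = r ^ (l / 2) * r ^ ((l + 1) / 2) := by
    rw [← pow_add]
    congr 1
    omega
  rw [h3, ← mul_assoc]
  gcongr
  exact le_trans (by gcongr) h1

lemma mul_pow_le_sq (h0 : 0 ≤ r) (h5 : r ≤ 1 / 5) (hl : 2 ≤ l) : l * r ^ l ≤ 2 * r ^ 2 := by
  induction l, hl using Nat.le_induction with
  | base => norm_num
  | succ l hl ih =>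
    have hl' : (2 : ℝ) ≤ l := by exact_mod_cast hl
    have : 0 ≤ r ^ l := by positivity
    push_cast
    rw [pow_succ]
    have h1 : r ^ l * r ≤ r ^ l * (1 / 5) := by gcongr
    nlinarith

lemma wt_quotWE_le (h0 : 0 ≤ r) (hl : 2 ≤ l) : wt n r (quotWE l) ≤ wt n r (invE l) := by
  refine (wt_mul_le h0 _ _).trans ?_
  rw [wt_C]
  exact mul_le_of_le_one_left (wt_nonneg h0 _) (nrm_wPoly_le hl)

lemma wt_serA_le (h0 : 0 ≤ r) (h5 : r ≤ 1 / 5) (hl : 2 ≤ l) :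
    wt n r (serA l) ≤ 27 / 10 * r ^ ((l + 1) / 2) := by
  have hx := wt_invE_le (n := n) h0 h5 hl
  have h1 := mul_pow_le_half h0 h5 hl
  have h2 := mul_pow_le_sq h0 h5 hl
  have hy := wt_quotWE_le (n := n) h0 hl
  have hlog := wt_log_le (n := n) h0 h5 hl
  have hw := nrm_wPoly_le hl
  have hy0 := wt_nonneg (n := n) h0 (quotWE l)
  set ε := r ^ ((l + 1) / 2)
  have hε0 : 0 ≤ ε := by positivity
  have hX := X_dvd_quotWE (by omega : 0 < l)
  set y := wt n r (quotWE l)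
  -- Here `8/75 = (4/3) · 2 · (1/25)`. Also `y ≤ (4/5) ε`, so that `y/(1-y) ≤ (9/10) ε`; the total
  -- becomes `9/5 + (1/2)(9/10) + (1/2)(9/10) = 27/10`.
  have hy8 : y ≤ 8 / 75 := by nlinarith
  have hyε : y / (1 - y) ≤ 9 / 10 * ε := by
    rw [div_le_iff₀ (by linarith)]
    nlinarith
  have b1 : wt n r (logRem.subst (quotWE l)) ≤ 1 / 2 * (y / (1 - y)) := by
    refine wt_subst_le_geometric h0 hX constantCoeff_logRem (by norm_num) (fun k => ?_) le_rfl
      (by linarith)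
    rw [logRem, PowerSeries.coeff_mk, nrm_C]
    push_cast
    rw [abs_neg, abs_of_pos (by positivity)]
    apply one_div_le_one_div_of_le (by norm_num)
    have := Nat.cast_nonneg (α := ℝ) k
    nlinarith
  have b2 : wt n r (negLog.subst (quotWE l)) ≤ 1 * (y / (1 - y)) := by
    refine wt_subst_le_geometric h0 hX constantCoeff_negLog (by norm_num) (fun k => ?_) le_rfl
      (by linarith)
    rw [negLog, PowerSeries.coeff_mk, nrm_C]
    push_cast
    rw [abs_of_pos (by positivity), div_le_one (by positivity)]
    linarith [Nat.cast_nonneg (α := ℝ) k]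
  rw [serA]
  have t1 := wt_mul_le (n := n) h0 (PowerSeries.C (wPoly l))
    ((PowerSeries.log ℚ[X]).subst ((1 - PowerSeries.X ^ l) * den l - 1))
  have t2 := wt_mul_le (n := n) h0 (PowerSeries.C (wPoly l)) (logRem.subst (quotWE l))
  have t3 := wt_mul_le (n := n) h0 (PowerSeries.C (Polynomial.C (1 / 2)))
    (negLog.subst (quotWE l))
  rw [wt_C] at t1 t2 t3
  rw [nrm_C] at t3
  have hhalf : |((1 / 2 : ℚ) : ℝ)| = 1 / 2 := by norm_num [abs_of_pos]
  rw [hhalf] at t3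
  have t1' := mul_le_of_le_one_left (wt_nonneg (n := n) h0
    ((PowerSeries.log ℚ[X]).subst ((1 - PowerSeries.X ^ l) * den l - 1))) hw
  have t2' := mul_le_of_le_one_left (wt_nonneg (n := n) h0 (logRem.subst (quotWE l))) hw
  refine (wt_add_le h0 _ _).trans ((add_le_add (wt_add_le h0 _ _) le_rfl).trans ?_)
  linarith

/-- As long as `k t ≤ 3/2`, the growth of `(k-1)!` is harmless: `(k-1)! t^{k-1} ≤ (kt)^{k-1} ≤
(3/2)^{k-1}`, and the powers of `2π ≥ 6` turn this into ratio `1/4`. -/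
lemma bernBd_mul_pow_le {k : ℕ} {t : ℝ} (ht0 : 0 ≤ t) (ht : k * t ≤ 3 / 2) (hk : 0 < k) :
    bernBd k * t ^ k ≤ 17 / 200 * t * (1 / 4) ^ (k - 1) := by
  obtain ⟨k, rfl⟩ : ∃ j, k = j + 1 := ⟨k - 1, by omega⟩
  have hpi : 6 ≤ 2 * Real.pi := by linarith [Real.pi_gt_three]
  have hpi2 : 39 ≤ (2 * Real.pi) ^ 2 := by nlinarith [Real.pi_gt_d2]
  rw [bernBd, Nat.add_sub_cancel]
  have hfac : (k.factorial : ℝ) ≤ ((k + 1 : ℕ) : ℝ) ^ k := by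
    have h : (k.factorial : ℝ) ≤ (k : ℝ) ^ k := by exact_mod_cast Nat.factorial_le_pow k
    refine h.trans ?_
    gcongr
    simp
  have h1 : (k.factorial : ℝ) * t ^ k ≤ (3 / 2) ^ k := by
    calc (k.factorial : ℝ) * t ^ k ≤ ((k + 1 : ℕ) : ℝ) ^ k * t ^ k := by gcongr
      _ = (((k + 1 : ℕ) : ℝ) * t) ^ k := by rw [mul_pow]
      _ ≤ _ := by gcongr
  have h2 : (39 : ℝ) * 6 ^ k ≤ (2 * Real.pi) ^ (k + 1 + 1) := by
    rw [add_assoc, add_comm k, pow_add]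
    gcongr
  have h3 : (k.factorial : ℝ) * t ^ k / (2 * Real.pi) ^ (k + 1 + 1) ≤
      (3 / 2) ^ k / (39 * 6 ^ k) := by gcongr
  have h4 : ((3 / 2 : ℝ)) ^ k / (39 * 6 ^ k) = 1 / 39 * (1 / 4) ^ k := by
    rw [show (3 / 2 : ℝ) = 6 * (1 / 4) by norm_num, mul_pow]
    field_simp
  rw [h4] at h3
  have h5 : (0 : ℝ) ≤ (1 / 4) ^ k := by positivity
  calc 33 / 10 * ((k.factorial : ℝ) / (2 * Real.pi) ^ (k + 1 + 1)) * t ^ (k + 1)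
      = 33 / 10 * t * ((k.factorial : ℝ) * t ^ k / (2 * Real.pi) ^ (k + 1 + 1)) := by ring
    _ ≤ 33 / 10 * t * (1 / 39 * (1 / 4) ^ k) := by gcongr
    _ ≤ _ := by nlinarith [mul_nonneg ht0 h5]

/-- The divergent series is used only up to `k ≤ n/l ≤ n/2`. There `n r² ≤ 1` and `t ≤ 3 r²` give `k
t ≤ 3/2`, so its terms still decay geometrically. This fails for `l = 1`, which is treated
separately. -/
lemma wt_bernSeries_subst_le (h0 : 0 ≤ r) (hn : n * r ^ 2 ≤ 1) (hl : 2 ≤ l) {g : ℚ[X]⟦X⟧}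
    (hg : PowerSeries.X ^ l ∣ g) {t : ℝ} (hgt : wt n r g ≤ t) (ht : t ≤ 3 * r ^ 2) :
    wt n r (bernSeries.subst g) ≤ 3 / 25 * t := by
  have hg0 := wt_nonneg (n := n) h0 g
  have ht0 : 0 ≤ t := hg0.trans hgt
  refine (wt_subst_le h0 (by omega : 0 < l) hg _).trans ?_
  rw [Finset.sum_range_succ', PowerSeries.coeff_zero_eq_constantCoeff_apply,
    constantCoeff_bernSeries, nrm_zero, zero_mul, add_zero]
  calc _ ≤ ∑ k ∈ Finset.range (n / l), 17 / 200 * t * (1 / 4) ^ k := by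
        refine Finset.sum_le_sum fun k hk => ?_
        have hk' : k + 1 ≤ n / l := Finset.mem_range.mp hk
        have hk2 : 2 * (k + 1) ≤ n :=
          (Nat.mul_le_mul_right _ hl).trans
            ((Nat.mul_le_mul_left l hk').trans (Nat.mul_div_le n l))
        have hk3 : (2 : ℝ) * ((k + 1 : ℕ) : ℝ) ≤ n := by exact_mod_cast hk2
        have hkt : ((k + 1 : ℕ) : ℝ) * t ≤ 3 / 2 := by
          have hr2 : 0 ≤ r ^ 2 := by positivity
          have : ((k + 1 : ℕ) : ℝ) * t ≤ ((k + 1 : ℕ) : ℝ) * (3 * r ^ 2) := by gcongr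
          nlinarith
        refine le_trans ?_ (bernBd_mul_pow_le ht0 hkt (by omega))
        gcongr
        · exact bernBd_nonneg _
        · exact nrm_coeff_bernSeries_le _
    _ = 17 / 200 * t * ∑ k ∈ Finset.range (n / l), (1 / 4 : ℝ) ^ k := by rw [Finset.mul_sum]
    _ ≤ 17 / 200 * t * (4 / 3) := by
        gcongr
        refine ((summable_geometric_of_lt_one (by norm_num) (by norm_num)).sum_le_tsum _
          fun _ _ => by positivity).trans ?_
        rw [tsum_geometric_of_lt_one (by norm_num) (by norm_num)]
        norm_num
    _ ≤ _ := by linarith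

lemma wt_serB_le (h0 : 0 ≤ r) (h5 : r ≤ 1 / 5) (hn : n * r ^ 2 ≤ 1) (hl : 2 ≤ l) :
    wt n r (serB l) ≤ 11 / 50 * r ^ ((l + 1) / 2) := by
  have hx := wt_invE_le (n := n) h0 h5 hl
  have h1 := mul_pow_le_half h0 h5 hl
  have h2 := mul_pow_le_sq h0 h5 hl
  have hy := wt_quotWE_le (n := n) h0 hl
  have hx0 := wt_nonneg (n := n) h0 (invE l)
  have hε0 : 0 ≤ r ^ ((l + 1) / 2) := by positivity
  have hr2 : r ^ 2 ≤ 1 / 25 := by nlinarith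
  have hr20 : 0 ≤ r ^ 2 := by positivity
  have hinv := wt_invOfUnit_le (n := n) h0 (X_dvd_one_sub_quotWE (by omega : 0 < l))
    (x := 8 / 75) (by rw [sub_sub_cancel_left, wt_neg]; linarith) (by norm_num)
  have hz : wt n r (-(invE l * (1 - quotWE l).invOfUnit 1)) ≤ 75 / 67 * wt n r (invE l) := by
    rw [wt_neg]
    refine (wt_mul_le h0 _ _).trans ?_
    calc _ ≤ wt n r (invE l) * (1 / (1 - 8 / 75)) := by gcongr
      _ = _ := by ring
  have d1 : PowerSeries.X ^ l ∣ -invE l := (dvd_neg).mpr (X_pow_dvd_invE l)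
  have d2 : PowerSeries.X ^ l ∣ -(invE l * (1 - quotWE l).invOfUnit 1) :=
    (dvd_neg).mpr (Dvd.dvd.mul_right (X_pow_dvd_invE l) _)
  have b1 := wt_bernSeries_subst_le h0 hn hl d1 (t := wt n r (invE l)) (by rw [wt_neg])
    (by linarith)
  have b2 := wt_bernSeries_subst_le h0 hn hl d2 hz (by linarith)
  rw [serB]
  refine (wt_sub_le h0 _ _).trans ?_
  -- The numbers are `(3/25)(1 + 75/67)(4/3)(3/5) < 11/50`.
  linarith

lemma sum_pow_half_le (h0 : 0 ≤ r) (h5 : r ≤ 1 / 5) (n : ℕ) :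
    ∑ l ∈ Finset.Icc 2 (2 * n), r ^ ((l + 1) / 2) ≤ 3 / 10 := by
  rcases Nat.eq_zero_or_pos n with rfl | hn
  · norm_num
  -- The exponent `1` occurs once, each exponent from `2` to `n` twice, so the limit at `r = 1/5` is
  -- `1/5 + 2 · (1/25)/(4/5) = 3/10`. The subtracted term is the tail of this series, which makes
  -- the induction close.
  suffices h : ∑ l ∈ Finset.Icc 2 (2 * n), r ^ ((l + 1) / 2) ≤
      3 / 10 - 1 / 10 * (1 / 5) ^ (n - 1) by
    have : (0 : ℝ) ≤ (1 / 5) ^ (n - 1) := by positivity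
    linarith
  induction n, hn using Nat.le_induction with
  | base => norm_num; linarith
  | succ n hn ih =>
    rw [show 2 * (n + 1) = 2 * n + 1 + 1 by ring, Finset.sum_Icc_succ_top (by omega),
      Finset.sum_Icc_succ_top (by omega), show (2 * n + 1 + 1) / 2 = n + 1 by omega,
      show (2 * n + 1 + 1 + 1) / 2 = n + 1 by omega]
    have h1 : r ^ (n + 1) ≤ (1 / 5) ^ (n + 1) := by gcongr
    obtain ⟨m, rfl⟩ : ∃ m, n = m + 1 := ⟨n - 1, by omega⟩
    simp only [Nat.add_sub_cancel] at ih ⊢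
    rw [show m + 1 + 1 = m + 2 by ring, pow_add (1 / 5 : ℝ)] at h1
    norm_num at h1 ih ⊢
    rw [pow_succ (1 / 5 : ℝ) m]
    rw [show m + 1 + 1 = m + 2 by ring]
    linarith

lemma wt_serHigher_le (h0 : 0 ≤ r) (h5 : r ≤ 1 / 5) (hn : n * r ^ 2 ≤ 1) :
    wt n r serHigher ≤ 7 / 8 + 1 / 1000 := by
  have e : wt n r serHigher =
      wt n r (∑ l ∈ Finset.Icc 2 (2 * n), (serA l + serB l)) := by
    refine wt_congr fun i hi => ?_
    rw [serHigher, PowerSeries.coeff_mk, map_sum]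
    refine Finset.sum_subset (Finset.Icc_subset_Icc le_rfl (by omega)) fun l _ hl => ?_
    have hl' : 2 * i < l := by
      by_contra hcon
      simp only [Finset.mem_Icc] at *
      omega
    rw [map_add, coeff_serA_eq_zero hl', coeff_serB_eq_zero (by omega), add_zero]
  rw [e]
  refine (wt_sum_le h0 _ _).trans ?_
  -- The constant is `27/10 + 11/50 = 73/25`, and `(73/25)(3/10) = 0.876`.
  calc _ ≤ ∑ l ∈ Finset.Icc 2 (2 * n), 73 / 25 * r ^ ((l + 1) / 2) := by
        refine Finset.sum_le_sum fun l hl => ?_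
        have hl2 := (Finset.mem_Icc.mp hl).1
        refine (wt_add_le h0 _ _).trans ?_
        linarith [wt_serA_le (n := n) h0 h5 hl2, wt_serB_le h0 h5 hn hl2]
    _ = 73 / 25 * ∑ l ∈ Finset.Icc 2 (2 * n), r ^ ((l + 1) / 2) := by rw [Finset.mul_sum]
    _ ≤ 73 / 25 * (3 / 10) := by gcongr; exact sum_pow_half_le h0 h5 n
    _ ≤ _ := by norm_num

end

/-! ### The terms with `ℓ = 1` -/

lemma den_one : den 1 = 1 := by simp [den]

lemma invOfUnit_one_eq {A : Type*} [CommRing A] {F G : A⟦X⟧} (hF : PowerSeries.X ∣ F - 1)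
    (h : F * G = 1) : F.invOfUnit 1 = G := by
  have h1 := mul_invOfUnit_one hF
  calc F.invOfUnit 1 = F.invOfUnit 1 * (F * G) := by rw [h, mul_one]
    _ = (F * F.invOfUnit 1) * G := by ring
    _ = G := by rw [h1, one_mul]

lemma invE_one : invE 1 = PowerSeries.X := by
  have : (den 1).invOfUnit 1 = 1 := by
    rw [den_one]
    exact invOfUnit_one_eq (by simp) (by simp)
  rw [invE, this]
  simp

lemma wPoly_one : wPoly 1 = 1 - Polynomial.X := by simp [wPoly]

lemma quotWE_one : quotWE 1 = PowerSeries.C (1 - Polynomial.X) * PowerSeries.X := by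
  rw [quotWE, invE_one, wPoly_one]

lemma coeff_C_mul_X_pow (a : ℚ[X]) (k n : ℕ) :
    PowerSeries.coeff n ((PowerSeries.C a * PowerSeries.X) ^ k) = if n = k then a ^ k else 0 := by
  rw [mul_pow, ← map_pow, PowerSeries.coeff_C_mul, PowerSeries.coeff_X_pow]
  split_ifs <;> simp

lemma coeff_subst_C_mul_X (φ : ℚ[X]⟦X⟧) (a : ℚ[X]) (n : ℕ) :
    PowerSeries.coeff n (φ.subst (PowerSeries.C a * PowerSeries.X : ℚ[X]⟦X⟧)) =
      PowerSeries.coeff n φ * a ^ n := by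
  rw [coeff_subst_eq_sum' (dvd_mul_left _ _) φ (le_refl n), Finset.sum_eq_single n]
  · rw [coeff_C_mul_X_pow, if_pos rfl]
  · intro k _ hk
    rw [coeff_C_mul_X_pow, if_neg (Ne.symm hk), mul_zero]
  · intro h
    exact absurd (Finset.mem_range.mpr (Nat.lt_succ_self n)) h

lemma coeff_serA_one (n : ℕ) : PowerSeries.coeff n (serA 1) =
    -((1 - Polynomial.X) * Polynomial.C (1 / (n : ℚ))) -
      (1 - Polynomial.X) ^ (n + 1) * Polynomial.C (1 / ((n : ℚ) * (n + 1))) +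
      (1 - Polynomial.X) ^ n * (Polynomial.C (1 / 2) * Polynomial.C (1 / (n : ℚ))) := by
  have h1 : ((1 - PowerSeries.X ^ 1) * den 1 - 1 : ℚ[X]⟦X⟧) = -PowerSeries.X := by
    rw [den_one]
    ring
  have h2 : negLog.subst (PowerSeries.X : ℚ[X]⟦X⟧) = negLog := PowerSeries.X_subst _
  rw [serA, h1, log_subst_neg (dvd_refl _), h2, quotWE_one, wPoly_one, map_add, map_add,
    PowerSeries.coeff_C_mul, PowerSeries.coeff_C_mul, PowerSeries.coeff_C_mul, map_neg,
    coeff_subst_C_mul_X, coeff_subst_C_mul_X, negLog, logRem, PowerSeries.coeff_mk,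
    PowerSeries.coeff_mk, map_neg]
  ring

lemma invOfUnit_one_sub_C_mul_X (a : ℚ[X]) :
    (1 - PowerSeries.C a * PowerSeries.X : ℚ[X]⟦X⟧).invOfUnit 1 =
      PowerSeries.rescale a (PowerSeries.mk 1) := by
  refine invOfUnit_one_eq ?_ ?_
  · rw [sub_sub_cancel_left]
    exact (dvd_neg).mpr (dvd_mul_left _ _)
  · have h := congrArg (PowerSeries.rescale a) (PowerSeries.mk_one_mul_one_sub_eq_one ℚ[X])
    rw [map_mul, map_sub, map_one, PowerSeries.rescale_X] at h
    rw [mul_comm, h]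

lemma coeff_bernSeries_subst (a : ℚ[X]) (m : ℕ) :
    PowerSeries.coeff (m + 1) (bernSeries.subst
      (-(PowerSeries.X * (1 - PowerSeries.C a * PowerSeries.X : ℚ[X]⟦X⟧).invOfUnit 1))) =
      -∑ k ∈ Finset.range (m + 1), Polynomial.C (bern (k + 1) * (m.choose k)) * a ^ (m - k) := by
  rw [invOfUnit_one_sub_C_mul_X]
  set I := PowerSeries.rescale a (PowerSeries.mk 1) with hI
  rw [coeff_subst_eq_sum' ((dvd_neg).mpr (dvd_mul_right _ _)) _ (le_refl _),
    Finset.sum_range_succ', ← Finset.sum_neg_distrib]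
  have h0 : PowerSeries.coeff 0 bernSeries = 0 := by simp [bernSeries]
  rw [h0, zero_mul, add_zero]
  refine Finset.sum_congr rfl fun k hk => ?_
  have hk' : k ≤ m := Nat.lt_succ_iff.mp (Finset.mem_range.mp hk)
  have hsign : (-(PowerSeries.X * I)) ^ (k + 1) =
      PowerSeries.C (Polynomial.C ((-1 : ℚ) ^ (k + 1))) *
        (PowerSeries.X ^ (k + 1) * I ^ (k + 1)) := by
    rw [neg_pow, mul_pow]
    simp
  have hc : PowerSeries.coeff (m + 1) (PowerSeries.X ^ (k + 1) * I ^ (k + 1)) =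
      Polynomial.C (m.choose k : ℚ) * a ^ (m - k) := by
    obtain ⟨j, rfl⟩ := Nat.exists_eq_add_of_le hk'
    rw [show k + j + 1 = j + (k + 1) by ring, PowerSeries.coeff_X_pow_mul, hI, ← map_pow,
      PowerSeries.coeff_rescale, PowerSeries.mk_one_pow_eq_mk_choose_add, PowerSeries.coeff_mk,
      Nat.add_sub_cancel_left, mul_comm]
    simp
  rw [hsign, PowerSeries.coeff_C_mul, hc, bernSeries, PowerSeries.coeff_mk]
  rcases (k + 1).even_or_odd with he | ho
  · rw [bern_of_even he]
    simp
  · rw [ho.neg_one_pow]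
    simp only [map_neg, map_one, map_mul]
    ring

/-- The power series `∑ c_n u^n` with
`c_{m+1} = -∑_{k < m} B_{k+2}/((k+1)(k+2)) (m choose k) x^{m-k}`,
which is `B(-1/u + x) - B(-1/u)`. -/
def bernDiff (x : ℚ[X]) : ℚ[X]⟦X⟧ :=
  PowerSeries.mk fun n => -∑ k ∈ Finset.range (n - 1),
    Polynomial.C (bern (k + 1) * ((n - 1).choose k)) * x ^ (n - 1 - k)

lemma coeff_succ_bernDiff (x : ℚ[X]) (m : ℕ) : PowerSeries.coeff (m + 1) (bernDiff x) =
    -∑ k ∈ Finset.range m, Polynomial.C (bern (k + 1) * (m.choose k)) * x ^ (m - k) := by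
  rw [bernDiff, PowerSeries.coeff_mk, Nat.add_sub_cancel]

lemma coeff_zero_bernDiff (x : ℚ[X]) : PowerSeries.coeff 0 (bernDiff x) = 0 := by
  simp [bernDiff]

lemma X_dvd_bernDiff (x : ℚ[X]) : PowerSeries.X ∣ bernDiff x := by
  rw [PowerSeries.X_dvd_iff, ← PowerSeries.coeff_zero_eq_constantCoeff_apply, coeff_zero_bernDiff]

/-- With `E_1 = 1/u` everything is explicit. The term `k = m`, which carries no power of `1 - w`, is
the coefficient of `B(-1/u)` and cancels. -/
lemma serB_one : serB 1 = bernDiff (1 - Polynomial.X) := by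
  ext1 n
  rcases n with _ | m
  · rw [coeff_zero_bernDiff, coeff_serB_eq_zero one_pos]
  · have h := coeff_bernSeries_subst 0 m
    have hz : (PowerSeries.X * (1 - PowerSeries.C (0 : ℚ[X]) * PowerSeries.X).invOfUnit 1 :
        ℚ[X]⟦X⟧) = PowerSeries.X := by
      rw [invOfUnit_one_eq (G := 1) (by simp) (by simp), mul_one]
    rw [hz, Finset.sum_range_succ, Finset.sum_eq_zero, zero_add, Nat.sub_self, pow_zero,
      Nat.choose_self] at h
    · rw [serB, map_sub, invE_one, quotWE_one, coeff_bernSeries_subst, h, coeff_succ_bernDiff,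
        Finset.sum_range_succ, Nat.sub_self, pow_zero, Nat.choose_self]
      ring
    · intro k hk
      rw [zero_pow (by have := Finset.mem_range.mp hk; omega), mul_zero]

/-- Two absorptions of binomial coefficients; they turn the coefficients of `bernDiff` into those of
the Bernoulli polynomial of degree `m + 2`. -/
lemma mul_bern_mul_choose (m k : ℕ) :
    ((m : ℚ) + 1) * (m + 2) * (bern (k + 1) * (m.choose k)) =
      _root_.bernoulli (k + 2) * ((m + 2).choose (k + 2)) := by
  have h1 := Nat.add_one_mul_choose_eq m k
  have h2 := Nat.add_one_mul_choose_eq (m + 1) (k + 1)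
  have h1' : ((m : ℚ) + 1) * (m.choose k) = ((m + 1).choose (k + 1)) * (k + 1) := by
    exact_mod_cast h1
  have h2' : ((m : ℚ) + 1 + 1) * ((m + 1).choose (k + 1)) =
      ((m + 2).choose (k + 2)) * (k + 1 + 1) := by exact_mod_cast h2
  rw [bern, if_pos (by omega)]
  push_cast
  field_simp
  linear_combination (_root_.bernoulli (k + 1 + 1)) * ((m : ℚ) + 2) * h1' +
    (_root_.bernoulli (k + 1 + 1)) * ((k : ℚ) + 1) * h2'

/-- Evaluation of the truncated Bernoulli sums by Bernoulli polynomials. -/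
lemma mul_coeff_bernDiff (x : ℚ[X]) (m : ℕ) :
    Polynomial.C (((m : ℚ) + 1) * (m + 2)) * PowerSeries.coeff (m + 1) (bernDiff x) =
      -((Polynomial.bernoulli (m + 2)).comp x - x ^ (m + 2) +
        Polynomial.C (((m : ℚ) + 2) / 2) * x ^ (m + 1) -
        Polynomial.C (_root_.bernoulli (m + 2))) := by
  have e : (Polynomial.bernoulli (m + 2)).comp x = ∑ i ∈ Finset.range (m + 3),
      Polynomial.C (_root_.bernoulli i * ((m + 2).choose i)) * x ^ (m + 2 - i) := by
    rw [Polynomial.bernoulli, Polynomial.sum_comp]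
    exact Finset.sum_congr rfl fun i _ => Polynomial.monomial_comp _
  -- The indices `i = 0`, `1` and `m + 2` of the Bernoulli polynomial are split off; they give the
  -- three correction terms.
  rw [coeff_succ_bernDiff, e, Finset.sum_range_succ, Finset.sum_range_succ',
    Finset.sum_range_succ', mul_neg, Finset.mul_sum]
  have e2 : ∀ k ∈ Finset.range m, Polynomial.C (((m : ℚ) + 1) * (m + 2)) *
      (Polynomial.C (bern (k + 1) * (m.choose k)) * x ^ (m - k)) =
      Polynomial.C (_root_.bernoulli (k + 1 + 1) * ((m + 2).choose (k + 1 + 1))) *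
        x ^ (m + 2 - (k + 1 + 1)) := by
    intro k _
    rw [← mul_assoc, ← map_mul, mul_bern_mul_choose]
    congr 2
    omega
  rw [Finset.sum_congr rfl e2]
  have e3 : Polynomial.C (_root_.bernoulli (0 + 1) * ((m + 2).choose (0 + 1))) *
      x ^ (m + 2 - (0 + 1)) = -(Polynomial.C (((m : ℚ) + 2) / 2) * x ^ (m + 1)) := by
    rw [zero_add, bernoulli_one, Nat.choose_one_right, ← neg_mul, ← map_neg]
    congr 2
    push_cast
    ring
  rw [e3]
  simp
  ring

/-- This is `B_n(y+1) - B_n(y) = n y^{n-1}` at `y = -w`. -/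
lemma bernoulli_comp_sub (n : ℕ) : (Polynomial.bernoulli n).comp (1 - Polynomial.X) -
    (Polynomial.bernoulli n).comp (-Polynomial.X) =
      -((-1) ^ n * ((n : ℚ[X]) * Polynomial.X ^ (n - 1))) := by
  rw [Polynomial.bernoulli_comp_one_sub_X, Polynomial.bernoulli_comp_neg_X, zsmul_eq_mul,
    nsmul_eq_mul]
  push_cast
  ring

/-- The elementary part of `𝐁_1`. -/
def elem (n : ℕ) : ℚ[X] :=
  -(Polynomial.C (1 / 2) * Polynomial.C (1 / (n : ℚ)) *
      ((1 - Polynomial.X) ^ n + (-Polynomial.X) ^ n)) +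
    Polynomial.C (1 / ((n : ℚ) * (n + 1))) *
      ((1 - Polynomial.X) ^ (n + 1) - (-Polynomial.X) ^ (n + 1))

/-- The shift by one of the argument changes `B` by an elementary series. -/
lemma coeff_serB_one (n : ℕ) : PowerSeries.coeff n (serB 1) =
    PowerSeries.coeff n (bernDiff (-Polynomial.X)) + elem n := by
  rw [serB_one]
  rcases n with _ | m
  · simp [coeff_zero_bernDiff, elem]
  · have h1 := mul_coeff_bernDiff (1 - Polynomial.X) m
    have h2 := mul_coeff_bernDiff (-Polynomial.X) m
    have h3 := bernoulli_comp_sub (m + 2)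
    have ha : (m : ℚ) + 1 ≠ 0 := by positivity
    have hb : (m : ℚ) + 2 ≠ 0 := by positivity
    have h4 : (-1 : ℚ[X]) ^ (m + 2) * (((m + 2 : ℕ) : ℚ[X]) * Polynomial.X ^ (m + 2 - 1)) =
        -(Polynomial.C ((m : ℚ) + 2) * (-Polynomial.X) ^ (m + 1)) := by
      rw [neg_pow (Polynomial.X : ℚ[X]) (m + 1)]
      have : ((m + 2 : ℕ) : ℚ[X]) = Polynomial.C ((m : ℚ) + 2) := by
        rw [← Nat.cast_ofNat (R := ℚ), ← Nat.cast_add, map_natCast]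
      rw [this, show m + 2 - 1 = m + 1 by omega]
      ring
    rw [h4, neg_neg] at h3
    have hq : Polynomial.C (1 / (((m : ℚ) + 1) * (m + 2))) *
        Polynomial.C (((m : ℚ) + 1) * (m + 2)) = 1 := by
      rw [← map_mul, one_div, inv_mul_cancel₀ (mul_ne_zero ha hb), map_one]
    have hq2 : Polynomial.C (1 / (((m : ℚ) + 1) * (m + 2))) * Polynomial.C ((m : ℚ) + 2) =
        Polynomial.C (1 / ((m : ℚ) + 1)) := by
      rw [← map_mul]
      congr 1
      field_simp
    have hhalf : Polynomial.C (((m : ℚ) + 2) / 2) =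
        Polynomial.C (1 / 2) * Polynomial.C ((m : ℚ) + 2) := by
      rw [← map_mul]
      congr 1
      ring
    have htwo : Polynomial.C (1 / 2 : ℚ) * 2 = 1 := by
      have : (2 : ℚ[X]) = Polynomial.C 2 := (map_ofNat Polynomial.C 2).symm
      rw [this, ← map_mul]
      norm_num
    rw [hhalf] at h1 h2
    rw [elem]
    push_cast
    rw [show (m : ℚ) + 1 + 1 = m + 2 by ring]
    generalize PowerSeries.coeff (m + 1) (bernDiff (1 - Polynomial.X)) = b1 at *
    generalize PowerSeries.coeff (m + 1) (bernDiff (-Polynomial.X)) = b2 at *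
    generalize Polynomial.C (1 / (((m : ℚ) + 1) * (m + 2))) = q at *
    generalize Polynomial.C (((m : ℚ) + 1) * (m + 2)) = qi at *
    generalize Polynomial.C ((m : ℚ) + 2) = b at *
    generalize Polynomial.C (1 / ((m : ℚ) + 1)) = a at *
    generalize Polynomial.C (1 / 2 : ℚ) = h at *
    generalize (Polynomial.bernoulli (m + 2)).comp (1 - Polynomial.X) = P1 at *
    generalize (Polynomial.bernoulli (m + 2)).comp (-Polynomial.X) = P2 at *
    have h5 : qi * (b1 - b2) = -(b * (-Polynomial.X) ^ (m + 1)) + (1 - Polynomial.X) ^ (m + 2) -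
        (-Polynomial.X) ^ (m + 2) - h * b * ((1 - Polynomial.X) ^ (m + 1) -
          (-Polynomial.X) ^ (m + 1)) := by
      linear_combination h1 - h2 - h3
    have h6 : b1 - b2 = q * (-(b * (-Polynomial.X) ^ (m + 1)) + (1 - Polynomial.X) ^ (m + 2) -
        (-Polynomial.X) ^ (m + 2) - h * b * ((1 - Polynomial.X) ^ (m + 1) -
          (-Polynomial.X) ^ (m + 1))) := by
      linear_combination q * h5 - (b1 - b2) * hq
    rw [show m + 1 + 1 = m + 2 by ring]
    generalize (1 - Polynomial.X : ℚ[X]) ^ (m + 1) = v1 at *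
    generalize (1 - Polynomial.X : ℚ[X]) ^ (m + 2) = v2 at *
    generalize (-Polynomial.X : ℚ[X]) ^ (m + 1) = w1 at *
    generalize (-Polynomial.X : ℚ[X]) ^ (m + 2) = w2 at *
    linear_combination h6 - (w1 + h * v1 - h * w1) * hq2 + a * w1 * htwo

/-- The elementary part of `𝐀_1 + 𝐁_1`. -/
def serOne : ℚ[X]⟦X⟧ := PowerSeries.mk fun n =>
  -((1 - Polynomial.X) * Polynomial.C (1 / (n : ℚ))) -
    (-Polynomial.X) ^ n * (Polynomial.C (1 / 2) * Polynomial.C (1 / (n : ℚ))) -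
    (-Polynomial.X) ^ (n + 1) * Polynomial.C (1 / ((n : ℚ) * (n + 1)))

/-- All higher powers of `1 - w` in `𝐀_1` cancel against those in `elem`. What remains contains
powers of `-w`, of seminorm at most `1`, instead of powers of `1 - w`, for which only the bound
`2^k` is at hand. -/
lemma serA_one_add_serB_one : serA 1 + serB 1 = serOne + bernDiff (-Polynomial.X) := by
  ext1 n
  rw [map_add, map_add, coeff_serA_one, coeff_serB_one, serOne, PowerSeries.coeff_mk, elem]
  ring

lemma X_dvd_serOne : PowerSeries.X ∣ serOne := by
  rw [PowerSeries.X_dvd_iff, ← PowerSeries.coeff_zero_eq_constantCoeff_apply, serOne]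
  simp

lemma nrm_elem_le {n : ℕ} (hn : 3 ≤ n) : nrm (elem n) ≤ 2 ^ n := by
  have hn' : (3 : ℝ) ≤ n := by exact_mod_cast hn
  have hv : ∀ k, nrm ((1 - Polynomial.X) ^ k) ≤ 2 ^ k := fun k =>
    (nrm_pow_le _ _).trans (pow_le_pow_left₀ (nrm_nonneg _) nrm_one_sub_X_le k)
  have h1 := nrm_add_le ((1 - Polynomial.X) ^ n) ((-Polynomial.X) ^ n)
  have h2 := nrm_sub_le ((1 - Polynomial.X) ^ (n + 1)) ((-Polynomial.X) ^ (n + 1))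
  have h3 := nrm_neg_X_pow_le n
  have h4 := nrm_neg_X_pow_le (n + 1)
  have h5 := hv n
  have h6 := hv (n + 1)
  have h7 : (1 : ℝ) ≤ 2 ^ n := one_le_pow₀ (by norm_num)
  rw [pow_succ (2 : ℝ) n] at h6
  rw [elem]
  refine (nrm_add_le _ _).trans ?_
  rw [nrm_neg, ← map_mul, nrm_C_mul, nrm_C_mul]
  push_cast
  rw [abs_of_pos (by positivity), abs_of_pos (by positivity)]
  have e1 : (1 / 2 : ℝ) * (1 / n) ≤ 1 / 2 * (1 / 3) := by gcongr
  have e2 : 1 / ((n : ℝ) * (n + 1)) ≤ 1 / (3 * (3 + 1)) := by gcongr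
  have f1 := nrm_nonneg ((1 - Polynomial.X) ^ n + (-Polynomial.X) ^ n)
  have f2 := nrm_nonneg ((1 - Polynomial.X) ^ (n + 1) - (-Polynomial.X) ^ (n + 1))
  have g1 : (1 / 2 : ℝ) * (1 / n) * nrm ((1 - Polynomial.X) ^ n + (-Polynomial.X) ^ n) ≤
      1 / 2 * (1 / 3) * (2 ^ n + 1) := by gcongr; linarith
  have g2 : 1 / ((n : ℝ) * (n + 1)) * nrm ((1 - Polynomial.X) ^ (n + 1) -
      (-Polynomial.X) ^ (n + 1)) ≤ 1 / (3 * (3 + 1)) * (2 ^ n * 2 + 1) := by gcongr; linarith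
  linarith

lemma nrm_coeff_serOne_le (n : ℕ) :
    nrm (PowerSeries.coeff n serOne) ≤ 5 / 2 * (1 / n) + 1 / (n * (n + 1)) := by
  rw [serOne, PowerSeries.coeff_mk]
  refine (nrm_sub_le _ _).trans ((add_le_add (nrm_sub_le _ _) le_rfl).trans ?_)
  rw [nrm_neg, ← map_mul, mul_comm, nrm_C_mul, mul_comm _ (Polynomial.C _), nrm_C_mul,
    mul_comm _ (Polynomial.C _), nrm_C_mul]
  push_cast
  have h0 : (0 : ℝ) ≤ n := Nat.cast_nonneg n
  rw [abs_of_nonneg (by positivity), abs_of_nonneg (by positivity),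
    abs_of_nonneg (by positivity)]
  have h1 := nrm_one_sub_X_le
  have h3 := nrm_neg_X_pow_le n
  have h4 := nrm_neg_X_pow_le (n + 1)
  have e1 : (1 : ℝ) / n * nrm (1 - Polynomial.X) ≤ 1 / n * 2 := by gcongr
  have e2 : (1 : ℝ) / 2 * (1 / n) * nrm ((-Polynomial.X) ^ n) ≤ 1 / 2 * (1 / n) * 1 := by gcongr
  have e3 : (1 : ℝ) / (n * (n + 1)) * nrm ((-Polynomial.X) ^ (n + 1)) ≤
    1 / (n * (n + 1)) * 1 := by gcongr
  linarith

lemma wt_serOne_le {n : ℕ} {r : ℝ} (h0 : 0 ≤ r) (h5 : r ≤ 1 / 5) : wt n r serOne ≤ 7 / 10 := by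
  rcases n with _ | m
  · have h := nrm_coeff_serOne_le 0
    simp only [wt, zero_add, Finset.sum_range_one, pow_zero, mul_one]
    simp only [Nat.cast_zero, div_zero, mul_zero, zero_mul, add_zero] at h
    linarith
  rw [wt, Finset.sum_range_succ', Finset.sum_range_succ']
  have hz := nrm_coeff_serOne_le 0
  simp only [Nat.cast_zero, div_zero, mul_zero, zero_mul, add_zero] at hz
  have hone : nrm (PowerSeries.coeff (0 + 1) serOne) ≤ 3 := by
    refine (nrm_coeff_serOne_le 1).trans ?_
    norm_num
  have key : ∀ k : ℕ, nrm (PowerSeries.coeff (k + 1 + 1) serOne) * r ^ (k + 1 + 1) ≤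
      3 / 10 * (1 / 5) ^ (k + 1) := by
    intro k
    have h1 := nrm_coeff_serOne_le (k + 2)
    have h3 : (2 : ℝ) ≤ ((k + 2 : ℕ) : ℝ) := by simp
    have e1 : (1 : ℝ) / ((k + 2 : ℕ) : ℝ) ≤ 1 / 2 := by gcongr
    have e2 : (1 : ℝ) / (((k + 2 : ℕ) : ℝ) * (((k + 2 : ℕ) : ℝ) + 1)) ≤ 1 / (2 * (2 + 1)) := by
      gcongr
    have h4 : nrm (PowerSeries.coeff (k + 2) serOne) ≤ 3 / 2 := by linarith
    calc nrm (PowerSeries.coeff (k + 2) serOne) * r ^ (k + 2) ≤ 3 / 2 * (1 / 5) ^ (k + 2) := by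
          gcongr
      _ = _ := by ring
  have hsum := (Finset.sum_le_sum fun k (_ : k ∈ Finset.range m) => key k)
  rw [← Finset.mul_sum] at hsum
  have hgeo := sum_pow_succ_le (x := 1 / 5) (by norm_num) (by norm_num) m
  have h1 : nrm (PowerSeries.coeff (0 + 1) serOne) * r ^ (0 + 1) ≤ 3 * (1 / 5) := by
    rw [zero_add, pow_one]
    gcongr
  rw [pow_zero, mul_one]
  norm_num at hgeo h1 ⊢
  rw [← PowerSeries.coeff_zero_eq_constantCoeff_apply]
  linarith

/-- The exponential of the convergent part of the exponent. -/
def expConv : ℚ[X]⟦X⟧ := expS (serOne + serHigher)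

lemma wt_expConv_le {n : ℕ} {r : ℝ} (h0 : 0 ≤ r) (h5 : r ≤ 1 / 5) (hn : n * r ^ 2 ≤ 1) :
    wt n r expConv ≤ 5 := by
  refine (wt_expS_le h0 (dvd_add X_dvd_serOne X_dvd_serHigher)).trans ?_
  have h1 := wt_add_le (n := n) h0 serOne serHigher
  have h2 := wt_serOne_le (n := n) h0 h5
  have h3 := wt_serHigher_le h0 h5 hn
  -- The exponent is at most `0.7 + 0.876 < 8/5`, and `e^{8/5} < 5` is checked through fifth powers.
  have h4 : Real.exp (wt n r (serOne + serHigher)) ≤ Real.exp (8 / 5) :=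
    Real.exp_le_exp.mpr (by linarith)
  refine h4.trans ?_
  have h5 : Real.exp (8 / 5) ^ 5 = Real.exp 1 ^ 8 := by
    rw [← Real.exp_nat_mul, ← Real.exp_nat_mul]
    norm_num
  have h6 : Real.exp 1 ^ 8 ≤ 2.7182818286 ^ 8 := by
    gcongr
    exact Real.exp_one_lt_d9.le
  refine le_of_pow_le_pow_left₀ (by norm_num : (5 : ℕ) ≠ 0) (by norm_num) ?_
  rw [h5]
  exact h6.trans (by norm_num)

/-- The bound for the coefficients of the convergent part. -/
lemma nrm_coeff_expConv_le {n k : ℕ} {r : ℝ} (h0 : 0 < r) (h5 : r ≤ 1 / 5) (hn : n * r ^ 2 ≤ 1)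
    (hk : k ≤ n) : nrm (PowerSeries.coeff k expConv) ≤ 5 * (1 / r) ^ k := by
  have h1 := (nrm_coeff_mul_pow_le (n := n) h0.le expConv hk).trans (wt_expConv_le h0.le h5 hn)
  rw [one_div, inv_pow, ← div_eq_mul_inv, le_div_iff₀ (by positivity)]
  exact h1

/-! ### The factorially divergent part -/

/-- The series `∑_{k ≥ 1} bernBd k u^k`. -/
def bernMaj : ℝ⟦X⟧ := PowerSeries.X * PowerSeries.mk fun k => bernBd (k + 1)

lemma coeff_zero_bernMaj : PowerSeries.coeff 0 bernMaj = 0 := by simp [bernMaj]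

lemma coeff_succ_bernMaj (k : ℕ) : PowerSeries.coeff (k + 1) bernMaj = bernBd (k + 1) := by
  rw [bernMaj, PowerSeries.coeff_succ_X_mul, PowerSeries.coeff_mk]

lemma coeff_bernMaj_nonneg (k : ℕ) : 0 ≤ PowerSeries.coeff k bernMaj := by
  rcases k with _ | k
  · rw [coeff_zero_bernMaj]
  · rw [coeff_succ_bernMaj]
    exact bernBd_nonneg _

lemma sum_factorial_mul_factorial_le (j : ℕ) :
    ∑ x ∈ Finset.HasAntidiagonal.antidiagonal j, ((x.1.factorial : ℝ) * x.2.factorial) ≤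
      (j + 1).factorial := by
  have h : ∀ x ∈ Finset.HasAntidiagonal.antidiagonal j,
      ((x.1.factorial : ℝ) * x.2.factorial) ≤ j.factorial := by
    intro x hx
    have := Nat.le_of_dvd (Nat.factorial_pos _)
      (Nat.factorial_mul_factorial_dvd_factorial_add x.1 x.2)
    rw [Finset.HasAntidiagonal.mem_antidiagonal.mp hx] at this
    exact_mod_cast this
  refine (Finset.sum_le_card_nsmul _ _ _ h).trans ?_
  rw [Finset.Nat.card_antidiagonal, nsmul_eq_mul, Nat.factorial_succ]
  push_cast
  rfl

/-- Squaring does not raise the growth rate: `∑ i!(j-i)! ≤ (j+1)!`, and the surplus factor of the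
squares is `(33/10)/(2π)`, about `0.53`. -/
lemma coeff_bernMaj_mul_self_le (k : ℕ) : PowerSeries.coeff k (bernMaj * bernMaj) ≤
    33 / 10 / (2 * Real.pi) * PowerSeries.coeff k bernMaj := by
  have hpi : 0 < 2 * Real.pi := by positivity
  rcases k with _ | _ | j
  · simp [coeff_zero_bernMaj, PowerSeries.coeff_mul]
  · have : PowerSeries.coeff 1 (bernMaj * bernMaj) = 0 := by
      rw [PowerSeries.coeff_mul, Finset.Nat.sum_antidiagonal_eq_sum_range_succ_mk]
      simp [Finset.sum_range_succ, coeff_zero_bernMaj, -PowerSeries.coeff_zero_eq_constantCoeff]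
    rw [zero_add, this]
    exact mul_nonneg (by positivity) (coeff_bernMaj_nonneg 1)
  · have e : bernMaj * bernMaj = PowerSeries.X ^ 2 *
        ((PowerSeries.mk fun k => bernBd (k + 1)) * PowerSeries.mk fun k => bernBd (k + 1)) := by
      rw [bernMaj]
      ring
    rw [coeff_succ_bernMaj, e, show j + 1 + 1 = j + 2 by ring, PowerSeries.coeff_X_pow_mul,
      PowerSeries.coeff_mul]
    have h1 : ∀ x ∈ Finset.HasAntidiagonal.antidiagonal j,
        PowerSeries.coeff x.1 (PowerSeries.mk fun k => bernBd (k + 1)) *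
          PowerSeries.coeff x.2 (PowerSeries.mk fun k => bernBd (k + 1)) =
        (33 / 10) ^ 2 / (2 * Real.pi) ^ (j + 4) * ((x.1.factorial : ℝ) * x.2.factorial) := by
      intro x hx
      rw [PowerSeries.coeff_mk, PowerSeries.coeff_mk, bernBd, bernBd,
        ← Finset.HasAntidiagonal.mem_antidiagonal.mp hx, Nat.add_sub_cancel, Nat.add_sub_cancel]
      field_simp
      ring
    rw [Finset.sum_congr rfl h1, ← Finset.mul_sum, bernBd, show j + 2 - 1 = j + 1 by omega]
    calc (33 / 10 : ℝ) ^ 2 / (2 * Real.pi) ^ (j + 4) *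
          ∑ x ∈ Finset.HasAntidiagonal.antidiagonal j, ((x.1.factorial : ℝ) * x.2.factorial)
        ≤ (33 / 10 : ℝ) ^ 2 / (2 * Real.pi) ^ (j + 4) * (j + 1).factorial := by
          gcongr
          exact sum_factorial_mul_factorial_le j
      _ = _ := by
          field_simp
          ring

/-- The series `∑_{k ≥ 1} bernBd k (u / (1 - u))^k`, which majorizes `bernDiff (-w)`. -/
def diffMaj : ℝ⟦X⟧ := bernMaj.subst (PowerSeries.X * PowerSeries.mk 1 : ℝ⟦X⟧)

lemma coeff_X_mul_mk_one_pow (m k : ℕ) :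
    PowerSeries.coeff (m + 1) ((PowerSeries.X * PowerSeries.mk 1 : ℝ⟦X⟧) ^ (k + 1)) =
      m.choose k := by
  rw [mul_pow, PowerSeries.coeff_X_pow_mul']
  split_ifs with h
  · obtain ⟨j, rfl⟩ := Nat.exists_eq_add_of_le (Nat.succ_le_succ_iff.mp h)
    rw [PowerSeries.mk_one_pow_eq_mk_choose_add, PowerSeries.coeff_mk]
    congr 2
    omega
  · rw [Nat.choose_eq_zero_of_lt (by omega), Nat.cast_zero]

lemma coeff_zero_diffMaj : PowerSeries.coeff 0 diffMaj = 0 := by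
  rw [diffMaj, PowerSeries.coeff_zero_eq_constantCoeff_apply,
    constantCoeff_subst_of_X_dvd (dvd_mul_right _ _),
    ← PowerSeries.coeff_zero_eq_constantCoeff_apply, coeff_zero_bernMaj]

lemma coeff_succ_diffMaj (m : ℕ) : PowerSeries.coeff (m + 1) diffMaj =
    ∑ k ∈ Finset.range (m + 1), bernBd (k + 1) * (m.choose k) := by
  rw [diffMaj, coeff_subst_eq_sum' (dvd_mul_right _ _) _ (le_refl _), Finset.sum_range_succ',
    coeff_zero_bernMaj, zero_mul, add_zero]
  refine Finset.sum_congr rfl fun k _ => ?_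
  rw [coeff_succ_bernMaj, coeff_X_mul_mk_one_pow]

lemma coeff_diffMaj_nonneg (n : ℕ) : 0 ≤ PowerSeries.coeff n diffMaj := by
  rcases n with _ | m
  · rw [coeff_zero_diffMaj]
  · rw [coeff_succ_diffMaj]
    exact Finset.sum_nonneg fun k _ => mul_nonneg (bernBd_nonneg _) (Nat.cast_nonneg _)

/-- Substitution is multiplicative and the powers of `u/(1-u)` have nonnegative coefficients, so the
inequality for `bernMaj` is inherited termwise. -/
lemma coeff_diffMaj_mul_self_le (n : ℕ) : PowerSeries.coeff n (diffMaj * diffMaj) ≤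
    33 / 10 / (2 * Real.pi) * PowerSeries.coeff n diffMaj := by
  have hX : PowerSeries.X ∣ (PowerSeries.X * PowerSeries.mk 1 : ℝ⟦X⟧) := dvd_mul_right _ _
  rcases n with _ | m
  · simp [PowerSeries.coeff_mul, coeff_zero_diffMaj]
  rw [diffMaj, ← PowerSeries.subst_mul (hasSubst_of_X_dvd hX),
    coeff_subst_eq_sum' hX _ (le_refl _), coeff_subst_eq_sum' hX _ (le_refl _), Finset.mul_sum]
  refine Finset.sum_le_sum fun k _ => ?_
  rw [← mul_assoc]
  refine mul_le_mul_of_nonneg_right (coeff_bernMaj_mul_self_le k) ?_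
  rcases k with _ | k
  · rw [pow_zero, PowerSeries.coeff_one, if_neg (by omega)]
  · rw [coeff_X_mul_mk_one_pow]
    exact Nat.cast_nonneg _

/-- The growth `(n-1)! / (2π)^n` of the coefficients. -/
def growth (n : ℕ) : ℝ := (n - 1).factorial / (2 * Real.pi) ^ n

lemma growth_pos (n : ℕ) : 0 < growth n := by
  rw [growth]
  positivity

lemma succ_mul_growth (n : ℕ) : (n + 1) * growth (n + 1) = 2 * Real.pi * growth (n + 2) := by
  rw [growth, growth, show n + 2 - 1 = n + 1 by omega, Nat.add_sub_cancel, Nat.factorial_succ]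
  push_cast
  field_simp
  ring

lemma exp_two_pi_le : Real.exp (2 * Real.pi) ≤ 545 := by
  have h1 : Real.exp (2 * Real.pi) ≤ Real.exp (63 / 10) :=
    Real.exp_le_exp.mpr (by linarith [Real.pi_lt_d2])
  refine h1.trans ?_
  have h5 : Real.exp (63 / 10) ^ 10 = Real.exp 1 ^ 63 := by
    rw [← Real.exp_nat_mul, ← Real.exp_nat_mul]
    norm_num
  have h6 : Real.exp 1 ^ 63 ≤ 2.7182818286 ^ 63 := by
    gcongr
    exact Real.exp_one_lt_d9.le
  refine le_of_pow_le_pow_left₀ (by norm_num : (10 : ℕ) ≠ 0) (by norm_num) ?_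
  rw [h5]
  exact h6.trans (by norm_num)

/-- Read from the top index downwards, the binomial sum is `growth n` times a partial sum of
`e^{2π}`, and `(33/10)/(2π) · 545 < 287`. -/
lemma coeff_diffMaj_le {n : ℕ} (hn : 0 < n) : PowerSeries.coeff n diffMaj ≤ 287 * growth n := by
  obtain ⟨m, rfl⟩ : ∃ m, n = m + 1 := ⟨n - 1, by omega⟩
  have hpi : 0 < 2 * Real.pi := by positivity
  rw [coeff_succ_diffMaj, ← Finset.sum_range_reflect]
  have h1 : ∀ j ∈ Finset.range (m + 1), bernBd (m + 1 - 1 - j + 1) *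
      (m.choose (m + 1 - 1 - j) : ℝ) =
      33 / 10 / (2 * Real.pi) * growth (m + 1) * ((2 * Real.pi) ^ j / j.factorial) := by
    intro j hj
    obtain ⟨i, rfl⟩ := Nat.exists_eq_add_of_le (Nat.lt_succ_iff.mp (Finset.mem_range.mp hj))
    have e : j + i + 1 - 1 - j = i := by omega
    rw [e, bernBd, growth, Nat.add_sub_cancel, Nat.add_sub_cancel]
    have h2 : ((j + i).choose i : ℝ) * i.factorial * j.factorial = (j + i).factorial := by
      have := Nat.choose_mul_factorial_mul_factorial (Nat.le_add_left i j)
      rw [Nat.add_sub_cancel] at this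
      exact_mod_cast this
    rw [← h2]
    field_simp
    ring
  rw [Finset.sum_congr rfl h1, ← Finset.mul_sum]
  have h2 := (Real.sum_le_exp_of_nonneg hpi.le (m + 1)).trans exp_two_pi_le
  have h3 : 33 / 10 / (2 * Real.pi) ≤ 33 / 10 / (157 / 25) := by
    gcongr
    linarith [Real.pi_gt_d2]
  have hg := growth_pos (m + 1)
  calc _ ≤ 33 / 10 / (157 / 25) * growth (m + 1) * 545 := by gcongr
    _ ≤ _ := by linarith

lemma nrm_coeff_bernDiff_le (n : ℕ) :
    nrm (PowerSeries.coeff n (bernDiff (-Polynomial.X))) ≤ PowerSeries.coeff n diffMaj := by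
  rcases n with _ | m
  · rw [coeff_zero_bernDiff, coeff_zero_diffMaj, nrm_zero]
  rw [coeff_succ_bernDiff, coeff_succ_diffMaj, nrm_neg]
  refine (nrm_sum_le _ _).trans ((Finset.sum_le_sum fun k _ => ?_).trans
    (Finset.sum_le_sum_of_subset_of_nonneg (Finset.range_subset_range.mpr (Nat.le_succ m))
      fun k _ _ => mul_nonneg (bernBd_nonneg _) (Nat.cast_nonneg _)))
  rw [nrm_C_mul, Rat.cast_mul, abs_mul, Rat.cast_natCast, Nat.abs_cast]
  calc _ ≤ bernBd (k + 1) * (m.choose k : ℝ) * 1 := by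
        gcongr
        · exact nrm_nonneg _
        · exact mul_nonneg (bernBd_nonneg _) (Nat.cast_nonneg _)
        · exact abs_bern_le
        · exact nrm_neg_X_pow_le _
    _ = _ := mul_one _

/-- Symmetrisation: on the antidiagonal the weight `x.1` averages to `n/2`. This gains the factor
two that closes the induction for `expDiv`. -/
lemma two_mul_sum_antidiagonal_fst (a : ℕ → ℝ) (n : ℕ) :
    2 * ∑ x ∈ Finset.HasAntidiagonal.antidiagonal n, (x.1 : ℝ) * a x.1 * a x.2 =
      n * ∑ x ∈ Finset.HasAntidiagonal.antidiagonal n, a x.1 * a x.2 := by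
  have h : ∑ x ∈ Finset.HasAntidiagonal.antidiagonal n, (x.1 : ℝ) * a x.1 * a x.2 =
      ∑ x ∈ Finset.HasAntidiagonal.antidiagonal n, (x.2 : ℝ) * a x.2 * a x.1 :=
    (Finset.Nat.sum_antidiagonal_swap (f := fun x : ℕ × ℕ => (x.1 : ℝ) * a x.1 * a x.2)).symm
  rw [two_mul]
  nth_rewrite 2 [h]
  rw [← Finset.sum_add_distrib, Finset.mul_sum]
  refine Finset.sum_congr rfl fun x hx => ?_
  rw [← Finset.HasAntidiagonal.mem_antidiagonal.mp hx]
  push_cast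
  ring

/-- The exponential of the divergent part of the exponent. -/
def expDiv : ℚ[X]⟦X⟧ := expS (bernDiff (-Polynomial.X))

lemma coeff_zero_expDiv : PowerSeries.coeff 0 expDiv = 1 := by
  rw [expDiv, PowerSeries.coeff_zero_eq_constantCoeff_apply, constantCoeff_expS (X_dvd_bernDiff _)]

lemma nrm_natCast_mul (n : ℕ) (p : ℚ[X]) : nrm ((n : ℚ[X]) * p) = n * nrm p := by
  rw [← map_natCast Polynomial.C, nrm_C_mul, Rat.cast_natCast, Nat.abs_cast]

/-- Induction on `n e_n = ∑ k d_k e_{n-k}`. If `e ≤ C H` in positive degrees, the recursion and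
symmetrisation give `e_n ≤ (1 + C c/2) H_n` with `c = (33/10)/(157/25)`; the choice `C = 34/25`
satisfies `1 + C c/2 ≤ C`. The indicator term accounts for `e_0 = 1`. -/
lemma nrm_coeff_expDiv_le_add (n : ℕ) : nrm (PowerSeries.coeff n expDiv) ≤
    34 / 25 * PowerSeries.coeff n diffMaj + if n = 0 then 1 else 0 := by
  induction n using Nat.strong_induction_on with
  | _ n ih =>
  rcases n with _ | n
  · rw [coeff_zero_expDiv, coeff_zero_diffMaj, nrm_one]
    simp
  have hrec := congrArg nrm (succ_mul_coeff_expS (X_dvd_bernDiff (-Polynomial.X)) n)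
  rw [nrm_natCast_mul] at hrec
  rw [if_neg (by omega), add_zero]
  set H := fun i => PowerSeries.coeff i diffMaj with hH
  have hH0 : ∀ i, 0 ≤ H i := coeff_diffMaj_nonneg
  have h1 : ∀ k ∈ Finset.range (n + 1), nrm (((k + 1 : ℕ) : ℚ[X]) *
      PowerSeries.coeff (k + 1) (bernDiff (-Polynomial.X)) * PowerSeries.coeff (n - k) expDiv) ≤
      34 / 25 * (((k + 1 : ℕ) : ℝ) * H (k + 1) * H (n + 1 - (k + 1))) +
        (if k = n then ((n + 1 : ℕ) : ℝ) * H (n + 1) else 0) := by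
    intro k hk
    have hk' : k < n + 1 := Finset.mem_range.mp hk
    have h2 := ih (n - k) (by omega)
    have h3 := nrm_coeff_bernDiff_le (k + 1)
    calc _ ≤ nrm (((k + 1 : ℕ) : ℚ[X]) * PowerSeries.coeff (k + 1) (bernDiff (-Polynomial.X))) *
          nrm (PowerSeries.coeff (n - k) expDiv) := nrm_mul_le _ _
      _ ≤ (((k + 1 : ℕ) : ℝ) * H (k + 1)) *
          (34 / 25 * H (n - k) + if n - k = 0 then 1 else 0) := by
          rw [nrm_natCast_mul]
          gcongr
          · exact nrm_nonneg _
          · exact mul_nonneg (Nat.cast_nonneg _) (hH0 _)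
      _ = _ := by
          rw [Nat.add_sub_add_right]
          by_cases hkn : k = n
          · subst hkn
            simp
            ring
          · rw [if_neg (by omega), if_neg hkn]
            ring
  have h4 := (nrm_sum_le (Finset.range (n + 1)) fun k => ((k + 1 : ℕ) : ℚ[X]) *
      PowerSeries.coeff (k + 1) (bernDiff (-Polynomial.X)) *
        PowerSeries.coeff (n - k) expDiv).trans (Finset.sum_le_sum h1)
  rw [Finset.sum_add_distrib, ← Finset.mul_sum, Finset.sum_ite_eq', if_pos (by simp)] at h4
  have h5 : ∑ k ∈ Finset.range (n + 1), ((k + 1 : ℕ) : ℝ) * H (k + 1) * H (n + 1 - (k + 1)) =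
      ∑ x ∈ Finset.HasAntidiagonal.antidiagonal (n + 1), (x.1 : ℝ) * H x.1 * H x.2 := by
    rw [Finset.Nat.sum_antidiagonal_eq_sum_range_succ_mk,
      Finset.sum_range_succ' (fun k => (((k, n + 1 - k) : ℕ × ℕ).1 : ℝ) * _ * _)]
    simp only [Nat.cast_zero, zero_mul, add_zero]
  have h6 := two_mul_sum_antidiagonal_fst H (n + 1)
  have h7 : ∑ x ∈ Finset.HasAntidiagonal.antidiagonal (n + 1), H x.1 * H x.2 =
      PowerSeries.coeff (n + 1) (diffMaj * diffMaj) := (PowerSeries.coeff_mul _ _ _).symm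
  have h8 := coeff_diffMaj_mul_self_le (n + 1)
  have h9 : 33 / 10 / (2 * Real.pi) ≤ 33 / 10 / (157 / 25) := by
    gcongr
    linarith [Real.pi_gt_d2]
  have h10 : PowerSeries.coeff (n + 1) (diffMaj * diffMaj) ≤ 33 / 10 / (157 / 25) * H (n + 1) :=
    h8.trans (mul_le_mul_of_nonneg_right h9 (hH0 _))
  rw [h7] at h6
  rw [h5] at h4
  have hn : (0 : ℝ) < ((n + 1 : ℕ) : ℝ) := by positivity
  have h11 := mul_le_mul_of_nonneg_left h10 hn.le
  have h12 := mul_nonneg hn.le (hH0 (n + 1))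
  refine le_of_mul_le_mul_left ?_ hn
  calc _ ≤ _ := hrec.le.trans h4
    _ ≤ _ := by
      change _ ≤ ((n + 1 : ℕ) : ℝ) * (34 / 25 * H (n + 1))
      nlinarith

lemma nrm_coeff_expDiv_le {n : ℕ} (hn : 0 < n) :
    nrm (PowerSeries.coeff n expDiv) ≤ 391 * growth n := by
  have h1 := nrm_coeff_expDiv_le_add n
  rw [if_neg hn.ne', add_zero] at h1
  linarith [coeff_diffMaj_le hn, growth_pos n]

/-! ### The quadratic part of the exponential of the divergent part -/

lemma factorial_add_mul_factorial_le {a b : ℕ} (h : a ≤ b) (c : ℕ) :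
    (a + c).factorial * b.factorial ≤ a.factorial * (b + c).factorial := by
  induction c with
  | zero => simp
  | succ c ih =>
    rw [← add_assoc, ← add_assoc, Nat.factorial_succ, Nat.factorial_succ (b + c)]
    calc (a + c + 1) * (a + c).factorial * b.factorial =
          (a + c + 1) * ((a + c).factorial * b.factorial) := by ring
      _ ≤ (b + c + 1) * (a.factorial * (b + c).factorial) := by gcongr
      _ = _ := by ring

/-- The two end terms are `2 (p+3)!` each. The `p` others are at most `3! (p+2)!`, together at most
`6 (p+3)!`. -/
lemma sum_factorial_mul_factorial_interior_le (p : ℕ) :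
    ∑ j ∈ Finset.range (p + 2), (j + 2).factorial * (p + 2 + 1 - j).factorial ≤
      10 * (p + 3).factorial := by
  rw [Finset.sum_range_succ, Finset.sum_range_succ']
  have h1 : ∀ j ∈ Finset.range p, (j + 1 + 2).factorial * (p + 2 + 1 - (j + 1)).factorial ≤
      6 * (p + 2).factorial := by
    intro j hj
    obtain ⟨i, hi⟩ := Nat.exists_eq_add_of_lt (Finset.mem_range.mp hj)
    have h := factorial_add_mul_factorial_le (show 3 ≤ i + 3 by omega) j
    rw [show p + 2 + 1 - (j + 1) = i + 3 by omega, show j + 1 + 2 = 3 + j by ring,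
      show p + 2 = i + 3 + j by omega]
    exact h
  have h2 := Finset.sum_le_card_nsmul _ _ _ h1
  rw [Finset.card_range, nsmul_eq_mul, Nat.cast_id] at h2
  have h3 : p * (6 * (p + 2).factorial) ≤ 6 * (p + 3).factorial := by
    rw [Nat.factorial_succ (p + 2)]
    calc p * (6 * (p + 2).factorial) = 6 * (p * (p + 2).factorial) := by ring
      _ ≤ 6 * ((p + 2 + 1) * (p + 2).factorial) := by
        gcongr
        omega
  have h4 : p + 2 + 1 - (p + 1) = 2 := by omega
  rw [h4, zero_add, Nat.sub_zero, Nat.factorial_two, show p + 1 + 2 = p + 3 by ring,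
    show p + 2 + 1 = p + 3 by ring]
  rw [show p + 2 + 1 = p + 3 by ring] at h2
  omega

lemma coeff_one_bernDiff (x : ℚ[X]) : PowerSeries.coeff 1 (bernDiff x) = 0 := by
  simp [bernDiff]

lemma coeff_one_expDiv : PowerSeries.coeff 1 expDiv = 0 := by
  have h := succ_mul_coeff_expS (X_dvd_bernDiff (-Polynomial.X)) 0
  simp only [zero_add, Finset.range_one, Finset.sum_singleton, coeff_one_bernDiff, mul_zero,
    zero_mul, Nat.cast_one, one_mul] at h
  exact h

lemma coeff_two_diffMaj_le : PowerSeries.coeff 2 diffMaj ≤ 1 / 10 := by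
  have h := coeff_succ_diffMaj 1
  have hpi : 157 / 25 ≤ 2 * Real.pi := by linarith [Real.pi_gt_d2]
  have h2 : bernBd 1 ≤ 33 / 10 * (1 / (157 / 25) ^ 2) := by
    rw [bernBd]
    simp only [Nat.reduceSub, Nat.factorial_zero, Nat.cast_one, Nat.reduceAdd]
    gcongr
  have h3 : bernBd 2 ≤ 33 / 10 * (1 / (157 / 25) ^ 3) := by
    rw [bernBd]
    simp only [Nat.reduceSub, Nat.factorial_one, Nat.cast_one, Nat.reduceAdd]
    gcongr
  simp only [Finset.sum_range_succ, Finset.sum_range_zero, Nat.choose_zero_right, Nat.choose_self,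
    Nat.cast_one, mul_one, zero_add] at h
  norm_num at h h2 h3
  linarith

lemma growth_two_step (q : ℕ) : ((q : ℝ) + 4) * (q + 3) * growth (q + 3) =
    (2 * Real.pi) ^ 2 * growth (q + 5) := by
  have h1 := succ_mul_growth (q + 2)
  have h2 := succ_mul_growth (q + 3)
  push_cast at h1 h2
  linear_combination ((q : ℝ) + 4) * h1 + 2 * Real.pi * h2

lemma two_pi_sq_le : (2 * Real.pi) ^ 2 ≤ 79 / 2 := by
  have h1 := Real.pi_lt_d2
  have h2 := Real.pi_pos
  calc (2 * Real.pi) ^ 2 ≤ (2 * 3.142) ^ 2 := by gcongr; linarith [Real.pi_lt_d4]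
    _ ≤ _ := by norm_num

/-- The final comparison of `nrm_coeff_expDiv_sub_le`, with `1122170 = 287 · 391 · 10` and `(2π)² ≤
79/2`. It is close to sharp at `q = 593`. -/
lemma cubic_bound {q : ℝ} (hq : 593 ≤ q) : 1122170 * (q + 5) +
    (2 * (1 / 10) * 391 + (q + 3) * 287 * (7 / 50)) * (q + 2) * (79 / 2) ≤
      (q + 5) * (6 * (q + 3) * (q + 2)) := by
  obtain ⟨x, rfl⟩ : ∃ x : ℝ, q = 593 + x := ⟨q - 593, by ring⟩
  have hx0 : 0 ≤ x := by linarith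
  nlinarith [pow_nonneg hx0 3, pow_nonneg hx0 2]

/-- The coefficients of `exp D` and of `D` agree up to a relative error of order `1 / n`. -/
lemma nrm_coeff_expDiv_sub_le {n : ℕ} (hn : 597 ≤ n) :
    n * nrm (PowerSeries.coeff (n + 1) expDiv -
      PowerSeries.coeff (n + 1) (bernDiff (-Polynomial.X))) ≤ 6 * growth (n + 1) := by
  obtain ⟨q, rfl⟩ := Nat.exists_eq_add_of_le' (show 4 ≤ n by omega)
  obtain ⟨p, hq⟩ := Nat.exists_eq_add_of_le' (show 2 ≤ q by omega)
  have hq590 : (593 : ℝ) ≤ q := by exact_mod_cast (by omega : 593 ≤ q)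
  set D := bernDiff (-Polynomial.X) with hD
  have hrec := succ_mul_coeff_expS (X_dvd_bernDiff (-Polynomial.X)) (q + 4)
  rw [← hD, ← expDiv, Finset.sum_range_succ, Nat.sub_self, coeff_zero_expDiv, mul_one] at hrec
  set f : ℕ → ℚ[X] := fun k => ((k + 1 : ℕ) : ℚ[X]) * PowerSeries.coeff (k + 1) D *
    PowerSeries.coeff (q + 4 - k) expDiv with hf
  have hrec2 : ((q + 4 + 1 : ℕ) : ℚ[X]) * (PowerSeries.coeff (q + 4 + 1) expDiv -
      PowerSeries.coeff (q + 4 + 1) D) = ∑ k ∈ Finset.range (q + 4), f k := by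
    rw [mul_sub, hrec]
    ring
  -- Neither `D` nor `exp D` has a linear term, so the outermost terms vanish. The largest surviving
  -- factorial is then two steps below the top, which is the source of the gain.
  have hf0 : f 0 = 0 := by
    rw [hf]
    simp only [zero_add]
    rw [hD, coeff_one_bernDiff]
    ring
  have hf3 : f (q + 3) = 0 := by
    rw [hf]
    simp only
    rw [show q + 4 - (q + 3) = 1 by omega, coeff_one_expDiv, mul_zero]
  rw [Finset.sum_range_succ, Finset.sum_range_succ, Finset.sum_range_succ',
    Finset.sum_range_succ', hf0, hf3, add_zero, add_zero, zero_add] at hrec2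
  have hD' : ∀ i, 0 < i → nrm (PowerSeries.coeff i D) ≤ 287 * growth i := fun i hi =>
    (nrm_coeff_bernDiff_le i).trans (coeff_diffMaj_le hi)
  have hfle : ∀ k, nrm (f k) ≤ ((k + 1 : ℕ) : ℝ) * nrm (PowerSeries.coeff (k + 1) D) *
      nrm (PowerSeries.coeff (q + 4 - k) expDiv) := by
    intro k
    refine (nrm_mul_le _ _).trans (le_of_eq ?_)
    rw [nrm_natCast_mul]
  have hfirst : nrm (f 1) ≤ 2 * (1 / 10) * (391 * growth (q + 3)) := by
    refine (hfle 1).trans ?_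
    have h1 := (nrm_coeff_bernDiff_le 2).trans coeff_two_diffMaj_le
    have h2 := nrm_coeff_expDiv_le (show 0 < q + 3 by omega)
    rw [show q + 4 - 1 = q + 3 by omega]
    push_cast
    norm_num
    have := nrm_nonneg (PowerSeries.coeff (q + 3) expDiv)
    have := nrm_nonneg (PowerSeries.coeff 2 D)
    gcongr
    linarith
  have hlast : nrm (f (q + 2)) ≤ ((q : ℝ) + 3) * (287 * growth (q + 3)) * (7 / 50) := by
    refine (hfle (q + 2)).trans ?_
    have h1 := hD' (q + 3) (by omega)
    have h2 := nrm_coeff_expDiv_le_add 2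
    have h3 := coeff_two_diffMaj_le
    rw [if_neg (by norm_num)] at h2
    -- From `(34/25)(1/10) = 0.136`.
    have h4 : nrm (PowerSeries.coeff 2 expDiv) ≤ 7 / 50 := by linarith
    rw [show q + 4 - (q + 2) = 2 by omega]
    have e : ((q + 2 + 1 : ℕ) : ℝ) = q + 3 := by push_cast; ring
    rw [e]
    have := nrm_nonneg (PowerSeries.coeff 2 expDiv)
    have := growth_pos (q + 3)
    gcongr
  -- All remaining terms have both indices at least `3`; both factors are bounded by `growth`, and
  -- the powers of `2π` combine to a common denominator.
  have hmid : nrm (∑ j ∈ Finset.range q, f (j + 1 + 1)) ≤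
      287 * 391 * ((q : ℝ) + 5) * (10 * (q + 1).factorial) / (2 * Real.pi) ^ (q + 5) := by
    refine (nrm_sum_le _ _).trans ?_
    have h1 : ∀ j ∈ Finset.range q, nrm (f (j + 1 + 1)) ≤
        287 * 391 * ((q : ℝ) + 5) / (2 * Real.pi) ^ (q + 5) *
          (((j + 2).factorial * (q + 1 - j).factorial : ℕ) : ℝ) := by
      intro j hj
      refine (hfle _).trans ?_
      obtain ⟨i, hi⟩ := Nat.exists_eq_add_of_lt (Finset.mem_range.mp hj)
      have h1 := hD' (j + 3) (by omega)
      have h2 := nrm_coeff_expDiv_le (show 0 < i + 3 by omega)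
      rw [show q + 4 - (j + 1 + 1) = i + 3 by omega, show q + 1 - j = i + 2 by omega]
      have h3 : ((j + 1 + 1 + 1 : ℕ) : ℝ) ≤ q + 5 := by
        exact_mod_cast (by omega : j + 1 + 1 + 1 ≤ q + 5)
      have h4 := growth_pos (j + 3)
      have h5 := nrm_nonneg (PowerSeries.coeff (i + 3) expDiv)
      calc _ ≤ ((q : ℝ) + 5) * (287 * growth (j + 3)) * (391 * growth (i + 3)) := by
            gcongr
            exact nrm_nonneg _
        _ = _ := by
          rw [growth, growth, show j + 3 - 1 = j + 2 by omega, show i + 3 - 1 = i + 2 by omega,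
            show q + 5 = (j + 3) + (i + 3) by omega, pow_add]
          push_cast
          field_simp
          ring
    refine (Finset.sum_le_sum h1).trans ?_
    rw [← Finset.mul_sum, ← Nat.cast_sum]
    have h2 := sum_factorial_mul_factorial_interior_le p
    rw [← hq, show p + 3 = q + 1 by omega] at h2
    have h3 : ((∑ j ∈ Finset.range q, (j + 2).factorial * (q + 1 - j).factorial : ℕ) : ℝ) ≤
        10 * (q + 1).factorial := by exact_mod_cast h2
    calc _ ≤ 287 * 391 * ((q : ℝ) + 5) / (2 * Real.pi) ^ (q + 5) *
          (10 * (q + 1).factorial) := by gcongr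
      _ = _ := by ring
  have hsum := congrArg nrm hrec2
  rw [nrm_natCast_mul] at hsum
  have htot : ((q + 4 + 1 : ℕ) : ℝ) * nrm (PowerSeries.coeff (q + 4 + 1) expDiv -
      PowerSeries.coeff (q + 4 + 1) D) ≤
      287 * 391 * ((q : ℝ) + 5) * (10 * (q + 1).factorial) / (2 * Real.pi) ^ (q + 5) +
        2 * (1 / 10) * (391 * growth (q + 3)) +
        ((q : ℝ) + 3) * (287 * growth (q + 3)) * (7 / 50) := by
    rw [hsum]
    refine (nrm_add_le _ _).trans (add_le_add ((nrm_add_le _ _).trans ?_) hlast)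
    exact add_le_add hmid hfirst
  set t := nrm (PowerSeries.coeff (q + 4 + 1) expDiv - PowerSeries.coeff (q + 4 + 1) D) with ht
  have hg := growth_pos (q + 5)
  have e1 : 287 * 391 * ((q : ℝ) + 5) * (10 * (q + 1).factorial) / (2 * Real.pi) ^ (q + 5) *
      ((q + 4) * (q + 3) * (q + 2)) = 1122170 * (q + 5) * growth (q + 5) := by
    rw [growth, show q + 5 - 1 = q + 4 by omega, Nat.factorial_succ (q + 3),
      Nat.factorial_succ (q + 2), Nat.factorial_succ (q + 1)]
    push_cast
    field_simp
    ring
  have e2 := growth_two_step q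
  have e3 : ((q : ℝ) + 4) * (q + 3) * growth (q + 3) ≤ 79 / 2 * growth (q + 5) := by
    rw [e2]
    exact mul_le_mul_of_nonneg_right two_pi_sq_le hg.le
  have hgoal : ((q : ℝ) + 5) * t * ((q + 4) * (q + 3) * (q + 2)) ≤
      ((q : ℝ) + 5) * (6 * (q + 3) * (q + 2)) * growth (q + 5) := by
    have h1 : ((q : ℝ) + 5) * t * ((q + 4) * (q + 3) * (q + 2)) ≤
        (287 * 391 * ((q : ℝ) + 5) * (10 * (q + 1).factorial) / (2 * Real.pi) ^ (q + 5) +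
        2 * (1 / 10) * (391 * growth (q + 3)) +
        ((q : ℝ) + 3) * (287 * growth (q + 3)) * (7 / 50)) * ((q + 4) * (q + 3) * (q + 2)) := by
      refine mul_le_mul_of_nonneg_right ?_ (by positivity)
      refine le_trans (le_of_eq ?_) htot
      push_cast
      ring
    have h2 : (2 * (1 / 10) * (391 * growth (q + 3)) +
        ((q : ℝ) + 3) * (287 * growth (q + 3)) * (7 / 50)) * ((q + 4) * (q + 3) * (q + 2)) ≤
        (2 * (1 / 10) * 391 + ((q : ℝ) + 3) * 287 * (7 / 50)) * (q + 2) *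
          (79 / 2 * growth (q + 5)) := by
      calc _ = (2 * (1 / 10) * 391 + ((q : ℝ) + 3) * 287 * (7 / 50)) * (q + 2) *
          (((q : ℝ) + 4) * (q + 3) * growth (q + 3)) := by ring
        _ ≤ _ := mul_le_mul_of_nonneg_left e3 (by positivity)
    have h3 := cubic_bound hq590
    have h4 := mul_le_mul_of_nonneg_right h3 hg.le
    linarith
  have hfin : ((q : ℝ) + 4) * t * (((q : ℝ) + 5) * ((q + 3) * (q + 2))) ≤
      6 * growth (q + 5) * (((q : ℝ) + 5) * ((q + 3) * (q + 2))) := by linarith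
  have := le_of_mul_le_mul_right hfin (by positivity)
  push_cast
  exact this

/-! ### The coefficient of `w^10` -/

/-- A single summand carries `w^10`, and its size is `(33/10)(2π)^9/10!`, about `13.9`, times
`growth`. This is far below the bound `287` for the whole seminorm. -/
lemma abs_coeff_ten_bernDiff_le (p : ℕ) :
    |(((PowerSeries.coeff (p + 11) (bernDiff (-Polynomial.X))).coeff 10 : ℚ) : ℝ)| ≤
      14 * growth (p + 11) := by
  have h1 : (PowerSeries.coeff (p + 11) (bernDiff (-Polynomial.X))).coeff 10 =
      -(bern (p + 1) * ((p + 10).choose p)) := by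
    rw [show p + 11 = p + 10 + 1 by ring, coeff_succ_bernDiff, Polynomial.coeff_neg,
      Polynomial.finsetSum_coeff, Finset.sum_eq_single p]
    · rw [show p + 10 - p = 10 by omega, Polynomial.coeff_C_mul, Even.neg_pow (by decide),
        Polynomial.coeff_X_pow, if_pos rfl, mul_one]
    · intro k hk hkp
      have := Finset.mem_range.mp hk
      rw [Polynomial.coeff_C_mul, neg_pow, ← map_one Polynomial.C, ← map_neg, ← map_pow,
        Polynomial.coeff_C_mul, Polynomial.coeff_X_pow, if_neg (by omega), mul_zero, mul_zero]
    · intro h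
      exact absurd (Finset.mem_range.mpr (by omega)) h
  rw [h1, Rat.cast_neg, abs_neg, Rat.cast_mul, abs_mul, Rat.cast_natCast, Nat.abs_cast]
  have h2 : ((p + 10).choose p : ℝ) * p.factorial * (Nat.factorial 10) = (p + 10).factorial := by
    have := Nat.choose_mul_factorial_mul_factorial (Nat.le_add_right p 10)
    rw [Nat.add_sub_cancel_left] at this
    exact_mod_cast this
  have hpi : (2 * Real.pi) ^ 9 ≤ (15708 / 2500) ^ 9 := by
    have := Real.pi_pos
    gcongr
    linarith [Real.pi_lt_d4]
  calc |((bern (p + 1) : ℚ) : ℝ)| * ((p + 10).choose p : ℝ) ≤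
        bernBd (p + 1) * ((p + 10).choose p : ℝ) := by
        gcongr
        exact abs_bern_le
    _ = 33 / 10 * (2 * Real.pi) ^ 9 / (Nat.factorial 10) * growth (p + 11) := by
        rw [bernBd, growth, show p + 11 - 1 = p + 10 by omega, Nat.add_sub_cancel, ← h2]
        field_simp
        ring
    _ ≤ 14 * growth (p + 11) := by
        have := growth_pos (p + 11)
        gcongr
        rw [div_le_iff₀ (by positivity)]
        refine (mul_le_mul_of_nonneg_left hpi (by norm_num)).trans ?_
        norm_num [Nat.factorial]

/-! ### The first coefficients of the convergent part -/

lemma coeff_one_subst {A : Type*} [CommRing A] {g φ : A⟦X⟧} (hg : PowerSeries.X ∣ g) :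
    PowerSeries.coeff 1 (φ.subst g) = PowerSeries.coeff 1 φ * PowerSeries.coeff 1 g := by
  rw [coeff_subst_eq_sum' hg φ (le_refl 1)]
  simp [Finset.sum_range_succ, PowerSeries.coeff_one]

lemma coeff_two_subst {A : Type*} [CommRing A] {g φ : A⟦X⟧} (hg : PowerSeries.X ∣ g) :
    PowerSeries.coeff 2 (φ.subst g) = PowerSeries.coeff 1 φ * PowerSeries.coeff 2 g +
      PowerSeries.coeff 2 φ * PowerSeries.coeff 1 g ^ 2 := by
  have h2 : PowerSeries.coeff 2 (g ^ 2) = PowerSeries.coeff 1 g ^ 2 := by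
    obtain ⟨f, rfl⟩ := hg
    rw [mul_pow, show (2 : ℕ) = 0 + 2 by rfl, PowerSeries.coeff_X_pow_mul,
      show (1 : ℕ) = 0 + 1 by rfl, PowerSeries.coeff_succ_X_mul]
    simp
  rw [coeff_subst_eq_sum' hg φ (le_refl 2), Finset.sum_range_succ, Finset.sum_range_succ,
    Finset.sum_range_one, h2, pow_zero, PowerSeries.coeff_one, if_neg (by norm_num), pow_one]
  ring

lemma divisors_two : (2 : ℕ).divisors = {1, 2} := by decide

lemma moebius_two : ArithmeticFunction.moebius 2 = -1 :=
  ArithmeticFunction.moebius_apply_prime Nat.prime_two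

lemma den_two : den 2 = 1 - PowerSeries.X := by
  rw [den, divisors_two, Finset.sum_pair (by norm_num)]
  norm_num [moebius_two]
  ring

lemma wPoly_two : wPoly 2 = Polynomial.C (1 / 2) * (Polynomial.X - Polynomial.X ^ 2) := by
  rw [wPoly_eq le_rfl, divisors_two, Finset.sum_pair (by norm_num)]
  norm_num [moebius_two]
  ring

lemma coeff_two_invE_two : PowerSeries.coeff 2 (invE 2) = 2 := by
  rw [invE, PowerSeries.coeff_C_mul, show (2 : ℕ) = 0 + 2 by rfl, PowerSeries.coeff_X_pow_mul]
  simp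
  exact map_ofNat Polynomial.C 2

lemma coeff_one_invE_two : PowerSeries.coeff 1 (invE 2) = 0 :=
  PowerSeries.X_pow_dvd_iff.mp (X_pow_dvd_invE 2) 1 (by norm_num)

lemma coeff_one_quotWE_two : PowerSeries.coeff 1 (quotWE 2) = 0 :=
  PowerSeries.X_pow_dvd_iff.mp (X_pow_dvd_quotWE 2) 1 (by norm_num)

lemma coeff_two_quotWE_two : PowerSeries.coeff 2 (quotWE 2) = 2 * wPoly 2 := by
  rw [quotWE, PowerSeries.coeff_C_mul, coeff_two_invE_two, mul_comm]

lemma log_arg_two : ((1 - PowerSeries.X ^ 2) * den 2 - 1 : ℚ[X]⟦X⟧) =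
    PowerSeries.X * (-1 - PowerSeries.X + PowerSeries.X ^ 2) := by
  rw [den_two]
  ring

lemma coeff_one_serA_two : PowerSeries.coeff 1 (serA 2) = -wPoly 2 := by
  have hl : PowerSeries.coeff 1 (PowerSeries.X * (-1 - PowerSeries.X + PowerSeries.X ^ 2) :
      ℚ[X]⟦X⟧) = -1 := by
    rw [show (1 : ℕ) = 0 + 1 by rfl, PowerSeries.coeff_succ_X_mul]
    simp
  rw [serA, log_arg_two, map_add, map_add, PowerSeries.coeff_C_mul, PowerSeries.coeff_C_mul,
    PowerSeries.coeff_C_mul, coeff_one_subst (dvd_mul_right _ _),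
    coeff_one_subst (X_dvd_quotWE two_pos), coeff_one_subst (X_dvd_quotWE two_pos), hl,
    coeff_one_quotWE_two, PowerSeries.coeff_log]
  simp

lemma coeff_two_serA_two : PowerSeries.coeff 2 (serA 2) =
    -(Polynomial.C (1 / 2) * wPoly 2) - wPoly 2 * wPoly 2 := by
  have hl1 : PowerSeries.coeff 1 (PowerSeries.X * (-1 - PowerSeries.X + PowerSeries.X ^ 2) :
      ℚ[X]⟦X⟧) = -1 := by
    rw [show (1 : ℕ) = 0 + 1 by rfl, PowerSeries.coeff_succ_X_mul]
    simp
  have hl2 : PowerSeries.coeff 2 (PowerSeries.X * (-1 - PowerSeries.X + PowerSeries.X ^ 2) :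
      ℚ[X]⟦X⟧) = -1 := by
    rw [show (2 : ℕ) = 1 + 1 by rfl, PowerSeries.coeff_succ_X_mul]
    simp [PowerSeries.coeff_X_pow, PowerSeries.coeff_one]
  have e1 : PowerSeries.coeff 1 (PowerSeries.log ℚ[X]) = 1 := by
    rw [PowerSeries.coeff_log]
    simp
  have e2 : PowerSeries.coeff 2 (PowerSeries.log ℚ[X]) = -Polynomial.C (1 / 2) := by
    rw [PowerSeries.coeff_log, if_neg (by norm_num), ← map_neg]
    change Polynomial.C _ = _
    congr 1
    norm_num
  have e3 : PowerSeries.coeff 1 logRem = -Polynomial.C (1 / 2) := by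
    rw [logRem, PowerSeries.coeff_mk, ← map_neg]
    congr 1
    norm_num
  have e4 : PowerSeries.coeff 1 negLog = 1 := by
    rw [negLog, PowerSeries.coeff_mk]
    simp
  have htwo : (2 : ℚ[X]) = Polynomial.C 2 := (map_ofNat Polynomial.C 2).symm
  have hh : Polynomial.C (1 / 2 : ℚ) * 2 = 1 := by
    rw [htwo, ← map_mul]
    norm_num
  rw [serA, log_arg_two, map_add, map_add, PowerSeries.coeff_C_mul, PowerSeries.coeff_C_mul,
    PowerSeries.coeff_C_mul, coeff_two_subst (dvd_mul_right _ _),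
    coeff_two_subst (X_dvd_quotWE two_pos), coeff_two_subst (X_dvd_quotWE two_pos), hl1, hl2,
    coeff_one_quotWE_two, coeff_two_quotWE_two, e1, e2, e3, e4]
  linear_combination (wPoly 2 - wPoly 2 * wPoly 2) * hh

lemma coeff_two_serB_two : PowerSeries.coeff 2 (serB 2) = 0 := by
  have hx : PowerSeries.X ∣ invE 2 := X_dvd_invE two_pos
  have h1 : PowerSeries.coeff 1 (invE 2 * (1 - quotWE 2).invOfUnit 1) = 0 :=
    PowerSeries.X_pow_dvd_iff.mp (Dvd.dvd.mul_right (X_pow_dvd_invE 2) _) 1 (by norm_num)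
  have h2 : PowerSeries.coeff 2 (invE 2 * (1 - quotWE 2).invOfUnit 1) = 2 := by
    obtain ⟨f, hf⟩ := X_pow_dvd_invE 2
    have hc := coeff_two_invE_two
    rw [hf, show (2 : ℕ) = 0 + 2 by rfl, PowerSeries.coeff_X_pow_mul] at hc
    rw [hf, mul_assoc, show (2 : ℕ) = 0 + 2 by rfl, PowerSeries.coeff_X_pow_mul,
      PowerSeries.coeff_zero_eq_constantCoeff_apply, map_mul,
      ← PowerSeries.coeff_zero_eq_constantCoeff_apply, hc]
    simp
  rw [serB, map_sub, coeff_two_subst ((dvd_neg).mpr (Dvd.dvd.mul_right hx _)),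
    coeff_two_subst ((dvd_neg).mpr hx), map_neg, map_neg, map_neg, map_neg, h1, h2,
    coeff_one_invE_two, coeff_two_invE_two, sub_self]

/-- The quadratic part in `w` coming from `ℓ = 1` cancels against `-W_2`. The result is a multiple
of `w - 1`, on which the truncation telescopes. -/
lemma coeff_one_expConv : PowerSeries.coeff 1 expConv = Polynomial.X - 1 := by
  have h := succ_mul_coeff_expS (dvd_add X_dvd_serOne X_dvd_serHigher) 0
  have h0 : PowerSeries.coeff 0 (expS (serOne + serHigher)) = 1 := by
    rw [PowerSeries.coeff_zero_eq_constantCoeff_apply,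
      constantCoeff_expS (dvd_add X_dvd_serOne X_dvd_serHigher)]
  have h1 : PowerSeries.coeff 1 serHigher = -wPoly 2 := by
    rw [serHigher, PowerSeries.coeff_mk]
    simp [coeff_one_serA_two, coeff_serB_eq_zero]
  have htwo : (2 : ℚ[X]) = Polynomial.C 2 := (map_ofNat Polynomial.C 2).symm
  have hh : Polynomial.C (1 / 2 : ℚ) * 2 = 1 := by
    rw [htwo, ← map_mul]
    norm_num
  have h2 : PowerSeries.coeff 1 serOne = -(1 - Polynomial.X) +
      Polynomial.X * Polynomial.C (1 / 2) - Polynomial.X ^ 2 * Polynomial.C (1 / 2) := by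
    rw [serOne, PowerSeries.coeff_mk]
    norm_num
  simp only [zero_add, Finset.range_one, Finset.sum_singleton, Nat.cast_one, one_mul, Nat.sub_zero,
    h0, mul_one] at h
  rw [expConv, h, map_add, h1, h2, wPoly_two]
  ring

/-- The weighted bound `5 · 5²` for the second coefficient of `expConv` would be too large, so it is
estimated by hand. Only `ℓ = 2, 3, 4` matter, giving `3/2 + 27/10 + 27/10`. -/
lemma nrm_coeff_two_serHigher_le : nrm (PowerSeries.coeff 2 serHigher) ≤ 69 / 10 := by
  have hA : ∀ l, 2 ≤ l → (l + 1) / 2 = 2 → nrm (PowerSeries.coeff 2 (serA l)) ≤ 27 / 10 := by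
    intro l hl h2
    have h1 := wt_serA_le (n := 2) (r := 1 / 5) (by norm_num) le_rfl hl
    have h3 := (nrm_coeff_mul_pow_le (n := 2) (r := 1 / 5) (by norm_num) (serA l) le_rfl).trans h1
    rw [h2] at h3
    linarith
  have h3 := hA 3 (by norm_num) (by norm_num)
  have h4 := hA 4 (by norm_num) (by norm_num)
  have h2 : nrm (PowerSeries.coeff 2 (serA 2)) ≤ 3 / 2 := by
    have hw := nrm_wPoly_le (le_refl 2)
    have hw0 := nrm_nonneg (wPoly 2)
    rw [coeff_two_serA_two]
    refine (nrm_sub_le _ _).trans ?_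
    rw [nrm_neg, nrm_C_mul]
    have := (nrm_mul_le (wPoly 2) (wPoly 2)).trans (mul_le_mul hw hw hw0 (by norm_num))
    norm_num
    linarith
  have e : PowerSeries.coeff 2 serHigher = PowerSeries.coeff 2 (serA 2) +
      PowerSeries.coeff 2 (serA 3) + PowerSeries.coeff 2 (serA 4) := by
    rw [serHigher, PowerSeries.coeff_mk, show Finset.Icc 2 (2 * 2) = {2, 3, 4} by decide,
      Finset.sum_insert (by decide), Finset.sum_insert (by decide), Finset.sum_singleton,
      map_add, map_add, map_add, coeff_two_serB_two, coeff_serB_eq_zero (by norm_num),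
      coeff_serB_eq_zero (by norm_num)]
    ring
  rw [e]
  have h5 := nrm_add_le (PowerSeries.coeff 2 (serA 2) + PowerSeries.coeff 2 (serA 3))
    (PowerSeries.coeff 2 (serA 4))
  have h6 := nrm_add_le (PowerSeries.coeff 2 (serA 2)) (PowerSeries.coeff 2 (serA 3))
  linarith

lemma nrm_coeff_two_expConv_le : nrm (PowerSeries.coeff 2 expConv) ≤ 21 / 2 := by
  have hX := dvd_add X_dvd_serOne X_dvd_serHigher
  have h := congrArg nrm (succ_mul_coeff_expS hX 1)
  have h0 : PowerSeries.coeff 0 expConv = 1 := by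
    rw [expConv, PowerSeries.coeff_zero_eq_constantCoeff_apply, constantCoeff_expS hX]
  have hc : PowerSeries.coeff 1 (serOne + serHigher) = Polynomial.X - 1 := by
    have h1 := succ_mul_coeff_expS hX 0
    rw [← expConv, Finset.sum_range_one, Nat.sub_zero, h0, zero_add, coeff_one_expConv] at h1
    simpa using h1.symm
  rw [nrm_natCast_mul, ← expConv, Finset.sum_range_succ, Finset.sum_range_one, Nat.sub_self,
    Nat.sub_zero, h0, zero_add, hc, coeff_one_expConv, Nat.cast_one, one_mul, mul_one] at h
  have h1 : nrm (Polynomial.X - 1) ≤ 2 := by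
    rw [← neg_sub, nrm_neg]
    exact nrm_one_sub_X_le
  have h2 := (nrm_mul_le (Polynomial.X - 1) (Polynomial.X - 1)).trans
    (mul_le_mul h1 h1 (nrm_nonneg _) (by norm_num))
  have h3 := nrm_coeff_serOne_le 2
  have h4 := nrm_add_le (PowerSeries.coeff 2 serOne) (PowerSeries.coeff 2 serHigher)
  have h5 := nrm_coeff_two_serHigher_le
  have h6 := nrm_add_le ((Polynomial.X - 1) * (Polynomial.X - 1))
    (((1 + 1 : ℕ) : ℚ[X]) * PowerSeries.coeff (1 + 1) (serOne + serHigher))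
  rw [nrm_natCast_mul, map_add] at h6
  norm_num at h h3 h6
  linarith

/-! ### Comparison of the growth of consecutive coefficients -/

/-- Passing from `n - k` to `n` multiplies the factorial by `n-1, …, n-k`, all at least `n - K`. -/
lemma growth_sub_mul_le {n k K : ℕ} (hk : k ≤ K) (hK : K < n) :
    growth (n - k) * ((n : ℝ) - K) ^ k ≤ (2 * Real.pi) ^ k * growth n := by
  induction k with
  | zero => simp
  | succ k ih =>
    have h := ih (by omega)
    obtain ⟨j, hj⟩ := Nat.exists_eq_add_of_le' (show k + 2 ≤ n by omega)
    have hg := succ_mul_growth j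
    have hK' : (0 : ℝ) < (n : ℝ) - K := by
      have : (K : ℝ) < n := by exact_mod_cast hK
      linarith
    have hjK : (n : ℝ) - K ≤ j + 1 := by
      have : (n : ℝ) ≤ j + 1 + K := by exact_mod_cast (by omega : n ≤ j + 1 + K)
      linarith
    rw [show n - (k + 1) = j + 1 by omega]
    rw [show n - k = j + 2 by omega] at h
    have hp := growth_pos (j + 1)
    calc growth (j + 1) * ((n : ℝ) - K) ^ (k + 1)
        = ((n : ℝ) - K) * growth (j + 1) * ((n : ℝ) - K) ^ k := by ring
      _ ≤ (j + 1) * growth (j + 1) * ((n : ℝ) - K) ^ k := by gcongr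
      _ = 2 * Real.pi * (growth (j + 2) * ((n : ℝ) - K) ^ k) := by rw [hg]; ring
      _ ≤ 2 * Real.pi * ((2 * Real.pi) ^ k * growth n) := by gcongr
      _ = _ := by ring

lemma sub_one_mul_growth {n : ℕ} (hn : 2 ≤ n) :
    ((n : ℝ) - 1) * growth (n - 1) = 2 * Real.pi * growth n := by
  obtain ⟨m, rfl⟩ := Nat.exists_eq_add_of_le' hn
  have h := succ_mul_growth m
  rw [show m + 2 - 1 = m + 1 by omega, ← h]
  push_cast
  ring

lemma sub_one_mul_growth_sub_le {n k K : ℕ} (hk0 : 1 ≤ k) (hk : k ≤ K) (hK : K < n) :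
    ((n : ℝ) - 1) * growth (n - k) ≤
      2 * Real.pi * (2 * Real.pi / ((n : ℝ) - K)) ^ (k - 1) * growth n := by
  obtain ⟨j, rfl⟩ := Nat.exists_eq_add_of_le' hk0
  have h := growth_sub_mul_le (n := n - 1) (k := j) (K := K - 1) (by omega) (by omega)
  have hK' : (0 : ℝ) < (n : ℝ) - K := by
    have : (K : ℝ) < n := by exact_mod_cast hK
    linarith
  have hn1 : (1 : ℝ) ≤ n := by exact_mod_cast (by omega : 1 ≤ n)
  have e : ((n - 1 : ℕ) : ℝ) - ((K - 1 : ℕ) : ℝ) = n - K := by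
    rw [Nat.cast_sub (by omega), Nat.cast_sub (by omega)]
    ring
  rw [e, show n - 1 - j = n - (j + 1) by omega] at h
  have h1 := sub_one_mul_growth (n := n) (by omega)
  rw [Nat.add_sub_cancel, div_pow, mul_div_assoc', div_mul_eq_mul_div, le_div_iff₀ (by positivity)]
  calc ((n : ℝ) - 1) * growth (n - (j + 1)) * ((n : ℝ) - K) ^ j =
        ((n : ℝ) - 1) * (growth (n - (j + 1)) * ((n : ℝ) - K) ^ j) := by ring
    _ ≤ ((n : ℝ) - 1) * ((2 * Real.pi) ^ j * growth (n - 1)) :=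
        mul_le_mul_of_nonneg_left h (by linarith)
    _ = _ := by linear_combination (2 * Real.pi) ^ j * h1

/-- A lower bound for falling factorials. -/
lemma factorial_sub_mul_pow_le {n k : ℕ} (hk : k ≤ n) :
    ((n - k).factorial : ℝ) * (n : ℝ) ^ k ≤ Real.exp 1 ^ k * n.factorial := by
  induction k generalizing n with
  | zero => simp
  | succ j ih =>
    obtain ⟨m, rfl⟩ := Nat.exists_eq_add_of_le' (show 1 ≤ n by omega)
    have h := ih (n := m) (by omega)
    -- Because `j ≤ m`, one has `(1 + 1/m)^j ≤ e^{j/m} ≤ e`.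
    have he : ((m : ℝ) + 1) ^ j ≤ Real.exp 1 * (m : ℝ) ^ j := by
      rcases Nat.eq_zero_or_pos m with rfl | hm
      · rw [show j = 0 by omega]
        simp
      · have hm' : (0 : ℝ) < m := by exact_mod_cast hm
        have h1 : ((1 : ℝ) / m + 1) ^ j ≤ Real.exp 1 := by
          calc ((1 : ℝ) / m + 1) ^ j ≤ Real.exp (1 / m) ^ j := by
                gcongr
                exact Real.add_one_le_exp _
            _ = Real.exp (j * (1 / m)) := (Real.exp_nat_mul _ _).symm
            _ ≤ _ := by
                refine Real.exp_le_exp.mpr ?_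
                rw [mul_one_div, div_le_one hm']
                exact_mod_cast (by omega : j ≤ m)
        calc ((m : ℝ) + 1) ^ j = ((1 : ℝ) / m + 1) ^ j * (m : ℝ) ^ j := by
              rw [← mul_pow]
              congr 1
              field_simp
              ring
          _ ≤ _ := by gcongr
    rw [Nat.add_sub_add_right, Nat.factorial_succ]
    push_cast
    calc ((m - j).factorial : ℝ) * ((m : ℝ) + 1) ^ (j + 1) =
          ((m - j).factorial : ℝ) * (m + 1) * ((m : ℝ) + 1) ^ j := by ring
      _ ≤ ((m - j).factorial : ℝ) * (m + 1) * (Real.exp 1 * (m : ℝ) ^ j) := by gcongr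
      _ = Real.exp 1 * (m + 1) * (((m - j).factorial : ℝ) * (m : ℝ) ^ j) := by ring
      _ ≤ Real.exp 1 * (m + 1) * (Real.exp 1 ^ j * m.factorial) := by gcongr
      _ = _ := by ring

lemma two_pi_mul_exp_one_sq_le : (2 * Real.pi * Real.exp 1) ^ 2 ≤ 292 := by
  have h1 : 2 * Real.pi * Real.exp 1 ≤ 2 * 3.1416 * 2.7182818286 := by
    have := Real.pi_pos
    have := Real.exp_pos 1
    gcongr
    · exact Real.pi_lt_d4.le
    · exact Real.exp_one_lt_d9.le
  calc _ ≤ (2 * 3.1416 * 2.7182818286 : ℝ) ^ 2 := by gcongr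
    _ ≤ _ := by norm_num

/-- With the weight `r = 1/√n`, each index costs `√n` and gains `2πe/n`, hence a factor `θ =
2πe/√n`, with `θ² ≤ 292/599 < 0.49`. Four of these factors absorb the prefactor: `θ^4 n² ≤ 292² =
85264`. -/
lemma sub_one_mul_sqrt_pow_le {n k : ℕ} (hn : 599 ≤ n) (hk4 : 4 ≤ k) (hk : k ≤ n) :
    ((n : ℝ) - 1) * (√n ^ k * ((n - k).factorial / (2 * Real.pi) ^ (n - k))) ≤
      85264 * (7 / 10) ^ (k - 4) * growth n := by
  have hn' : (599 : ℝ) ≤ n := by exact_mod_cast hn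
  have hn0 : (0 : ℝ) < n := by linarith
  have hs : 0 < √(n : ℝ) := Real.sqrt_pos.mpr hn0
  have hss : √(n : ℝ) ^ 2 = n := Real.sq_sqrt hn0.le
  have hg := growth_pos n
  set θ := 2 * Real.pi * Real.exp 1 / √n with hθ
  have hθ0 : 0 < θ := by positivity
  have hθ2 : θ ^ 2 * n = (2 * Real.pi * Real.exp 1) ^ 2 := by
    rw [hθ, div_pow, hss]
    field_simp
  have hθ7 : θ ≤ 7 / 10 := by
    refine le_of_pow_le_pow_left₀ two_ne_zero (by norm_num) ?_
    refine le_of_mul_le_mul_right ?_ hn0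
    rw [hθ2]
    refine two_pi_mul_exp_one_sq_le.trans ?_
    linarith
  have hθ4 : θ ^ 4 * (n : ℝ) ^ 2 ≤ 85264 := by
    calc θ ^ 4 * (n : ℝ) ^ 2 = (θ ^ 2 * n) ^ 2 := by ring
      _ ≤ 292 ^ 2 := by
        rw [hθ2]
        gcongr
        exact two_pi_mul_exp_one_sq_le
      _ = _ := by norm_num
  have hfac : (n.factorial : ℝ) = n * (n - 1).factorial := by
    exact_mod_cast (Nat.mul_factorial_pred (by omega : n ≠ 0)).symm
  have hmain : √n ^ k * ((n - k).factorial / (2 * Real.pi) ^ (n - k)) ≤ n * θ ^ k * growth n := by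
    have h := factorial_sub_mul_pow_le hk
    rw [hfac] at h
    have hpow : (2 * Real.pi) ^ n = (2 * Real.pi) ^ (n - k) * (2 * Real.pi) ^ k := by
      rw [← pow_add]
      congr 1
      omega
    have hnk : (n : ℝ) ^ k = √n ^ k * √n ^ k := by
      rw [← mul_pow, ← sq, hss]
    rw [hnk] at h
    rw [hθ, growth, hpow, div_pow, mul_pow _ (Real.exp 1), mul_div_assoc',
      div_le_iff₀ (by positivity)]
    calc √n ^ k * ((n - k).factorial : ℝ) =
          ((n - k).factorial : ℝ) * (√n ^ k * √n ^ k) / √n ^ k := by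
          field_simp
      _ ≤ Real.exp 1 ^ k * (n * (n - 1).factorial) / √n ^ k := by gcongr
      _ = _ := by
          field_simp
  calc _ ≤ (n : ℝ) * (n * θ ^ k * growth n) := by
        gcongr
        linarith
    _ = θ ^ 4 * (n : ℝ) ^ 2 * θ ^ (k - 4) * growth n := by
        conv_lhs => rw [← Nat.sub_add_cancel hk4, pow_add]
        ring
    _ ≤ _ := by gcongr

lemma sum_Ico_geometric_le {x : ℝ} (h0 : 0 ≤ x) (h1 : x < 1) (a b : ℕ) :
    ∑ k ∈ Finset.Ico a b, x ^ (k - a) ≤ 1 / (1 - x) := by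
  rw [Finset.sum_Ico_eq_sum_range]
  simp only [Nat.add_sub_cancel_left]
  refine ((summable_geometric_of_lt_one h0 h1).sum_le_tsum _ fun _ _ => by positivity).trans ?_
  rw [tsum_geometric_of_lt_one h0 h1, one_div]

/-! ### The terms of the product -/

section terms

variable {n k : ℕ}

/-- The product of the seminorms of the factors contributing to the coefficient of `u^n`. -/
def prodTerm (n k : ℕ) : ℝ :=
  nrm (PowerSeries.coeff k expConv) * nrm (PowerSeries.coeff (n - k) expDiv)

/-- The coefficient of index `k ≤ K` only sees the seminorm cut at `K`, so the condition on the
weight is `K r² ≤ 1` rather than `n r² ≤ 1`. Here `1955 = 5 · 391`. -/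
lemma prodTerm_le {r : ℝ} {K : ℕ} (hr0 : 0 < r) (hr : r ≤ 1 / 5) (hkK : k ≤ K)
    (hK : K * r ^ 2 ≤ 1) (hk0 : 1 ≤ k) (hKn : K < n) :
    ((n : ℝ) - 1) * prodTerm n k ≤
      1955 * (2 * Real.pi / r) * (2 * Real.pi / r / ((n : ℝ) - K)) ^ (k - 1) * growth n := by
  have h1 := nrm_coeff_expConv_le hr0 hr hK hkK
  have h2 := nrm_coeff_expDiv_le (show 0 < n - k by omega)
  have h3 := sub_one_mul_growth_sub_le hk0 hkK hKn
  have hn1 : (1 : ℝ) ≤ n := by exact_mod_cast (by omega : 1 ≤ n)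
  have hg := growth_pos n
  obtain ⟨j, rfl⟩ := Nat.exists_eq_add_of_le' hk0
  rw [Nat.add_sub_cancel] at h3 ⊢
  calc ((n : ℝ) - 1) * prodTerm n (j + 1) ≤
        ((n : ℝ) - 1) * (5 * (1 / r) ^ (j + 1) * (391 * growth (n - (j + 1)))) := by
        refine mul_le_mul_of_nonneg_left ?_ (by linarith)
        exact mul_le_mul h1 h2 (nrm_nonneg _) (by positivity)
    _ = 1955 * (1 / r) ^ (j + 1) * (((n : ℝ) - 1) * growth (n - (j + 1))) := by ring
    _ ≤ 1955 * (1 / r) ^ (j + 1) *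
        (2 * Real.pi * (2 * Real.pi / ((n : ℝ) - K)) ^ j * growth n) := by gcongr
    _ = _ := by
        rw [show 2 * Real.pi / r / ((n : ℝ) - K) = 1 / r * (2 * Real.pi / ((n : ℝ) - K)) by
          field_simp, mul_pow]
        ring

lemma prodTerm_le_near (hn : 599 ≤ n) (hk3 : 3 ≤ k) (hk : k ≤ 25) :
    ((n : ℝ) - 1) * prodTerm n k ≤ 186 * (11 / 200) ^ (k - 3) * growth n := by
  have hn' : (599 : ℝ) ≤ n := by exact_mod_cast hn
  -- The largest admissible weight `1/5` is allowed exactly up to `K = 25`. The ratio is about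
  -- `31.416/574 < 11/200`.
  have h := prodTerm_le (n := n) (r := 1 / 5) (by norm_num) le_rfl hk (by norm_num) (by omega)
    (by omega)
  have hpi := Real.pi_lt_d4
  have hpi0 := Real.pi_pos
  have h1 : 2 * Real.pi / (1 / 5) ≤ 31416 / 1000 := by linarith
  have h2 : 2 * Real.pi / (1 / 5) / ((n : ℝ) - (25 : ℕ)) ≤ 11 / 200 := by
    push_cast
    rw [div_le_iff₀ (by linarith)]
    linarith
  have h3 : 0 ≤ 2 * Real.pi / (1 / 5) / ((n : ℝ) - (25 : ℕ)) := by
    push_cast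
    exact div_nonneg (by positivity) (by linarith)
  have hg := growth_pos n
  refine h.trans ?_
  obtain ⟨j, rfl⟩ := Nat.exists_eq_add_of_le' hk3
  calc _ ≤ 1955 * (31416 / 1000) * (11 / 200) ^ (j + 3 - 1) * growth n := by gcongr
    _ = (1955 * (31416 / 1000) * (11 / 200) ^ 2) * (11 / 200) ^ j * growth n := by
        rw [show j + 3 - 1 = j + 2 by omega]
        ring
    _ ≤ _ := by
        rw [Nat.add_sub_cancel]
        gcongr
        norm_num

lemma prodTerm_le_middle (hn : 599 ≤ n) (hk3 : 26 ≤ k) (hk : k ≤ 60) :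
    ((n : ℝ) - 1) * prodTerm n k ≤ 1 / 10 * (1 / 10) ^ (k - 26) * growth n := by
  have hn' : (599 : ℝ) ≤ n := by exact_mod_cast hn
  -- The smaller weight `1/8` reaches up to `K = 60`, since `60/64 ≤ 1`; the ratio is below `51/539
  -- < 1/10`.
  have h := prodTerm_le (n := n) (r := 1 / 8) (by norm_num) (by norm_num) hk (by norm_num)
    (by omega) (by omega)
  have hpi := Real.pi_lt_d4
  have hpi0 := Real.pi_pos
  have h1 : 2 * Real.pi / (1 / 8) ≤ 51 := by linarith
  have h2 : 2 * Real.pi / (1 / 8) / ((n : ℝ) - (60 : ℕ)) ≤ 1 / 10 := by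
    push_cast
    rw [div_le_iff₀ (by linarith)]
    linarith
  have h3 : 0 ≤ 2 * Real.pi / (1 / 8) / ((n : ℝ) - (60 : ℕ)) := by
    push_cast
    exact div_nonneg (by positivity) (by linarith)
  have hg := growth_pos n
  refine h.trans ?_
  obtain ⟨j, rfl⟩ := Nat.exists_eq_add_of_le' hk3
  calc _ ≤ 1955 * 51 * (1 / 10) ^ (j + 26 - 1) * growth n := by gcongr
    _ = (1955 * 51 * (1 / 10) ^ 25) * (1 / 10) ^ j * growth n := by
        rw [show j + 26 - 1 = j + 25 by omega]
        ring
    _ ≤ _ := by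
        rw [Nat.add_sub_cancel]
        gcongr
        norm_num

lemma nrm_coeff_expDiv_le_factorial (j : ℕ) :
    nrm (PowerSeries.coeff j expDiv) ≤ 391 * (j.factorial / (2 * Real.pi) ^ j) := by
  rcases Nat.eq_zero_or_pos j with rfl | hj
  · rw [coeff_zero_expDiv, nrm_one]
    norm_num
  · refine (nrm_coeff_expDiv_le hj).trans ?_
    rw [growth]
    gcongr
    omega

lemma prodTerm_le_far (hn : 599 ≤ n) (hk61 : 61 ≤ k) (hk : k ≤ n) :
    ((n : ℝ) - 1) * prodTerm n k ≤ 3 / 10 * (7 / 10) ^ (k - 61) * growth n := by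
  have hn' : (599 : ℝ) ≤ n := by exact_mod_cast hn
  have hn0 : (0 : ℝ) < n := by linarith
  have hs : 0 < √(n : ℝ) := Real.sqrt_pos.mpr hn0
  have hs5 : 1 / √(n : ℝ) ≤ 1 / 5 := by
    refine one_div_le_one_div_of_le (by norm_num) ?_
    exact Real.le_sqrt_of_sq_le (by linarith)
  -- For the remaining `k` the weight `1/√n` is admissible throughout. The start at `k = 61` leaves
  -- the small factor `(7/10)^57`.
  have h1 := nrm_coeff_expConv_le (k := k) (n := n) (r := 1 / √n) (by positivity) hs5
    (by rw [div_pow, Real.sq_sqrt hn0.le]; field_simp; exact le_rfl) hk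
  rw [one_div_one_div] at h1
  have h2 := nrm_coeff_expDiv_le_factorial (n - k)
  have h3 := sub_one_mul_sqrt_pow_le hn (by omega) hk
  have hg := growth_pos n
  obtain ⟨j, rfl⟩ := Nat.exists_eq_add_of_le' hk61
  calc ((n : ℝ) - 1) * prodTerm n (j + 61) ≤ ((n : ℝ) - 1) * (5 * √n ^ (j + 61) *
        (391 * ((n - (j + 61)).factorial / (2 * Real.pi) ^ (n - (j + 61))))) := by
        refine mul_le_mul_of_nonneg_left ?_ (by linarith)
        exact mul_le_mul h1 h2 (nrm_nonneg _) (by positivity)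
    _ = 1955 * (((n : ℝ) - 1) * (√n ^ (j + 61) *
        ((n - (j + 61)).factorial / (2 * Real.pi) ^ (n - (j + 61))))) := by ring
    _ ≤ 1955 * (85264 * (7 / 10) ^ (j + 61 - 4) * growth n) := by gcongr
    _ = 1955 * 85264 * (7 / 10) ^ 57 * (7 / 10) ^ j * growth n := by
        rw [show j + 61 - 4 = j + 57 by omega]
        ring
    _ ≤ _ := by
        rw [Nat.add_sub_cancel]
        gcongr
        norm_num

/-- Exponential growth against a factorial: as `2 ≤ √n`, the previous estimate applies with `k = n`.
-/
lemma nrm_elem_le_growth (hn : 599 ≤ n) : ((n : ℝ) - 1) * nrm (elem n) ≤ growth n := by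
  have hn' : (599 : ℝ) ≤ n := by exact_mod_cast hn
  have h1 := nrm_elem_le (show 3 ≤ n by omega)
  have h3 := sub_one_mul_sqrt_pow_le hn (by omega) le_rfl
  have hg := growth_pos n
  have h2 : (2 : ℝ) ≤ √n := Real.le_sqrt_of_sq_le (by linarith)
  rw [Nat.sub_self, Nat.factorial_zero, pow_zero, Nat.cast_one, div_one, mul_one] at h3
  have h4 : (7 / 10 : ℝ) ^ (n - 4) ≤ (7 / 10) ^ 40 :=
    pow_le_pow_of_le_one (by norm_num) (by norm_num) (by omega)
  calc ((n : ℝ) - 1) * nrm (elem n) ≤ ((n : ℝ) - 1) * √n ^ n := by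
        refine mul_le_mul_of_nonneg_left (h1.trans ?_) (by linarith)
        gcongr
    _ ≤ 85264 * (7 / 10) ^ (n - 4) * growth n := h3
    _ ≤ 85264 * (7 / 10) ^ 40 * growth n := by gcongr
    _ ≤ 1 * growth n := by
        gcongr
        norm_num
    _ = _ := one_mul _

lemma sum_prodTerm_le (hn : 599 ≤ n) :
    ((n : ℝ) - 1) * ∑ k ∈ Finset.Ico 3 (n + 1), prodTerm n k ≤ 199 * growth n := by
  have hg := growth_pos n
  rw [← Finset.sum_Ico_consecutive _ (show 3 ≤ 26 by norm_num) (by omega),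
    ← Finset.sum_Ico_consecutive _ (show 26 ≤ 61 by norm_num) (by omega), mul_add, mul_add]
  have h1 := Finset.sum_le_sum fun k (hk : k ∈ Finset.Ico 3 26) =>
    prodTerm_le_near hn (Finset.mem_Ico.mp hk).1 (Nat.lt_succ_iff.mp (Finset.mem_Ico.mp hk).2)
  have h2 := Finset.sum_le_sum fun k (hk : k ∈ Finset.Ico 26 61) =>
    prodTerm_le_middle hn (Finset.mem_Ico.mp hk).1 (Nat.lt_succ_iff.mp (Finset.mem_Ico.mp hk).2)
  have h3 := Finset.sum_le_sum fun k (hk : k ∈ Finset.Ico 61 (n + 1)) =>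
    prodTerm_le_far hn (Finset.mem_Ico.mp hk).1 (Nat.lt_succ_iff.mp (Finset.mem_Ico.mp hk).2)
  rw [← Finset.sum_mul, ← Finset.mul_sum, ← Finset.mul_sum] at h1 h2 h3
  have g1 := sum_Ico_geometric_le (x := 11 / 200) (by norm_num) (by norm_num) 3 26
  have g2 := sum_Ico_geometric_le (x := 1 / 10) (by norm_num) (by norm_num) 26 61
  have g3 := sum_Ico_geometric_le (x := 7 / 10) (by norm_num) (by norm_num) 61 (n + 1)
  have k1 := mul_le_mul_of_nonneg_right g1 hg.le
  have k2 := mul_le_mul_of_nonneg_right g2 hg.le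
  have k3 := mul_le_mul_of_nonneg_right g3 hg.le
  norm_num at k1 k2 k3
  linarith

lemma sub_one_mul_prodTerm_two_le (hn : 599 ≤ n) :
    ((n : ℝ) - 1) * prodTerm n 2 ≤ 273 * growth n := by
  have hn' : (599 : ℝ) ≤ n := by exact_mod_cast hn
  have hg := growth_pos n
  have h1 := nrm_coeff_two_expConv_le
  have h2 := nrm_coeff_expDiv_le (show 0 < n - 2 by omega)
  have h3 := sub_one_mul_growth_sub_le (n := n) (k := 2) (K := 2) (by omega) le_rfl (by omega)
  have h4 := two_pi_sq_le
  -- Two lost factors of the factorial against one factor `n - 1` leave `(2π)²/(n-2) ≤ (79/2)/597`.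
  have h5 : 2 * Real.pi * (2 * Real.pi / ((n : ℝ) - (2 : ℕ))) ^ (2 - 1) ≤ 79 / 2 / 597 := by
    have : (2 : ℕ) - 1 = 1 := rfl
    rw [this, pow_one, mul_div_assoc', ← sq]
    have : (597 : ℝ) ≤ (n : ℝ) - (2 : ℕ) := by
      push_cast
      linarith
    gcongr
  calc ((n : ℝ) - 1) * prodTerm n 2 ≤ ((n : ℝ) - 1) * (21 / 2 * (391 * growth (n - 2))) := by
        refine mul_le_mul_of_nonneg_left ?_ (by linarith)
        exact mul_le_mul h1 h2 (nrm_nonneg _) (by norm_num)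
    _ = 21 / 2 * 391 * (((n : ℝ) - 1) * growth (n - 2)) := by ring
    _ ≤ 21 / 2 * 391 * (79 / 2 / 597 * growth n) := by
        refine mul_le_mul_of_nonneg_left (h3.trans ?_) (by norm_num)
        gcongr
    _ ≤ _ := by linarith

lemma abs_coeff_le_nrm {p : ℚ[X]} {i : ℕ} (hi : i < 11) : |((p.coeff i : ℚ) : ℝ)| ≤ nrm p :=
  Finset.single_le_sum (f := fun i => |((p.coeff i : ℚ) : ℝ)|) (fun _ _ => abs_nonneg _)
    (Finset.mem_range.mpr hi)

/-- The contribution of the linear coefficient `w - 1` of the convergent part. -/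
lemma abs_truncPoly_linear_le (hn : 599 ≤ n) : ((n : ℝ) - 1) *
    |((truncPoly 10 ((Polynomial.X - 1) * PowerSeries.coeff (n - 1) expDiv) : ℚ) : ℝ)| ≤
      89 * growth n := by
  have hn' : (599 : ℝ) ≤ n := by exact_mod_cast hn
  have hg := growth_pos n
  have hg1 := growth_pos (n - 1)
  have h1 := sub_one_mul_growth (n := n) (by omega)
  obtain ⟨p, hp⟩ := Nat.exists_eq_add_of_le' (show 12 ≤ n by omega)
  have h2 := abs_coeff_ten_bernDiff_le p
  -- Applied at `n - 2`, this requires `n - 2 ≥ 597` and thus fixes the threshold `n ≥ 599`.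
  have h3 := nrm_coeff_expDiv_sub_le (n := n - 2) (by omega)
  rw [show p + 11 = n - 1 by omega] at h2
  rw [show n - 2 + 1 = n - 1 by omega] at h3
  have hcast : (597 : ℝ) ≤ ((n - 2 : ℕ) : ℝ) := by exact_mod_cast (by omega : 597 ≤ n - 2)
  have h4 : nrm (PowerSeries.coeff (n - 1) expDiv -
      PowerSeries.coeff (n - 1) (bernDiff (-Polynomial.X))) ≤ 6 / 597 * growth (n - 1) := by
    have := mul_le_mul_of_nonneg_right hcast (nrm_nonneg (PowerSeries.coeff (n - 1) expDiv -
      PowerSeries.coeff (n - 1) (bernDiff (-Polynomial.X))))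
    linarith
  have h5 : |(((PowerSeries.coeff (n - 1) expDiv).coeff 10 : ℚ) : ℝ)| ≤
      (14 + 6 / 597) * growth (n - 1) := by
    have e : (PowerSeries.coeff (n - 1) expDiv).coeff 10 =
        (PowerSeries.coeff (n - 1) (bernDiff (-Polynomial.X))).coeff 10 +
        (PowerSeries.coeff (n - 1) expDiv -
          PowerSeries.coeff (n - 1) (bernDiff (-Polynomial.X))).coeff 10 := by
      rw [Polynomial.coeff_sub]
      ring
    rw [e, Rat.cast_add]
    refine (abs_add_le _ _).trans ?_
    have := (abs_coeff_le_nrm (p := PowerSeries.coeff (n - 1) expDiv -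
      PowerSeries.coeff (n - 1) (bernDiff (-Polynomial.X))) (i := 10) (by norm_num)).trans h4
    linarith
  -- Telescoping leaves the coefficient of `w^10` alone, so `14` takes the place of the general
  -- constant `391` for `expDiv`.
  rw [truncPoly_X_sub_one_mul, Rat.cast_neg, abs_neg]
  calc _ ≤ ((n : ℝ) - 1) * ((14 + 6 / 597) * growth (n - 1)) :=
        mul_le_mul_of_nonneg_left h5 (by linarith)
    _ = (14 + 6 / 597) * (2 * Real.pi) * growth n := by linear_combination (14 + 6 / 597) * h1
    _ ≤ 89 * growth n := by
        gcongr
        linarith [Real.pi_lt_d4]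

end terms

/-! ### Assembly of the error estimate -/

/-- The remainder is smaller than the growth of the leading term by a factor of order `n`. -/
lemma abs_Rcoeff_le {n : ℕ} (hn : 599 ≤ n) :
    ((n : ℝ) - 1) * |(Rcoeff (n + 1) : ℝ)| ≤ 600 * growth n := by
  have hn' : (599 : ℝ) ≤ n := by exact_mod_cast hn
  have hg := growth_pos n
  obtain ⟨m, hm⟩ := Nat.exists_eq_add_of_le' (show 2 ≤ n by omega)
  have hR := Rcoeff_succ_succ (m + 1)
  rw [show m + 1 + 2 = n + 1 by omega, show m + 1 + 1 = n by omega] at hR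
  have hX := dvd_add X_dvd_serOne X_dvd_serHigher
  have h0 : PowerSeries.coeff 0 expConv = 1 := by
    rw [expConv, PowerSeries.coeff_zero_eq_constantCoeff_apply, constantCoeff_expS hX]
  have hexp : expS (serA 1 + serB 1 + serHigher) = expConv * expDiv := by
    rw [serA_one_add_serB_one, expConv, expDiv, ← expS_add hX (X_dvd_bernDiff _)]
    congr 1
    ring
  -- The convolution is split at `k = 0, 1, 2`. Subtracting `𝐁_1 = D + elem` turns the term `k = 0`
  -- into `exp D - D`, minus `elem`.
  have hcoeff : PowerSeries.coeff n (expS (serA 1 + serB 1 + serHigher) - serB 1) =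
      (PowerSeries.coeff n expDiv - PowerSeries.coeff n (bernDiff (-Polynomial.X))) +
      (Polynomial.X - 1) * PowerSeries.coeff (n - 1) expDiv +
      (PowerSeries.coeff 2 expConv * PowerSeries.coeff (n - 2) expDiv +
      ∑ k ∈ Finset.Ico 3 (n + 1), PowerSeries.coeff k expConv *
        PowerSeries.coeff (n - k) expDiv) - elem n := by
    rw [map_sub, hexp, coeff_serB_one, PowerSeries.coeff_mul,
      Finset.Nat.sum_antidiagonal_eq_sum_range_succ_mk, Finset.range_eq_Ico,
      Finset.sum_eq_sum_Ico_succ_bot (by omega), Finset.sum_eq_sum_Ico_succ_bot (by omega),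
      Finset.sum_eq_sum_Ico_succ_bot (by omega)]
    simp only [zero_add, h0, coeff_one_expConv, one_mul, Nat.sub_zero]
    ring
  rw [hR, hcoeff, map_sub, map_add, map_add]
  push_cast
  rw [abs_neg]
  set τ := PowerSeries.coeff n expDiv - PowerSeries.coeff n (bernDiff (-Polynomial.X)) with hτ
  set S := ∑ k ∈ Finset.Ico 3 (n + 1), PowerSeries.coeff k expConv *
    PowerSeries.coeff (n - k) expDiv with hS
  have b1 : ((n : ℝ) - 1) * nrm τ ≤ 6 * growth n := by
    have h := nrm_coeff_expDiv_sub_le (n := n - 1) (by omega)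
    rw [Nat.sub_add_cancel (by omega), Nat.cast_sub (by omega), Nat.cast_one] at h
    exact h
  have b2 := abs_truncPoly_linear_le hn
  have b3 := sub_one_mul_prodTerm_two_le hn
  have b4 := sum_prodTerm_le hn
  have b5 := nrm_elem_le_growth hn
  have c1 := abs_truncPoly_le τ
  have c2 := abs_truncPoly_le (PowerSeries.coeff 2 expConv * PowerSeries.coeff (n - 2) expDiv + S)
  have c3 := abs_truncPoly_le (elem n)
  have c4 : nrm S ≤ ∑ k ∈ Finset.Ico 3 (n + 1), prodTerm n k :=
    (nrm_sum_le _ _).trans (Finset.sum_le_sum fun k _ => nrm_mul_le _ _)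
  have c5 : nrm (PowerSeries.coeff 2 expConv * PowerSeries.coeff (n - 2) expDiv) ≤ prodTerm n 2 :=
    nrm_mul_le _ _
  have c6 := nrm_add_le (PowerSeries.coeff 2 expConv * PowerSeries.coeff (n - 2) expDiv) S
  generalize ((truncPoly 10 τ : ℚ) : ℝ) = x1 at *
  generalize ((truncPoly 10 ((Polynomial.X - 1) * PowerSeries.coeff (n - 1) expDiv) : ℚ) : ℝ) =
    x2 at *
  generalize ((truncPoly 10 (PowerSeries.coeff 2 expConv * PowerSeries.coeff (n - 2) expDiv + S) :
    ℚ) : ℝ) = x3 at *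
  generalize ((truncPoly 10 (elem n) : ℚ) : ℝ) = x4 at *
  have habs : |x1 + x2 + x3 - x4| ≤ nrm τ + |x2| + (prodTerm n 2 +
      ∑ k ∈ Finset.Ico 3 (n + 1), prodTerm n k) + nrm (elem n) := by
    have a1 := abs_sub (x1 + x2 + x3) x4
    have a2 := abs_add_le (x1 + x2) x3
    have a3 := abs_add_le x1 x2
    linarith
  -- The contributions add up to `6 + 89 + 273 + 199 + 1 = 568`.
  have := mul_le_mul_of_nonneg_left habs (show (0 : ℝ) ≤ (n : ℝ) - 1 by linarith)
  linarith

lemma relError_succ_le {n : ℕ} (hn : 599 ≤ n) : relError (n + 1) ≤ 3771 / ((n : ℝ) - 1) := by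
  have hn' : (599 : ℝ) ≤ n := by exact_mod_cast hn
  have hg := growth_pos n
  have h := abs_Rcoeff_le hn
  have e : ((n + 1 - 2).factorial : ℝ) * ((2 * Real.pi) ^ (n + 1))⁻¹ =
      growth n / (2 * Real.pi) := by
    rw [growth, show n + 1 - 2 = n - 1 by omega]
    field_simp
    ring
  rw [relError, e, div_div_eq_mul_div, div_le_div_iff₀ hg (by linarith)]
  calc |(Rcoeff (n + 1) : ℝ)| * (2 * Real.pi) * ((n : ℝ) - 1) =
        2 * Real.pi * (((n : ℝ) - 1) * |(Rcoeff (n + 1) : ℝ)|) := by ring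
    _ ≤ 2 * Real.pi * (600 * growth n) := by gcongr
    _ = 2 * Real.pi * 600 * growth n := by ring
    -- Since `2π · 600 < 3771`.
    _ ≤ 3771 * growth n := by
        gcongr
        linarith [Real.pi_lt_d4]

lemma relError_nonneg (g : ℕ) : 0 ≤ relError g := by
  rw [relError]
  positivity

lemma tendsto_relError : Filter.Tendsto relError Filter.atTop (nhds 0) := by
  refine squeeze_zero' (Filter.Eventually.of_forall relError_nonneg) ?_
    -- Twice `3771`, to pass from the denominator `g - 2` to `g`.
    (tendsto_const_div_atTop_nhds_zero_nat 7542)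
  filter_upwards [Filter.eventually_ge_atTop 600] with g hg
  obtain ⟨n, rfl⟩ := Nat.exists_eq_add_of_le' (show 1 ≤ g by omega)
  have hn' : (599 : ℝ) ≤ n := by exact_mod_cast (by omega : 599 ≤ n)
  refine (relError_succ_le (by omega)).trans ?_
  push_cast
  rw [div_le_div_iff₀ (by linarith) (by linarith)]
  linarith

/-! ### Numerical lower bounds for the two constants -/

lemma pi_sq_bounds : 9.8696 ≤ Real.pi ^ 2 ∧ Real.pi ^ 2 ≤ 9.86961 := by
  have h1 := Real.pi_gt_d6
  have h2 := Real.pi_lt_d6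
  have h0 := Real.pi_pos
  constructor
  · calc (9.8696 : ℝ) ≤ 3.141592 ^ 2 := by norm_num
      _ ≤ _ := by gcongr
  · calc Real.pi ^ 2 ≤ 3.141593 ^ 2 := by gcongr
      _ ≤ _ := by norm_num

/-- The polynomial in `π²` alternates in sign, so even and odd powers are bounded from opposite
sides. The cancellation is strong, which is why six decimals of `π` are used. -/
lemma le_Cev : 12.8 ≤ Cev := by
  obtain ⟨h1, h2⟩ := pi_sq_bounds
  have e4 : Real.pi ^ 4 = (Real.pi ^ 2) ^ 2 := by ring
  have e6 : Real.pi ^ 6 = (Real.pi ^ 2) ^ 3 := by ring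
  have e8 : Real.pi ^ 8 = (Real.pi ^ 2) ^ 4 := by ring
  rw [Cev, e4, e6, e8]
  generalize Real.pi ^ 2 = p at *
  have a4 : 9.8696 ^ 2 ≤ p ^ 2 := by gcongr
  have a6 : p ^ 3 ≤ 9.86961 ^ 3 := by gcongr
  have a8 : 9.8696 ^ 4 ≤ p ^ 4 := by gcongr
  have hin : 4610 ≤ 14175 - 4725 * p + 630 * p ^ 2 - 45 * p ^ 3 + 2 * p ^ 4 := by
    norm_num at a4 a6 a8
    linarith
  have h10 : (Nat.factorial 10 : ℝ) = 3628800 := by norm_num [Nat.factorial]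
  rw [h10]
  calc (12.8 : ℝ) ≤ 1 / 3628800 * 1024 * 9.8696 * 4610 := by norm_num
    _ ≤ _ := by gcongr

lemma le_Codd : 12.8 ≤ Codd := by
  obtain ⟨h1, h2⟩ := pi_sq_bounds
  have h3 := Real.pi_gt_three
  have e4 : Real.pi ^ 4 = (Real.pi ^ 2) ^ 2 := by ring
  have e6 : Real.pi ^ 6 = (Real.pi ^ 2) ^ 3 := by ring
  rw [Codd, e4, e6]
  generalize Real.pi ^ 2 = p at *
  have a4 : p ^ 2 ≤ 9.86961 ^ 2 := by gcongr
  have a6 : 9.8696 ^ 3 ≤ p ^ 3 := by gcongr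
  have hin : 120 ≤ -945 + 189 * p - 18 * p ^ 2 + p ^ 3 := by
    norm_num at a4 a6
    linarith
  have h10 : (Nat.factorial 10 : ℝ) = 3628800 := by norm_num [Nat.factorial]
  rw [h10]
  calc (12.8 : ℝ) ≤ 4 * 3 / 3628800 * 1280 * (2835 + 2 * 9.8696 * 120) := by norm_num
    _ ≤ _ := by gcongr

end WeightEleven

end

theorem theorem6p2 :
    Filter.Tendsto WeightEleven.relError Filter.atTop (nhds 0) ∧
      ∀ g : ℕ, 600 ≤ g →
        WeightEleven.relError g ≤ 1 / 2 * min WeightEleven.Cev WeightEleven.Codd := by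
  refine ⟨WeightEleven.tendsto_relError, fun g hg => ?_⟩
  obtain ⟨n, rfl⟩ := Nat.exists_eq_add_of_le' (show 1 ≤ g by omega)
  have hn : (599 : ℝ) ≤ n := by exact_mod_cast (by omega : 599 ≤ n)
  have h1 := le_min WeightEleven.le_Cev WeightEleven.le_Codd
  calc WeightEleven.relError (n + 1) ≤ 3771 / ((n : ℝ) - 1) :=
        WeightEleven.relError_succ_le (by omega)
    -- At `g = 600` the bound is about `6.31`, against `12.8/2 = 6.4`.
    _ ≤ 3771 / 598 := by
        gcongr
        linarith
    _ ≤ 1 / 2 * 12.8 := by norm_num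
    _ ≤ _ := by gcongr
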